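/- Let $\mathbb K$ be an algebraically closed field of characteristic $p>0$ and let $G$ be a connected reductive algebraic group over $\mathbb K$ with Lie algebra $\mathfrak g$ and $p$-th power map $x\mapsto x^{[p]}$. Let $T$ be a maximal torus of $G$ and $B\supseteq T$ a Borel subgroup, with Lie algebras $\mathfrak t$ and $\mathfrak b$; let $\Phi\subseteq X(T)$ be the roots of $G$ with respect to $T$, let $\Phi^+=\{\gamma_1,\dots,\gamma_D\}$ be the positive roots corresponding to $B$, enumerated in any order, and let $\mathfrak n^+=\bigoplus_{\alpha\in\Phi^+}\mathfrak g_\alpha$, so that $\mathfrak b=\mathfrak t\oplus\mathfrak n^+$. A Chevalley basis of $\mathfrak g$ (a basis of $\mathfrak t$ coming from a basis of the cocharacter group of $T$, and root vectors $e_\alpha\in\mathfrak g_\alpha$, $\alpha\in\Phi$) is fixed. The differential $\mathfrak t\to\mathbb K$ of a root $\gamma$ is also denoted $\gamma$. For $\chi\in\mathfrak g^*$ let $U_\chi(\mathfrak g)$ be the quotient of the universal enveloping algebra $U(\mathfrak g)$ by the two-sided ideal generated by all $x^p-x^{[p]}-\chi(x)^p$, $x\in\mathfrak g$, and define $U_\chi(\mathfrak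 b)$ in the same way from $\chi|_{\mathfrak b}$. Put $\Lambda_\chi=\{\lambda\in\mathfrak t^*\mid \lambda(h)^p-\lambda(h^{[p]})=\chi(h)^p\text{ for all }h\in\mathfrak t\}$. If $\chi(\mathfrak n^+)=0$ and $\lambda\in\Lambda_\chi$, let $\mathbb K_\lambda$ be the one-dimensional $U_\chi(\mathfrak b)$-module on which $\mathfrak n^+$ acts as zero and $\mathfrak t$ acts through $\lambda$, and let $Z_\chi(\lambda)=U_\chi(\mathfrak g)\otimes_{U_\chi(\mathfrak b)}\mathbb K_\lambda$ (the baby Verma module). For $\chi,\chi'\in\mathfrak g^*$ the tensor product over $\mathbb K$ of a $U_\chi(\mathfrak g)$-module and a $U_{\chi'}(\mathfrak g)$-module is a $U_{\chi+\chi'}(\mathfrak g)$-module, with $x(m\otimes n)=xm\otimes n+m\otimes xn$ for $x\in\mathfrak g$. **Theorem.** Let $\chi,\chi'\in\mathfrak g^*$ with $\chi(\mathfrak n^+)=\chi'(\mathfrak n^+)=0$, and let $\lambda\in\Lambda_\chi$ and $\mu\in\Lambda_{\chi'}$. Then there are a filtration $$0=W_0\subseteq W_1\subseteq\cdots\subseteq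 W_{p^D}=Z_\chi(\lambda)\otimes Z_{\chi'}(\mu)$$ by $U_{\chi+\chi'}(\mathfrak g)$-submodules and a bijection $i\mapsto(b_1,\dots,b_D)$ from $\{1,\dots,p^D\}$ to $\{0,1,\dots,p-1\}^D$ such that, for each $i$, $\lambda+\mu-b_D\gamma_D-\cdots-b_1\gamma_1$ lies in $\Lambda_{\chi+\chi'}$ and $$W_i/W_{i-1}\;\cong\;Z_{\chi+\chi'}(\lambda+\mu-b_D\gamma_D-\cdots-b_1\gamma_1)$$ as $U_{\chi+\chi'}(\mathfrak g)$-modules. In particular, the successive quotients are precisely these baby Verma modules, each tuple occurring exactly once. -/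

import Mathlib

noncomputable section

namespace ReducedRep

open scoped TensorProduct

attribute [local instance] LieRing.ofAssociativeRing

/-! ### Linear algebraic groups and their Lie algebras -/

section Groups

variable {K : Type*} [Field K] {N : ℕ}

/-- Polynomials in the entries of a matrix `g` (variables `Sum.inl (i, j)`) and of its inverse
(variables `Sum.inr (i, j)`). Restricted to `GL N`, these are exactly the regular functions. -/
abbrev Coord (K : Type*) [Field K] (N : ℕ) : Type _ :=
  MvPolynomial ((Fin N × Fin N) ⊕ (Fin N × Fin N)) K

/-- The entries of `g` and of `g⁻¹`. -/
def entries (g : GL (Fin N) K) : (Fin N × Fin N) ⊕ (Fin N × Fin N) → K :=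
  Sum.elim (fun ij => (g : Matrix (Fin N) (Fin N) K) ij.1 ij.2)
    (fun ij => ((g⁻¹ : GL (Fin N) K) : Matrix (Fin N) (Fin N) K) ij.1 ij.2)

/-- The value at `g` of the regular function given by `f`. -/
def evalAt (g : GL (Fin N) K) : Coord K N →ₐ[K] K := MvPolynomial.aeval (entries g)

/-- The derivative at the identity of the regular function given by `f`, in the direction of the
matrix `X`; the entries of the inverse move in the direction `-X`. -/
def diffOne (f : Coord K N) : Matrix (Fin N) (Fin N) K →ₗ[K] K where
  toFun X := ∑ ij : Fin N × Fin N, X ij.1 ij.2 *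
    (evalAt 1 (MvPolynomial.pderiv (Sum.inl ij) f) - evalAt 1 (MvPolynomial.pderiv (Sum.inr ij) f))
  map_add' X Y := by simp [add_mul, Finset.sum_add_distrib]
  map_smul' c X := by simp [Finset.mul_sum, mul_assoc]

/-- Zariski closed subsets of `GL N`. -/
def IsZariskiClosed (Z : Set (GL (Fin N) K)) : Prop :=
  ∃ I : Set (Coord K N), Z = {g | ∀ f ∈ I, evalAt g f = 0}

/-- Connectedness in the Zariski topology. -/
def IsZariskiConnected (Z : Set (GL (Fin N) K)) : Prop :=
  Z.Nonempty ∧ ∀ Z₁ Z₂ : Set (GL (Fin N) K), IsZariskiClosed Z₁ → IsZariskiClosed Z₂ →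
    Z ⊆ Z₁ ∪ Z₂ → Z ∩ (Z₁ ∩ Z₂) = ∅ → Z ⊆ Z₁ ∨ Z ⊆ Z₂

/-- The left invariant derivation attached to the matrix `X`. -/
def leftDer (X : Matrix (Fin N) (Fin N) K) : Derivation K (Coord K N) (Coord K N) :=
  MvPolynomial.mkDerivation K (Sum.elim
    (fun ij => ∑ k, MvPolynomial.X (Sum.inl (ij.1, k)) * MvPolynomial.C (X k ij.2))
    (fun ij => -∑ k, MvPolynomial.C (X ij.1 k) * MvPolynomial.X (Sum.inr (k, ij.2))))

theorem leftDer_C (X : Matrix (Fin N) (Fin N) K) (a : K) :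
    leftDer X (MvPolynomial.C a) = 0 := MvPolynomial.derivation_C _ a

theorem leftDer_mul_C (X : Matrix (Fin N) (Fin N) K) (f : Coord K N) (a : K) :
    leftDer X (f * MvPolynomial.C a) = leftDer X f * MvPolynomial.C a := by
  rw [Derivation.leibniz, leftDer_C, smul_zero, zero_add, smul_eq_mul, mul_comm]

theorem leftDer_C_mul (X : Matrix (Fin N) (Fin N) K) (f : Coord K N) (a : K) :
    leftDer X (MvPolynomial.C a * f) = MvPolynomial.C a * leftDer X f := by
  rw [mul_comm, leftDer_mul_C, mul_comm]

theorem leftDer_inl (X : Matrix (Fin N) (Fin N) K) (i j : Fin N) :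
    leftDer X (MvPolynomial.X (Sum.inl (i, j))) =
      ∑ k, MvPolynomial.X (Sum.inl (i, k)) * MvPolynomial.C (X k j) := by
  simp [leftDer]

theorem leftDer_inr (X : Matrix (Fin N) (Fin N) K) (i j : Fin N) :
    leftDer X (MvPolynomial.X (Sum.inr (i, j))) =
      -∑ k, MvPolynomial.C (X i k) * MvPolynomial.X (Sum.inr (k, j)) := by
  simp [leftDer]

/-- Left translation by `g` on regular functions. -/
def leftTrans (g : GL (Fin N) K) : Coord K N →ₐ[K] Coord K N :=
  MvPolynomial.aeval (Sum.elim
    (fun ij => ∑ k, MvPolynomial.C ((g : Matrix (Fin N) (Fin N) K) ij.1 k) *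
      MvPolynomial.X (Sum.inl (k, ij.2)))
    (fun ij => ∑ k, MvPolynomial.X (Sum.inr (ij.1, k)) *
      MvPolynomial.C (((g⁻¹ : GL (Fin N) K) : Matrix (Fin N) (Fin N) K) k ij.2)))

theorem evalAt_leftTrans (g h : GL (Fin N) K) (f : Coord K N) :
    evalAt h (leftTrans g f) = evalAt (g * h) f := by
  have : (evalAt h).comp (leftTrans g) = evalAt (g * h) := by
    apply MvPolynomial.algHom_ext
    rintro (⟨i, j⟩ | ⟨i, j⟩) <;>
    simp [evalAt, leftTrans, entries, Matrix.mul_apply, MvPolynomial.aeval_X]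
  exact DFunLike.congr_fun this f

theorem leftTrans_leftDer (g : GL (Fin N) K) (X : Matrix (Fin N) (Fin N) K) (f : Coord K N) :
    leftTrans g (leftDer X f) = leftDer X (leftTrans g f) := by
  induction f using MvPolynomial.induction_on with
  | C a =>
    simp [leftDer, leftTrans]
  | add p q hp hq => simp [hp, hq]
  | mul_X p v hp =>
    have hv : leftTrans g (leftDer X (MvPolynomial.X v)) =
        leftDer X (leftTrans g (MvPolynomial.X v)) := by
      rcases v with ⟨i, j⟩ | ⟨i, j⟩
      · simp only [leftDer_inl, leftTrans, map_sum, map_mul, MvPolynomial.aeval_X, Sum.elim_inl,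
          leftDer_C_mul, MvPolynomial.algHom_C, MvPolynomial.algebraMap_eq, Finset.sum_mul,
          Finset.mul_sum]
        rw [Finset.sum_comm]
        simp only [mul_assoc]
      · simp only [leftDer_inr, leftTrans, map_sum, map_mul, map_neg, MvPolynomial.aeval_X,
          Sum.elim_inr, leftDer_mul_C, MvPolynomial.algHom_C, MvPolynomial.algebraMap_eq,
          Finset.sum_mul, Finset.mul_sum, neg_mul, Finset.sum_neg_distrib]
        rw [Finset.sum_comm]
        simp only [mul_assoc]
    rw [Derivation.leibniz, map_mul, Derivation.leibniz, map_add, smul_eq_mul, smul_eq_mul,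
      smul_eq_mul, smul_eq_mul, map_mul, map_mul, hp, hv]

theorem evalAt_one_leftDer (X : Matrix (Fin N) (Fin N) K) (f : Coord K N) :
    evalAt 1 (leftDer X f) = diffOne f X := by
  induction f using MvPolynomial.induction_on with
  | C a => simp [leftDer, diffOne]
  | add p q hp hq =>
    rw [map_add, map_add, hp, hq]
    simp only [diffOne, LinearMap.coe_mk, AddHom.coe_mk, map_add, ← Finset.sum_add_distrib]
    exact Finset.sum_congr rfl fun _ _ => by ring
  | mul_X p v hp =>
    have key : evalAt 1 (leftDer X (MvPolynomial.X v)) = diffOne (MvPolynomial.X v) X := by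
      rcases v with ⟨i, j⟩ | ⟨i, j⟩
      · simp [leftDer, diffOne, evalAt, entries, MvPolynomial.pderiv_X, Pi.single_apply,
          Matrix.one_apply, apply_ite]
      · simp [leftDer, diffOne, evalAt, entries, MvPolynomial.pderiv_X, Pi.single_apply,
          Matrix.one_apply, apply_ite]
    have hm : diffOne (p * MvPolynomial.X v) X =
        evalAt 1 p * diffOne (MvPolynomial.X v) X + evalAt 1 (MvPolynomial.X v) * diffOne p X := by
      simp only [diffOne, LinearMap.coe_mk, AddHom.coe_mk, Finset.mul_sum,
        ← Finset.sum_add_distrib, Derivation.leibniz, map_add, smul_eq_mul, map_mul]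
      exact Finset.sum_congr rfl fun _ _ => by ring
    rw [hm, Derivation.leibniz, map_add, smul_eq_mul, smul_eq_mul, map_mul, map_mul, hp, key]

/-- The matrix `X` is tangent at the identity to the Zariski closure of `G`. -/
def IsTangent (G : Set (GL (Fin N) K)) (X : Matrix (Fin N) (Fin N) K) : Prop :=
  ∀ f : Coord K N, (∀ g ∈ G, evalAt g f = 0) → diffOne f X = 0

theorem isTangent_iff (G : Subgroup (GL (Fin N) K)) (X : Matrix (Fin N) (Fin N) K) :
    IsTangent (G : Set (GL (Fin N) K)) X ↔
      ∀ f : Coord K N, (∀ g ∈ G, evalAt g f = 0) → ∀ g ∈ G, evalAt g (leftDer X f) = 0 := by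
  constructor
  · intro h f hf g hg
    have := h (leftTrans g f) fun k hk => by
      rw [evalAt_leftTrans]; exact hf _ (G.mul_mem hg hk)
    rw [← mul_one g, ← evalAt_leftTrans, leftTrans_leftDer, evalAt_one_leftDer, this]
  · intro h f hf
    rw [← evalAt_one_leftDer]
    exact h f hf 1 G.one_mem

theorem leftDer_leftDer_inl (X Y : Matrix (Fin N) (Fin N) K) (i j : Fin N) :
    leftDer X (leftDer Y (MvPolynomial.X (Sum.inl (i, j)))) =
      ∑ k, MvPolynomial.X (Sum.inl (i, k)) * MvPolynomial.C ((X * Y) k j) := by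
  rw [leftDer_inl]
  simp only [map_sum, leftDer_mul_C, leftDer_inl, Matrix.mul_apply, map_mul, Finset.mul_sum,
    Finset.sum_mul, mul_assoc]
  rw [Finset.sum_comm]

theorem leftDer_leftDer_inr (X Y : Matrix (Fin N) (Fin N) K) (i j : Fin N) :
    leftDer X (leftDer Y (MvPolynomial.X (Sum.inr (i, j)))) =
      ∑ k, MvPolynomial.C ((Y * X) i k) * MvPolynomial.X (Sum.inr (k, j)) := by
  rw [leftDer_inr]
  simp only [map_sum, map_neg, leftDer_C_mul, leftDer_inr, Matrix.mul_apply, map_mul, mul_neg,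
    Finset.mul_sum, Finset.sum_mul, mul_assoc, Finset.sum_neg_distrib, neg_neg]
  rw [Finset.sum_comm]

theorem leftDer_lie (X Y : Matrix (Fin N) (Fin N) K) (f : Coord K N) :
    leftDer (X * Y - Y * X) f = leftDer X (leftDer Y f) - leftDer Y (leftDer X f) := by
  have : leftDer (X * Y - Y * X) = ⁅leftDer X, leftDer Y⁆ := by
    apply MvPolynomial.derivation_ext
    rintro (⟨i, j⟩ | ⟨i, j⟩)
    · rw [Derivation.commutator_apply, leftDer_leftDer_inl, leftDer_leftDer_inl, leftDer_inl,
        ← Finset.sum_sub_distrib]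
      refine Finset.sum_congr rfl fun k _ => ?_
      rw [Matrix.sub_apply, map_sub, mul_sub]
    · rw [Derivation.commutator_apply, leftDer_leftDer_inr, leftDer_leftDer_inr, leftDer_inr,
        ← Finset.sum_sub_distrib, ← Finset.sum_neg_distrib]
      refine Finset.sum_congr rfl fun k _ => ?_
      rw [Matrix.sub_apply, map_sub, sub_mul, neg_sub]
  rw [this, Derivation.commutator_apply]

/-- In characteristic `p` the `p`-th power of a derivation is a derivation. -/
theorem iterate_leibniz {A : Type*} [CommRing A] [Algebra K A] (p : ℕ) [Fact p.Prime] [CharP K p]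
    (D : Derivation K A A) (a b : A) :
    ((D : A →ₗ[K] A) ^ p) (a * b) =
      a * ((D : A →ₗ[K] A) ^ p) b + b * ((D : A →ₗ[K] A) ^ p) a := by
  rcases subsingleton_or_nontrivial A with hA | hA
  · exact Subsingleton.elim _ _
  let L : Module.End K A := (D : A →ₗ[K] A)
  let d₁ : Module.End K (A ⊗[K] A) := TensorProduct.map L LinearMap.id
  let d₂ : Module.End K (A ⊗[K] A) := TensorProduct.map LinearMap.id L
  have hc : Commute d₁ d₂ := by
    apply TensorProduct.ext'
    intro x y
    simp [d₁, d₂]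
  have : CharP (Module.End K (A ⊗[K] A)) p :=
    charP_of_injective_algebraMap (FaithfulSMul.algebraMap_injective K _) p
  have h1 : ∀ (n : ℕ) (z : A ⊗[K] A),
      LinearMap.mul' K A (((d₁ + d₂) ^ n) z) = (L ^ n) (LinearMap.mul' K A z) := by
    intro n
    induction n with
    | zero => simp
    | succ n ih =>
      intro z
      rw [pow_succ, pow_succ, Module.End.mul_apply, Module.End.mul_apply, ih]
      congr 1
      induction z using TensorProduct.induction_on with
      | zero => simp
      | tmul x y => simp [d₁, d₂, L, mul_comm, add_comm]
      | add x y hx hy => rw [map_add, map_add, map_add, map_add, hx, hy]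
  have h2 : ∀ (n : ℕ) (x y : A), (d₁ ^ n) (x ⊗ₜ y) = ((L ^ n) x) ⊗ₜ y := by
    intro n
    induction n with
    | zero => simp
    | succ n ih => intro x y; rw [pow_succ, pow_succ]; exact ih (L x) y
  have h3 : ∀ (n : ℕ) (x y : A), (d₂ ^ n) (x ⊗ₜ y) = x ⊗ₜ ((L ^ n) y) := by
    intro n
    induction n with
    | zero => simp
    | succ n ih => intro x y; rw [pow_succ, pow_succ]; exact ih x (L y)
  have := h1 p (a ⊗ₜ b)
  rw [add_pow_char_of_commute _ hc, LinearMap.add_apply, h2, h3] at this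
  simp only [map_add, LinearMap.mul'_apply] at this
  rw [← this]
  ring

theorem leftDer_pow_X (X : Matrix (Fin N) (Fin N) K) (n : ℕ) (i j : Fin N) :
    ((leftDer X : Coord K N →ₗ[K] Coord K N) ^ n) (MvPolynomial.X (Sum.inl (i, j))) =
      ∑ k, MvPolynomial.X (Sum.inl (i, k)) * MvPolynomial.C ((X ^ n) k j) := by
  induction n with
  | zero => simp [Matrix.one_apply, apply_ite]
  | succ n ih =>
    rw [pow_succ', Module.End.mul_apply, ih, pow_succ']
    simp only [Derivation.coeFn_coe, map_sum, leftDer_mul_C, leftDer_inl, Matrix.mul_apply, map_mul,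
      Finset.mul_sum, Finset.sum_mul, mul_assoc]
    rw [Finset.sum_comm]

theorem leftDer_pow_X' (X : Matrix (Fin N) (Fin N) K) (n : ℕ) (i j : Fin N) :
    ((leftDer X : Coord K N →ₗ[K] Coord K N) ^ n) (MvPolynomial.X (Sum.inr (i, j))) =
      (-1) ^ n * ∑ k, MvPolynomial.C ((X ^ n) i k) * MvPolynomial.X (Sum.inr (k, j)) := by
  induction n with
  | zero => simp [Matrix.one_apply, apply_ite]
  | succ n ih =>
    have h1 : ((-1 : Coord K N) ^ n) = MvPolynomial.C ((-1) ^ n) := by simp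
    rw [pow_succ', Module.End.mul_apply, ih, pow_succ (-1 : Coord K N), h1, pow_succ X]
    simp only [Derivation.coeFn_coe, leftDer_C_mul, map_sum, leftDer_inr, Matrix.mul_apply, map_mul,
      Finset.mul_sum, Finset.sum_mul, mul_neg, mul_one, neg_mul, Finset.sum_neg_distrib, mul_assoc]
    rw [Finset.sum_comm]

theorem leftDer_pow_char (p : ℕ) [Fact p.Prime] [CharP K p]
    (X : Matrix (Fin N) (Fin N) K) (f : Coord K N) :
    leftDer (X ^ p) f = ((leftDer X : Coord K N →ₗ[K] Coord K N) ^ p) f := by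
  let E : Derivation K (Coord K N) (Coord K N) :=
    Derivation.mk' ((leftDer X : Coord K N →ₗ[K] Coord K N) ^ p) fun a b => by
      simpa using iterate_leibniz p (leftDer X) a b
  have : leftDer (X ^ p) = E := by
    apply MvPolynomial.derivation_ext
    rintro (⟨i, j⟩ | ⟨i, j⟩)
    · exact (leftDer_inl _ i j).trans (leftDer_pow_X X p i j).symm
    · have h1 : (-1 : Coord K N) ^ p = -1 := neg_one_pow_expChar (Coord K N) p
      refine (leftDer_inr _ i j).trans ((leftDer_pow_X' X p i j).trans ?_).symm
      rw [h1, neg_one_mul]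
  rw [this]
  rfl

/-- The Lie algebra of (the Zariski closure of) a subgroup of `GL N`: its tangent space at the
identity, as a Lie subalgebra of the matrices under the commutator. -/
def lieAlg (G : Subgroup (GL (Fin N) K)) : LieSubalgebra K (Matrix (Fin N) (Fin N) K) where
  carrier := {X | IsTangent (G : Set (GL (Fin N) K)) X}
  zero_mem' := fun f _ => map_zero _
  add_mem' := fun hX hY f hf => by rw [map_add, hX f hf, hY f hf, add_zero]
  smul_mem' := fun c X hX f hf => by rw [map_smul, hX f hf, smul_zero]
  lie_mem' := by
    intro X Y hX hY
    change IsTangent _ (X * Y - Y * X)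
    have hX' := (isTangent_iff G X).1 hX
    have hY' := (isTangent_iff G Y).1 hY
    rw [isTangent_iff]
    intro f hf g hg
    rw [leftDer_lie, map_sub, hX' _ (hY' f hf) g hg, hY' _ (hX' f hf) g hg, sub_zero]

theorem mem_lieAlg {G : Subgroup (GL (Fin N) K)} {X : Matrix (Fin N) (Fin N) K} :
    X ∈ lieAlg G ↔ IsTangent (G : Set (GL (Fin N) K)) X := Iff.rfl

theorem lieAlg_mono {H G : Subgroup (GL (Fin N) K)} (h : H ≤ G) : lieAlg H ≤ lieAlg G :=
  fun _ hX f hf => hX f fun g hg => hf g (h hg)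

theorem pow_char_mem_lieAlg (p : ℕ) [Fact p.Prime] [CharP K p] (G : Subgroup (GL (Fin N) K))
    {X : Matrix (Fin N) (Fin N) K} (hX : X ∈ lieAlg G) : X ^ p ∈ lieAlg G := by
  have hX' := (isTangent_iff G X).1 hX
  refine (isTangent_iff G _).2 fun f hf => ?_
  rw [leftDer_pow_char p]
  generalize p = n
  induction n with
  | zero => simpa using hf
  | succ n ih =>
    intro g hg
    rw [pow_succ', Module.End.mul_apply]
    exact hX' _ ih g hg

/-- The restricted structure `x ↦ x^[p]` on the Lie algebra of `G`: the `p`-th power of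
matrices. -/
def pPow (p : ℕ) [Fact p.Prime] [CharP K p] (G : Subgroup (GL (Fin N) K)) (x : lieAlg G) :
    lieAlg G :=
  ⟨(x : Matrix (Fin N) (Fin N) K) ^ p, pow_char_mem_lieAlg p G x.2⟩

/-- A Zariski closed connected group of simultaneously diagonalizable matrices. -/
structure IsTorus (T : Subgroup (GL (Fin N) K)) : Prop where
  closed : IsZariskiClosed (T : Set (GL (Fin N) K))
  connected : IsZariskiConnected (T : Set (GL (Fin N) K))
  diagonalizable : ∃ P : GL (Fin N) K, ∀ t ∈ T,
    ((P * t * P⁻¹ : GL (Fin N) K) : Matrix (Fin N) (Fin N) K).IsDiag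

/-- A connected reductive group: a Zariski closed connected subgroup of `GL N` with no nontrivial
closed connected normal subgroup that consists of unipotent matrices. -/
structure IsReductive (G : Subgroup (GL (Fin N) K)) : Prop where
  closed : IsZariskiClosed (G : Set (GL (Fin N) K))
  connected : IsZariskiConnected (G : Set (GL (Fin N) K))
  unipotentRadical : ∀ U : Subgroup (GL (Fin N) K), U ≤ G → (U.subgroupOf G).Normal →
    IsZariskiClosed (U : Set (GL (Fin N) K)) → IsZariskiConnected (U : Set (GL (Fin N) K)) →
    (∀ u ∈ U, IsNilpotent ((u : Matrix (Fin N) (Fin N) K) - 1)) → U = ⊥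

def IsMaximalTorus (G T : Subgroup (GL (Fin N) K)) : Prop :=
  Maximal (fun S : Subgroup (GL (Fin N) K) => S ≤ G ∧ IsTorus S) T

def IsBorel (G B : Subgroup (GL (Fin N) K)) : Prop :=
  Maximal (fun S : Subgroup (GL (Fin N) K) => S ≤ G ∧ IsZariskiClosed (S : Set (GL (Fin N) K)) ∧
    IsZariskiConnected (S : Set (GL (Fin N) K)) ∧ Group.IsSolvable S) B

/-! ### Characters, weight spaces and roots -/

/-- The character group `X(T)`, written additively: the homomorphisms `T → Kˣ` that are regular
functions. -/
def charGroup (T : Subgroup (GL (Fin N) K)) : AddSubgroup (Additive (T →* Kˣ)) where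
  carrier := {x | ∃ f : Coord K N, ∀ t : T, ((x.toMul t : Kˣ) : K) = evalAt (t : GL (Fin N) K) f}
  zero_mem' := ⟨1, fun t => by simp⟩
  add_mem' := by
    rintro x y ⟨f, hf⟩ ⟨g, hg⟩
    exact ⟨f * g, fun t => by simp [← hf, ← hg]⟩
  neg_mem' := by
    rintro x ⟨f, hf⟩
    refine ⟨MvPolynomial.rename Sum.swap f, fun t => ?_⟩
    have h1 : ∀ g : GL (Fin N) K, evalAt g (MvPolynomial.rename Sum.swap f) = evalAt g⁻¹ f := by
      intro g
      simp only [evalAt, MvPolynomial.aeval_rename]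
      congr 2
      funext v
      rcases v with v | v <;> simp [entries]
    rw [h1]
    have h2 := hf t⁻¹
    rw [map_inv] at h2
    simpa using h2

/-- The value of a character at an element of `T`. -/
def charVal {T : Subgroup (GL (Fin N) K)} (x : charGroup T) (t : T) : Kˣ :=
  (x : Additive (T →* Kˣ)).toMul t

/-- The differential `Lie T → K` at the identity of a character of `T`. -/
def charDiff {T : Subgroup (GL (Fin N) K)} (x : charGroup T) : Module.Dual K (lieAlg T) :=
  (diffOne x.2.choose).comp (lieAlg T).toSubmodule.subtype

/-- The differential may be computed from any regular function that restricts to the character. -/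
theorem charDiff_apply {T : Subgroup (GL (Fin N) K)} (x : charGroup T) (f : Coord K N)
    (hf : ∀ t : T, (charVal x t : K) = evalAt (t : GL (Fin N) K) f) (X : lieAlg T) :
    charDiff x X = diffOne f (X : Matrix (Fin N) (Fin N) K) := by
  have h := X.2 (x.2.choose - f) fun g hg => by
    rw [map_sub, ← hf ⟨g, hg⟩, ← x.2.choose_spec ⟨g, hg⟩]
    exact sub_self _
  have hsub : diffOne (x.2.choose - f) (X : Matrix (Fin N) (Fin N) K) =
      diffOne x.2.choose (X : Matrix (Fin N) (Fin N) K) -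
        diffOne f (X : Matrix (Fin N) (Fin N) K) := by
    simp only [← evalAt_one_leftDer, map_sub]
  rw [hsub, sub_eq_zero] at h
  exact h

/-- The matrices on which `T` acts by conjugation through the character `x`. -/
def wtSpace {T : Subgroup (GL (Fin N) K)} (x : charGroup T) :
    Submodule K (Matrix (Fin N) (Fin N) K) where
  carrier := {X | ∀ t : T, ((t : GL (Fin N) K) : Matrix (Fin N) (Fin N) K) * X *
    ((t : GL (Fin N) K)⁻¹ : GL (Fin N) K) = (charVal x t : K) • X}
  zero_mem' := fun t => by simp
  add_mem' := fun hX hY t => by rw [mul_add, add_mul, hX t, hY t, smul_add]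
  smul_mem' := fun c X hX t => by
    rw [mul_smul_comm, smul_mul_assoc, hX t, smul_comm]

/-- The weight space of weight `x` for the adjoint action of `T` on the Lie algebra of `G`. -/
def rootSpace (G : Subgroup (GL (Fin N) K)) {T : Subgroup (GL (Fin N) K)} (x : charGroup T) :
    Submodule K (Matrix (Fin N) (Fin N) K) :=
  (lieAlg G).toSubmodule ⊓ wtSpace x

/-- The roots of `G` with respect to `T`: the nonzero weights of `T` on the Lie algebra of `G`. -/
def IsRoot (G : Subgroup (GL (Fin N) K)) {T : Subgroup (GL (Fin N) K)} (x : charGroup T) : Prop :=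
  x ≠ 0 ∧ rootSpace G x ≠ ⊥

/-- The set of roots of `G` with respect to `T`, as a type. -/
abbrev Roots (G T : Subgroup (GL (Fin N) K)) : Type _ := {x : charGroup T // IsRoot G x}

/-- The cocharacter group `Y(T)`, identified with `Hom(X(T), ℤ)` through the perfect pairing. -/
abbrev cocharGroup (T : Subgroup (GL (Fin N) K)) : Type _ := Module.Dual ℤ (charGroup T)

/-- `P` is the root datum of `(G, T)`: the pairing is the natural one, the roots are the roots of
`G` with respect to `T`, and the coroots are (given by) cocharacters of `T` with values in the
derived subgroup of `G`. -/
structure IsRootDatumOf (G T : Subgroup (GL (Fin N) K))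
    (P : RootPairing (Roots G T) ℤ (charGroup T) (cocharGroup T)) : Prop where
  pairing : ∀ (x : charGroup T) (y : cocharGroup T), P.toLinearMap x y = y x
  root : ∀ α : Roots G T, P.root α = α.1
  coroot : ∀ α : Roots G T, ∃ σ : Kˣ →* T, (∀ s : Kˣ, (σ s : GL (Fin N) K) ∈ ⁅G, G⁆) ∧
    ∀ (s : Kˣ) (x : charGroup T), charVal x (σ s) = s ^ (P.coroot α x)

/-- The root `α` is a nonnegative integral combination of simple roots. -/
def IsPositive {G T : Subgroup (GL (Fin N) K)}
    {P : RootPairing (Roots G T) ℤ (charGroup T) (cocharGroup T)} (b : P.Base)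
    (α : Roots G T) : Prop :=
  P.root α ∈ AddSubmonoid.closure (P.root '' b.support)

/-- The sum of the root spaces of the positive roots. -/
def nPlus {G T : Subgroup (GL (Fin N) K)}
    {P : RootPairing (Roots G T) ℤ (charGroup T) (cocharGroup T)} (b : P.Base) :
    Submodule K (Matrix (Fin N) (Fin N) K) :=
  ⨆ α : {α : Roots G T // IsPositive b α}, rootSpace G α.1.1

/-- The family `h i`, `e α` is a Chevalley basis of the Lie algebra of `G`: the `h i` are the
derivatives of a basis of the cocharacter group, the `e α` are root vectors, and the brackets
satisfy the Chevalley relations. -/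
structure IsChevalleyBasis {G T : Subgroup (GL (Fin N) K)}
    (P : RootPairing (Roots G T) ℤ (charGroup T) (cocharGroup T)) {d : ℕ}
    (h : Module.Basis (Fin d) K (lieAlg T)) (c : Module.Basis (Fin d ⊕ Roots G T) K (lieAlg G)) :
    Prop where
  cochar : ∃ y : Module.Basis (Fin d) ℤ (cocharGroup T),
    ∀ (i : Fin d) (x : charGroup T), charDiff x (h i) = (y i x : K)
  toral : ∀ i : Fin d, (c (Sum.inl i) : Matrix (Fin N) (Fin N) K) = h i
  root_vector : ∀ α : Roots G T, (c (Sum.inr α) : Matrix (Fin N) (Fin N) K) ∈ rootSpace G α.1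
  lie_neg : ∀ α β : Roots G T, α.1 + β.1 = 0 → ∃ hα : lieAlg T,
    ((⁅c (Sum.inr α), c (Sum.inr β)⁆ : lieAlg G) : Matrix (Fin N) (Fin N) K) = hα ∧
      ∀ x : charGroup T, charDiff x hα = (P.coroot α x : K)
  lie_add : ∀ (α β γ : Roots G T) (r : ℕ), α.1 + β.1 = γ.1 →
    IsGreatest {k : ℕ | IsRoot G (β.1 - k • α.1)} r →
      ⁅c (Sum.inr α), c (Sum.inr β)⁆ = ((r : K) + 1) • c (Sum.inr γ) ∨
      ⁅c (Sum.inr α), c (Sum.inr β)⁆ = -(((r : K) + 1) • c (Sum.inr γ))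
  lie_zero : ∀ α β : Roots G T, α.1 + β.1 ≠ 0 → ¬ IsRoot G (α.1 + β.1) →
    ⁅c (Sum.inr α), c (Sum.inr β)⁆ = 0

variable (K N) in
/-- A connected reductive group `G` with a maximal torus `T` and a Borel subgroup `B ⊇ T`, together
with its root datum, the simple roots that correspond to `B`, and a Chevalley basis of its Lie
algebra. Only `G`, `B` and `T` are free choices: over an algebraically closed field the root datum
and the simple roots are determined by them, and Chevalley bases exist for each of them. -/
structure ReductiveSetup where
  G : Subgroup (GL (Fin N) K)
  T : Subgroup (GL (Fin N) K)
  B : Subgroup (GL (Fin N) K)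
  isReductive : IsReductive G
  isMaximalTorus : IsMaximalTorus G T
  isBorel : IsBorel G B
  torus_le : T ≤ B
  P : RootPairing (Roots G T) ℤ (charGroup T) (cocharGroup T)
  isRootDatum : IsRootDatumOf G T P
  base : P.Base
  /-- The positive roots are those of `B`. -/
  borel_eq : (lieAlg B).toSubmodule = (lieAlg T).toSubmodule ⊔ nPlus base
  d : ℕ
  h : Module.Basis (Fin d) K (lieAlg T)
  c : Module.Basis (Fin d ⊕ Roots G T) K (lieAlg G)
  isChevalley : IsChevalleyBasis P h c

end Groups

/-! ### Reduced enveloping algebras -/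

section Reduced

variable {K : Type*} [Field K] {N : ℕ} (p : ℕ) [Fact p.Prime] [CharP K p]

/-- The relations `x ^ p = x^[p] + χ(x) ^ p` in the universal enveloping algebra. -/
inductive RedRel (G : Subgroup (GL (Fin N) K)) (χ : Module.Dual K (lieAlg G)) :
    UniversalEnvelopingAlgebra K (lieAlg G) → UniversalEnvelopingAlgebra K (lieAlg G) → Prop
  | mk (x : lieAlg G) : RedRel G χ (UniversalEnvelopingAlgebra.ι K x ^ p)
      (UniversalEnvelopingAlgebra.ι K (pPow p G x) +
        algebraMap K (UniversalEnvelopingAlgebra K (lieAlg G)) (χ x ^ p))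

/-- The reduced enveloping algebra `U_χ(Lie G)`: the quotient of the universal enveloping algebra
by the two-sided ideal generated by the elements `x ^ p - x^[p] - χ(x) ^ p`. -/
abbrev RedEnv (G : Subgroup (GL (Fin N) K)) (χ : Module.Dual K (lieAlg G)) : Type _ :=
  RingQuot (RedRel p G χ)

/-- The canonical map from the Lie algebra to its reduced enveloping algebra. -/
def redι (G : Subgroup (GL (Fin N) K)) (χ : Module.Dual K (lieAlg G)) :
    lieAlg G →ₗ⁅K⁆ RedEnv p G χ :=
  (RingQuot.mkAlgHom K (RedRel p G χ) : _ →ₗ⁅K⁆ _).comp (UniversalEnvelopingAlgebra.ι K)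

theorem redι_pow (G : Subgroup (GL (Fin N) K)) (χ : Module.Dual K (lieAlg G)) (x : lieAlg G) :
    redι p G χ x ^ p = redι p G χ (pPow p G x) + algebraMap K (RedEnv p G χ) (χ x ^ p) := by
  have := RingQuot.mkAlgHom_rel K (RedRel.mk (p := p) (χ := χ) x)
  rw [map_pow, map_add, AlgHom.commutes] at this
  exact this

/-- The universal property of the reduced enveloping algebra. -/
def redLift (G : Subgroup (GL (Fin N) K)) (χ : Module.Dual K (lieAlg G)) {A : Type*} [Ring A]
    [Algebra K A] (f : lieAlg G →ₗ⁅K⁆ A)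
    (hf : ∀ x, f x ^ p = f (pPow p G x) + algebraMap K A (χ x ^ p)) : RedEnv p G χ →ₐ[K] A :=
  RingQuot.liftAlgHom K ⟨UniversalEnvelopingAlgebra.lift K f, by
    rintro _ _ ⟨x⟩
    rw [map_pow, map_add, AlgHom.commutes, UniversalEnvelopingAlgebra.lift_ι_apply,
      UniversalEnvelopingAlgebra.lift_ι_apply]
    exact hf x⟩

theorem redLift_ι (G : Subgroup (GL (Fin N) K)) (χ : Module.Dual K (lieAlg G)) {A : Type*} [Ring A]
    [Algebra K A] (f : lieAlg G →ₗ⁅K⁆ A)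
    (hf : ∀ x, f x ^ p = f (pPow p G x) + algebraMap K A (χ x ^ p)) (x : lieAlg G) :
    redLift p G χ f hf (redι p G χ x) = f x := by
  simp only [redLift, redι, LieHom.comp_apply, AlgHom.coe_toLieHom]
  rw [RingQuot.liftAlgHom_mkAlgHom_apply, UniversalEnvelopingAlgebra.lift_ι_apply]

/-- Restriction of a linear form on `Lie G` to the Lie algebra of a subgroup. -/
def resDual {H G : Subgroup (GL (Fin N) K)} (hHG : H ≤ G) (χ : Module.Dual K (lieAlg G)) :
    Module.Dual K (lieAlg H) :=
  χ.comp (LieSubalgebra.inclusion (lieAlg_mono hHG) : lieAlg H →ₗ[K] lieAlg G)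

/-- The natural map `U_χ(Lie H) → U_χ(Lie G)` for a subgroup `H` of `G`. -/
def redMap {H G : Subgroup (GL (Fin N) K)} (hHG : H ≤ G) (χ : Module.Dual K (lieAlg G)) :
    RedEnv p H (resDual hHG χ) →ₐ[K] RedEnv p G χ :=
  redLift p H (resDual hHG χ)
    ((redι p G χ).comp (LieSubalgebra.inclusion (lieAlg_mono hHG)))
    fun x => redι_pow p G χ (LieSubalgebra.inclusion (lieAlg_mono hHG) x)

end Reduced

/-! ### Induced modules and tensor products -/

section Induced

variable {K : Type*} [Field K] {A B : Type*} [Ring A] [Algebra K A] [Ring B] [Algebra K B]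

/-- The `B`-submodule of `B ⊗[K] M` generated by the elements `b φ(a) ⊗ m - b ⊗ a m`. -/
def inducedRel (φ : A →ₐ[K] B) (M : Type*) [AddCommGroup M] [Module K M] [Module A M] :
    Submodule B (B ⊗[K] M) :=
  Submodule.span B {z | ∃ (b : B) (a : A) (m : M), z = (b * φ a) ⊗ₜ[K] m - b ⊗ₜ[K] (a • m)}

/-- The induced module `B ⊗_A M` along an algebra homomorphism `φ : A → B`. -/
abbrev Induced (φ : A →ₐ[K] B) (M : Type*) [AddCommGroup M] [Module K M] [Module A M] : Type _ :=
  (B ⊗[K] M) ⧸ inducedRel φ M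

/-- The one-dimensional module `K` on which `A` acts through `f : A → K`. -/
def OneDim (_f : A →ₐ[K] K) : Type _ := K

instance (f : A →ₐ[K] K) : AddCommGroup (OneDim f) := inferInstanceAs (AddCommGroup K)

instance (f : A →ₐ[K] K) : Module K (OneDim f) := inferInstanceAs (Module K K)

instance (f : A →ₐ[K] K) : Module A (OneDim f) := Module.compHom K f.toRingHom

theorem OneDim.smul_def (f : A →ₐ[K] K) (a : A) (m : OneDim f) : a • m = f a • m := rfl

end Induced

section Tensor

variable {K : Type*} [Field K] {N : ℕ} (p : ℕ) [Fact p.Prime] [CharP K p]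

/-- The action of `Lie G` on `M ⊗ M'`: `x (m ⊗ m') = (x m) ⊗ m' + m ⊗ (x m')`. -/
def tensorLie (G : Subgroup (GL (Fin N) K)) (χ χ' : Module.Dual K (lieAlg G)) (M M' : Type*)
    [AddCommGroup M] [Module K M] [Module (RedEnv p G χ) M] [IsScalarTower K (RedEnv p G χ) M]
    [AddCommGroup M'] [Module K M'] [Module (RedEnv p G χ') M']
    [IsScalarTower K (RedEnv p G χ') M'] :
    lieAlg G →ₗ⁅K⁆ Module.End K (M ⊗[K] M') where
  toFun x := TensorProduct.map (Algebra.lsmul K K M (redι p G χ x)) LinearMap.id +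
    TensorProduct.map LinearMap.id (Algebra.lsmul K K M' (redι p G χ' x))
  map_add' x y := by
    simp only [map_add, TensorProduct.map_add_left, TensorProduct.map_add_right]
    abel
  map_smul' c x := by
    simp only [map_smul, TensorProduct.map_smul_left, TensorProduct.map_smul_right, smul_add,
      RingHom.id_apply]
  map_lie' := by
    intro x y
    apply TensorProduct.ext'
    intro m m'
    simp only [LieHom.map_lie, LieRing.of_associative_ring_bracket, map_sub, map_mul,
      LinearMap.add_apply, LinearMap.sub_apply, Module.End.mul_apply, TensorProduct.map_tmul,
      LinearMap.id_apply, map_add, TensorProduct.sub_tmul, TensorProduct.tmul_sub]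
    abel

theorem tensorLie_pow (G : Subgroup (GL (Fin N) K)) (χ χ' : Module.Dual K (lieAlg G)) (M M' : Type*)
    [AddCommGroup M] [Module K M] [Module (RedEnv p G χ) M] [IsScalarTower K (RedEnv p G χ) M]
    [AddCommGroup M'] [Module K M'] [Module (RedEnv p G χ') M']
    [IsScalarTower K (RedEnv p G χ') M'] (x : lieAlg G) :
    tensorLie p G χ χ' M M' x ^ p = tensorLie p G χ χ' M M' (pPow p G x) +
      algebraMap K (Module.End K (M ⊗[K] M')) ((χ + χ') x ^ p) := by
  rcases subsingleton_or_nontrivial (M ⊗[K] M') with hA | hA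
  · exact Subsingleton.elim _ _
  let L : Module.End K M := Algebra.lsmul K K M (redι p G χ x)
  let L' : Module.End K M' := Algebra.lsmul K K M' (redι p G χ' x)
  let d₁ : Module.End K (M ⊗[K] M') := TensorProduct.map L LinearMap.id
  let d₂ : Module.End K (M ⊗[K] M') := TensorProduct.map LinearMap.id L'
  have hc : Commute d₁ d₂ := by
    apply TensorProduct.ext'
    intro m m'
    simp [d₁, d₂]
  have : CharP (Module.End K (M ⊗[K] M')) p :=
    charP_of_injective_algebraMap (FaithfulSMul.algebraMap_injective K _) p
  have h2 : ∀ (n : ℕ) (m : M) (m' : M'), (d₁ ^ n) (m ⊗ₜ m') = ((L ^ n) m) ⊗ₜ m' := by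
    intro n
    induction n with
    | zero => simp
    | succ n ih => intro m m'; rw [pow_succ, pow_succ]; exact ih (L m) m'
  have h3 : ∀ (n : ℕ) (m : M) (m' : M'), (d₂ ^ n) (m ⊗ₜ m') = m ⊗ₜ ((L' ^ n) m') := by
    intro n
    induction n with
    | zero => simp
    | succ n ih => intro m m'; rw [pow_succ, pow_succ]; exact ih m (L' m')
  have hL : L ^ p = Algebra.lsmul K K M (redι p G χ (pPow p G x)) +
      algebraMap K (Module.End K M) (χ x ^ p) := by
    rw [← AlgHom.commutes (Algebra.lsmul K K M : RedEnv p G χ →ₐ[K] _), ← map_add, ← redι_pow, map_pow]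
  have hL' : L' ^ p = Algebra.lsmul K K M' (redι p G χ' (pPow p G x)) +
      algebraMap K (Module.End K M') (χ' x ^ p) := by
    rw [← AlgHom.commutes (Algebra.lsmul K K M' : RedEnv p G χ' →ₐ[K] _), ← map_add, ← redι_pow, map_pow]
  change (d₁ + d₂) ^ p = _
  rw [add_pow_char_of_commute _ hc]
  apply TensorProduct.ext'
  intro m m'
  rw [LinearMap.add_apply, h2, h3, hL, hL', LinearMap.add_apply χ χ', add_pow_char]
  simp only [tensorLie, LieHom.coe_mk, LinearMap.add_apply, TensorProduct.map_tmul,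
    LinearMap.id_apply, Module.algebraMap_end_apply, TensorProduct.add_tmul, TensorProduct.tmul_add,
    add_smul, TensorProduct.tmul_smul, TensorProduct.smul_tmul']
  abel

/-- The tensor product over `K` of a `U_χ(Lie G)`-module and a `U_χ'(Lie G)`-module, regarded as a
`U_{χ + χ'}(Lie G)`-module. -/
def TensorMod (G : Subgroup (GL (Fin N) K)) (χ χ' : Module.Dual K (lieAlg G)) (M M' : Type*)
    [AddCommGroup M] [Module K M] [Module (RedEnv p G χ) M] [IsScalarTower K (RedEnv p G χ) M]
    [AddCommGroup M'] [Module K M'] [Module (RedEnv p G χ') M']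
    [IsScalarTower K (RedEnv p G χ') M'] : Type _ :=
  M ⊗[K] M'

section

variable (G : Subgroup (GL (Fin N) K)) (χ χ' : Module.Dual K (lieAlg G)) (M M' : Type*)
  [AddCommGroup M] [Module K M] [Module (RedEnv p G χ) M] [IsScalarTower K (RedEnv p G χ) M]
  [AddCommGroup M'] [Module K M'] [Module (RedEnv p G χ') M']
  [IsScalarTower K (RedEnv p G χ') M']

instance : AddCommGroup (TensorMod p G χ χ' M M') := inferInstanceAs (AddCommGroup (M ⊗[K] M'))

instance : Module K (TensorMod p G χ χ' M M') := inferInstanceAs (Module K (M ⊗[K] M'))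

/-- The action of `U_{χ + χ'}(Lie G)` on `M ⊗ M'`. -/
def tensorAction : RedEnv p G (χ + χ') →ₐ[K] Module.End K (M ⊗[K] M') :=
  redLift p G (χ + χ') (tensorLie p G χ χ' M M') (tensorLie_pow p G χ χ' M M')

instance : Module (RedEnv p G (χ + χ')) (TensorMod p G χ χ' M M') :=
  Module.compHom (M ⊗[K] M') (tensorAction p G χ χ' M M').toRingHom

theorem redι_smul_tmul (x : lieAlg G) (m : M) (m' : M') :
    redι p G (χ + χ') x • (show TensorMod p G χ χ' M M' from m ⊗ₜ[K] m') =
      (redι p G χ x • m) ⊗ₜ[K] m' + m ⊗ₜ[K] (redι p G χ' x • m') := by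
  change tensorAction p G χ χ' M M' (redι p G (χ + χ') x) (m ⊗ₜ[K] m') = _
  rw [tensorAction, redLift_ι]
  rfl

end

end Tensor

/-! ### Weights and baby Verma modules -/

section Weights

variable {K : Type*} [Field K] {N : ℕ} {T : Subgroup (GL (Fin N) K)}

theorem charVal_add (x y : charGroup T) (t : T) : charVal (x + y) t = charVal x t * charVal y t :=
  rfl

theorem charVal_zero (t : T) : charVal (0 : charGroup T) t = 1 := rfl

theorem wtSpace_mul {x y : charGroup T} {X Y : Matrix (Fin N) (Fin N) K} (hX : X ∈ wtSpace x)
    (hY : Y ∈ wtSpace y) : X * Y ∈ wtSpace (x + y) := by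
  intro t
  have h1 := hX t
  have h2 := hY t
  have h3 : (((t : GL (Fin N) K)⁻¹ : GL (Fin N) K) : Matrix (Fin N) (Fin N) K) *
      ((t : GL (Fin N) K) : Matrix (Fin N) (Fin N) K) = 1 := by
    rw [← Units.val_mul, inv_mul_cancel, Units.val_one]
  generalize ((t : GL (Fin N) K) : Matrix (Fin N) (Fin N) K) = g at *
  generalize (((t : GL (Fin N) K)⁻¹ : GL (Fin N) K) : Matrix (Fin N) (Fin N) K) = g' at *
  calc g * (X * Y) * g' = (g * X * g') * (g * Y * g') := by
        simp only [mul_assoc]; rw [← mul_assoc g' g, h3, one_mul]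
    _ = _ := by
        rw [h1, h2, charVal_add, Units.val_mul, smul_mul_smul_comm]

/-- Conjugation by an element of `T`, as an endomorphism of the space of matrices. -/
def conjEnd (t : T) : Module.End K (Matrix (Fin N) (Fin N) K) where
  toFun X := ((t : GL (Fin N) K) : Matrix (Fin N) (Fin N) K) * X *
    ((t : GL (Fin N) K)⁻¹ : GL (Fin N) K)
  map_add' X Y := by rw [mul_add, add_mul]
  map_smul' c X := by rw [mul_smul_comm, smul_mul_assoc, RingHom.id_apply]

theorem torus_comm (hT : IsTorus T) (s t : T) : (s : GL (Fin N) K) * t = t * s := by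
  obtain ⟨P, hP⟩ := hT.diagonalizable
  have key : ∀ a b : GL (Fin N) K, (a : Matrix (Fin N) (Fin N) K).IsDiag →
      (b : Matrix (Fin N) (Fin N) K).IsDiag → a * b = b * a := by
    intro a b ha hb
    apply Units.ext
    rw [Units.val_mul, Units.val_mul, ← ha.diagonal_diag, ← hb.diagonal_diag,
      Matrix.diagonal_mul_diagonal, Matrix.diagonal_mul_diagonal]
    simp only [mul_comm]
  have h := key _ _ (hP s s.2) (hP t t.2)
  have h' : P * ((s : GL (Fin N) K) * t) * P⁻¹ = P * ((t : GL (Fin N) K) * s) * P⁻¹ := by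
    simpa only [mul_assoc, inv_mul_cancel_left] using h
  exact mul_left_cancel (mul_right_cancel h')

theorem wtSpace_indep (hT : IsTorus T) :
    iSupIndep (fun x : charGroup T => (wtSpace x : Submodule K (Matrix (Fin N) (Fin N) K))) := by
  have h1 := Module.End.independent_iInf_maxGenEigenspace_of_forall_mapsTo
    (fun t : T => (conjEnd t : Module.End K (Matrix (Fin N) (Fin N) K))) fun s t φ =>
      Module.End.mapsTo_maxGenEigenspace_of_comm (by
        apply LinearMap.ext
        intro X
        change (t : GL (Fin N) K) * ((s : GL (Fin N) K) * X * ((s : GL (Fin N) K)⁻¹ : GL (Fin N) K)) *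
          ((t : GL (Fin N) K)⁻¹ : GL (Fin N) K) = (s : GL (Fin N) K) * ((t : GL (Fin N) K) * X *
          ((t : GL (Fin N) K)⁻¹ : GL (Fin N) K)) * ((s : GL (Fin N) K)⁻¹ : GL (Fin N) K)
        have e1 : ((t : GL (Fin N) K) : Matrix (Fin N) (Fin N) K) * (s : GL (Fin N) K) =
            (s : GL (Fin N) K) * (t : GL (Fin N) K) := by
          rw [← Units.val_mul, ← Units.val_mul, torus_comm hT]
        have e2 : (((s : GL (Fin N) K)⁻¹ : GL (Fin N) K) : Matrix (Fin N) (Fin N) K) *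
            ((t : GL (Fin N) K)⁻¹ : GL (Fin N) K) =
            ((t : GL (Fin N) K)⁻¹ : GL (Fin N) K) * ((s : GL (Fin N) K)⁻¹ : GL (Fin N) K) := by
          rw [← Units.val_mul, ← Units.val_mul, ← mul_inv_rev, ← mul_inv_rev, torus_comm hT]
        calc _ = ((t : GL (Fin N) K) * (s : GL (Fin N) K)) * X *
              ((((s : GL (Fin N) K)⁻¹ : GL (Fin N) K) : Matrix (Fin N) (Fin N) K) *
            ((t : GL (Fin N) K)⁻¹ : GL (Fin N) K)) := by simp only [mul_assoc]
          _ = _ := by rw [e1, e2]; simp only [mul_assoc]) φ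
  have hinj : Function.Injective (fun (x : charGroup T) (t : T) => (charVal x t : K)) := by
    intro x y hxy
    apply Subtype.ext
    apply Additive.toMul.injective
    apply MonoidHom.ext
    intro t
    exact Units.ext (congrFun hxy t)
  refine (h1.comp hinj).mono fun x X hX => ?_
  rw [Function.comp_apply, Submodule.mem_iInf]
  intro t
  exact (Module.End.genEigenspace _ _).mono le_top
    (Module.End.mem_eigenspace_iff.2 (hX t))

/-- A matrix that commutes with `T` commutes with the Lie algebra of `T`. -/
theorem lieAlg_comm_of_comm {A X : Matrix (Fin N) (Fin N) K} (hX : X ∈ lieAlg T)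
    (hA : ∀ g ∈ T, A * ((g : GL (Fin N) K) : Matrix (Fin N) (Fin N) K) = g * A) :
    A * X = X * A := by
  ext i j
  let f : Coord K N := ∑ k, (MvPolynomial.C (A i k) * MvPolynomial.X (Sum.inl (k, j)) -
    MvPolynomial.X (Sum.inl (i, k)) * MvPolynomial.C (A k j))
  have hf : ∀ g ∈ T, evalAt g f = 0 := by
    intro g hg
    have := congrFun (congrFun (hA g hg) i) j
    simp only [Matrix.mul_apply] at this
    simp [f, evalAt, entries, this]
  have h := hX f hf
  rw [← evalAt_one_leftDer] at h
  simp only [f, map_sum, map_sub, leftDer_C_mul, leftDer_mul_C, leftDer_inl] at h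
  simp [evalAt, entries, Matrix.one_apply] at h
  rw [Matrix.mul_apply, Matrix.mul_apply]
  exact sub_eq_zero.1 h

theorem lieAlg_torus_comm (hT : IsTorus T) (t : T) {X : Matrix (Fin N) (Fin N) K}
    (hX : X ∈ lieAlg T) :
    ((t : GL (Fin N) K) : Matrix (Fin N) (Fin N) K) * X = X * (t : GL (Fin N) K) := by
  refine lieAlg_comm_of_comm hX fun g hg => ?_
  rw [← Units.val_mul, ← Units.val_mul]
  exact congrArg Units.val (torus_comm hT t ⟨g, hg⟩)

theorem lieAlg_torus_abelian (hT : IsTorus T) {X Y : Matrix (Fin N) (Fin N) K}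
    (hX : X ∈ lieAlg T) (hY : Y ∈ lieAlg T) : X * Y = Y * X :=
  lieAlg_comm_of_comm hY fun g hg => (lieAlg_torus_comm hT ⟨g, hg⟩ hX).symm

theorem lieAlg_torus_le (hT : IsTorus T) :
    (lieAlg T).toSubmodule ≤ wtSpace (0 : charGroup T) := by
  intro X hX t
  rw [lieAlg_torus_comm hT t hX, mul_assoc, ← Units.val_mul, mul_inv_cancel, Units.val_one, mul_one,
    charVal_zero, Units.val_one, one_smul]

end Weights

namespace ReductiveSetup

variable {K : Type*} [Field K] {N : ℕ} (S : ReductiveSetup K N)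

theorem isTorus : IsTorus S.T := S.isMaximalTorus.1.2

theorem torus_le_group : S.T ≤ S.G := S.isMaximalTorus.1.1

theorem borel_le_group : S.B ≤ S.G := S.isBorel.1.1

/-- The Lie algebra of `G`. -/
abbrev LieG : LieSubalgebra K (Matrix (Fin N) (Fin N) K) := lieAlg S.G

/-- The Lie algebra of `T`. -/
abbrev LieT : LieSubalgebra K (Matrix (Fin N) (Fin N) K) := lieAlg S.T

/-- The set of positive roots, as a type. -/
abbrev PosRoots : Type _ := {α : Roots S.G S.T // IsPositive S.base α}

/-- The sum of the weight spaces for the nonzero sums of positive roots. -/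
def mPlus : Submodule K (Matrix (Fin N) (Fin N) K) :=
  ⨆ x : {x : charGroup S.T // x ∈ AddSubmonoid.closure (S.P.root '' S.base.support) ∧ x ≠ 0},
    wtSpace x.1

theorem closure_pointed {x y : charGroup S.T}
    (hx : x ∈ AddSubmonoid.closure (S.P.root '' S.base.support))
    (hy : y ∈ AddSubmonoid.closure (S.P.root '' S.base.support)) (hxy : x + y = 0) : x = 0 := by
  have key : ∀ z ∈ AddSubmonoid.closure (S.P.root '' S.base.support),
      ∃ n : S.base.support → ℕ, z = ∑ i, (n i : ℤ) • S.P.root i := by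
    intro z hz
    induction hz using AddSubmonoid.closure_induction with
    | mem z hz =>
      obtain ⟨i, hi, rfl⟩ := hz
      classical
      refine ⟨Pi.single ⟨i, hi⟩ 1, ?_⟩
      rw [Finset.sum_eq_single ⟨i, hi⟩] <;> simp +contextual
    | zero => exact ⟨0, by simp⟩
    | add a b _ _ ha hb =>
      obtain ⟨n, rfl⟩ := ha
      obtain ⟨m, rfl⟩ := hb
      refine ⟨n + m, ?_⟩
      rw [← Finset.sum_add_distrib]
      refine Finset.sum_congr rfl fun i _ => ?_
      rw [Pi.add_apply, Nat.cast_add, add_zsmul]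
  obtain ⟨n, rfl⟩ := key x hx
  obtain ⟨m, rfl⟩ := key y hy
  have hxy' : ∑ i, ((n i : ℤ) + m i) • S.P.root (i : Roots S.G S.T) = 0 := by
    rw [← hxy, ← Finset.sum_add_distrib]
    exact Finset.sum_congr rfl fun i _ => add_zsmul _ _ _
  have hli : LinearIndependent ℤ (fun i : S.base.support => S.P.root i) := S.base.linearIndepOn_root
  have h0 := Fintype.linearIndependent_iff.1 hli _ hxy'
  refine Finset.sum_eq_zero fun i _ => ?_
  have := h0 i
  have hn : n i = 0 := by omega
  rw [hn, Nat.cast_zero, zero_smul]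

theorem mPlus_mul {X Y : Matrix (Fin N) (Fin N) K} (hX : X ∈ S.mPlus) (hY : Y ∈ S.mPlus) :
    X * Y ∈ S.mPlus := by
  refine Submodule.iSup_induction _ (motive := fun X => X * Y ∈ S.mPlus) hX ?_ (by simp)
    fun a b ha hb => by rw [add_mul]; exact add_mem ha hb
  intro x X hX
  refine Submodule.iSup_induction _ (motive := fun Y => X * Y ∈ S.mPlus) hY ?_ (by simp)
    fun a b ha hb => by rw [mul_add]; exact add_mem ha hb
  intro y Y hY
  exact Submodule.mem_iSup_of_mem ⟨x.1 + y.1, add_mem x.2.1 y.2.1,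
    fun h => x.2.2 (S.closure_pointed x.2.1 y.2.1 h)⟩ (wtSpace_mul hX hY)

theorem mPlus_mul_zero {X Y : Matrix (Fin N) (Fin N) K} (hX : X ∈ S.mPlus)
    (hY : Y ∈ wtSpace (0 : charGroup S.T)) : X * Y ∈ S.mPlus := by
  refine Submodule.iSup_induction _ (motive := fun X => X * Y ∈ S.mPlus) hX ?_ (by simp)
    fun a b ha hb => by rw [add_mul]; exact add_mem ha hb
  intro x X hX
  have := wtSpace_mul hX hY
  rw [add_zero] at this
  exact Submodule.mem_iSup_of_mem x this

theorem zero_mul_mPlus {X Y : Matrix (Fin N) (Fin N) K} (hX : X ∈ wtSpace (0 : charGroup S.T))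
    (hY : Y ∈ S.mPlus) : X * Y ∈ S.mPlus := by
  refine Submodule.iSup_induction _ (motive := fun Y => X * Y ∈ S.mPlus) hY ?_ (by simp)
    fun a b ha hb => by rw [mul_add]; exact add_mem ha hb
  intro x Y hY
  have := wtSpace_mul hX hY
  rw [zero_add] at this
  exact Submodule.mem_iSup_of_mem x this

theorem nPlus_le : nPlus S.base ≤ S.mPlus := by
  refine iSup_le fun α => ?_
  refine le_trans inf_le_right ?_
  have h := α.2
  rw [IsPositive, S.isRootDatum.root] at h
  exact le_iSup (fun x : {x : charGroup S.T //
    x ∈ AddSubmonoid.closure (S.P.root '' S.base.support) ∧ x ≠ 0} =>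
      (wtSpace x.1 : Submodule K (Matrix (Fin N) (Fin N) K))) ⟨α.1.1, h, α.1.2.1⟩

theorem mPlus_le : S.mPlus ≤ ⨆ (x : charGroup S.T) (_ : x ≠ 0), wtSpace x :=
  iSup_le fun x => le_iSup₂_of_le x.1 x.2.2 le_rfl

/-- The projection of `Lie G` to `Lie T` along the sum of the root spaces. -/
def projT : S.LieG →ₗ[K] S.LieT := S.c.constr K (Sum.elim S.h 0)

theorem sub_projT_mem (x : S.LieG) : (x : Matrix (Fin N) (Fin N) K) - S.projT x ∈
    ⨆ (y : charGroup S.T) (_ : y ≠ 0), (wtSpace y : Submodule K (Matrix (Fin N) (Fin N) K)) := by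
  set M := ⨆ (y : charGroup S.T) (_ : y ≠ 0),
    (wtSpace y : Submodule K (Matrix (Fin N) (Fin N) K)) with hM
  have h : M.mkQ ∘ₗ (S.LieG.toSubmodule.subtype - S.LieT.toSubmodule.subtype ∘ₗ S.projT) = 0 := by
    apply S.c.ext
    intro i
    rw [LinearMap.comp_apply, LinearMap.zero_apply, Submodule.mkQ_apply,
      Submodule.Quotient.mk_eq_zero, LinearMap.sub_apply, LinearMap.comp_apply]
    rcases i with i | α
    · rw [projT, Module.Basis.constr_basis, Sum.elim_inl]
      change ((S.c (Sum.inl i) : S.LieG) : Matrix (Fin N) (Fin N) K) - (S.h i : Matrix _ _ K) ∈ M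
      rw [S.isChevalley.toral, sub_self]
      exact zero_mem _
    · rw [projT, Module.Basis.constr_basis, Sum.elim_inr, Pi.zero_apply, map_zero, sub_zero]
      have := (S.isChevalley.root_vector α).2
      exact Submodule.mem_iSup_of_mem α.1 (Submodule.mem_iSup_of_mem α.2.1 this)
  have := LinearMap.congr_fun h x
  rw [LinearMap.comp_apply, LinearMap.zero_apply, Submodule.mkQ_apply,
    Submodule.Quotient.mk_eq_zero] at this
  exact this

theorem projT_eq (x : S.LieG) (y : S.LieT)
    (hxy : (x : Matrix (Fin N) (Fin N) K) - y ∈ S.mPlus) : S.projT x = y := by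
  have h1 := sub_mem (S.mPlus_le hxy) (S.sub_projT_mem x)
  rw [sub_sub_sub_cancel_left] at h1
  have h2 : ((S.projT x : S.LieT) : Matrix (Fin N) (Fin N) K) - y ∈ wtSpace (0 : charGroup S.T) :=
    lieAlg_torus_le S.isTorus (sub_mem (S.projT x).2 y.2)
  have h3 := (wtSpace_indep S.isTorus 0).le_bot ⟨h2, h1⟩
  exact Subtype.ext (sub_eq_zero.1 h3)

variable {S} in
theorem pow_sub_mem {X H : Matrix (Fin N) (Fin N) K} (hH : H ∈ wtSpace (0 : charGroup S.T))
    (hX : X - H ∈ S.mPlus) (n : ℕ) :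
    X ^ n - H ^ n ∈ S.mPlus ∧ H ^ n ∈ wtSpace (0 : charGroup S.T) := by
  induction n with
  | zero =>
    refine ⟨by simp, fun t => ?_⟩
    rw [pow_zero, mul_one, ← Units.val_mul, mul_inv_cancel, charVal_zero]
    simp
  | succ n ih =>
    constructor
    · have : X ^ (n + 1) - H ^ (n + 1) =
          (X ^ n - H ^ n) * (X - H) + (X ^ n - H ^ n) * H + H ^ n * (X - H) := by
        rw [pow_succ, pow_succ]; noncomm_ring
      rw [this]
      exact add_mem (add_mem (S.mPlus_mul ih.1 hX) (S.mPlus_mul_zero ih.1 hH))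
        (S.zero_mul_mPlus ih.2 hX)
    · rw [pow_succ]
      simpa using wtSpace_mul ih.2 hH

/-- The inclusion of `Lie T` in `Lie G`. -/
def inclT : S.LieT →ₗ⁅K⁆ S.LieG := LieSubalgebra.inclusion (lieAlg_mono S.torus_le_group)

/-- The inclusion of `Lie B` in `Lie G`. -/
def inclB : lieAlg S.B →ₗ⁅K⁆ S.LieG := LieSubalgebra.inclusion (lieAlg_mono S.borel_le_group)

/-- The linear forms on `Lie G` that vanish on `𝔫⁺`. -/
def VanishesOnNPlus (χ : Module.Dual K S.LieG) : Prop :=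
  ∀ x : S.LieG, (x : Matrix (Fin N) (Fin N) K) ∈ nPlus S.base → χ x = 0

variable {S} in
theorem VanishesOnNPlus.add {χ χ' : Module.Dual K S.LieG} (hχ : S.VanishesOnNPlus χ)
    (hχ' : S.VanishesOnNPlus χ') : S.VanishesOnNPlus (χ + χ') := fun x hx => by
  rw [LinearMap.add_apply, hχ x hx, hχ' x hx, add_zero]

theorem exists_decomp (x : lieAlg S.B) : ∃ y : S.LieT, ∃ z : S.LieG,
    (z : Matrix (Fin N) (Fin N) K) ∈ nPlus S.base ∧ S.inclB x = S.inclT y + z := by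
  have hx : (x : Matrix (Fin N) (Fin N) K) ∈ (lieAlg S.B).toSubmodule := x.2
  rw [S.borel_eq] at hx
  obtain ⟨y, hy, z, hz, hyz⟩ := Submodule.mem_sup.1 hx
  have hz' : z ∈ S.LieG := by
    have : nPlus S.base ≤ S.LieG.toSubmodule := iSup_le fun α => inf_le_left
    exact this hz
  exact ⟨⟨y, hy⟩, ⟨z, hz'⟩, hz, Subtype.ext hyz.symm⟩

variable (p : ℕ) [Fact p.Prime] [CharP K p]

/-- The set `Λ_χ` of all `lam : Lie T → K` with `lam(h)^p - lam(h^[p]) = χ(h)^p` for all `h`. -/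
def Lam (χ : Module.Dual K S.LieG) : Set (Module.Dual K S.LieT) :=
  {lam | ∀ h : S.LieT, lam h ^ p - lam (pPow p S.T h) = χ (S.inclT h) ^ p}

/-- The character of `Lie B` that kills `𝔫⁺` and restricts to `lam` on `Lie T`. -/
def borelChar (lam : Module.Dual K S.LieT) : lieAlg S.B →ₗ⁅K⁆ K where
  toLinearMap := lam ∘ₗ S.projT ∘ₗ (S.inclB : lieAlg S.B →ₗ[K] S.LieG)
  map_lie' := by
    intro x y
    obtain ⟨hx, nx, hnx, ex⟩ := S.exists_decomp x
    obtain ⟨hy, ny, hny, ey⟩ := S.exists_decomp y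
    have hnx' := S.nPlus_le hnx
    have hny' := S.nPlus_le hny
    have hx0 := lieAlg_torus_le S.isTorus hx.2
    have hy0 := lieAlg_torus_le S.isTorus hy.2
    have h0 : S.projT (S.inclB ⁅x, y⁆) = 0 := by
      apply S.projT_eq
      rw [LieHom.map_lie, ex, ey]
      have : (((⁅S.inclT hx + nx, S.inclT hy + ny⁆ : S.LieG) : Matrix (Fin N) (Fin N) K)) -
          ((0 : S.LieT) : Matrix (Fin N) (Fin N) K) =
          (hx : Matrix (Fin N) (Fin N) K) * ny + (nx : Matrix (Fin N) (Fin N) K) * hy +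
            (nx : Matrix (Fin N) (Fin N) K) * ny - ((hy : Matrix (Fin N) (Fin N) K) * nx +
            (ny : Matrix (Fin N) (Fin N) K) * hx + (ny : Matrix (Fin N) (Fin N) K) * nx) := by
        change ((hx : Matrix (Fin N) (Fin N) K) + nx) * ((hy : Matrix (Fin N) (Fin N) K) + ny) -
          ((hy : Matrix (Fin N) (Fin N) K) + ny) * ((hx : Matrix (Fin N) (Fin N) K) + nx) - 0 = _
        have hc := lieAlg_torus_abelian S.isTorus hx.2 hy.2
        simp only [add_mul, mul_add, hc]
        abel
      rw [this]
      exact sub_mem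
        (add_mem (add_mem (S.zero_mul_mPlus hx0 hny') (S.mPlus_mul_zero hnx' hy0))
          (S.mPlus_mul hnx' hny'))
        (add_mem (add_mem (S.zero_mul_mPlus hy0 hnx') (S.mPlus_mul_zero hny' hx0))
          (S.mPlus_mul hny' hnx'))
    change lam (S.projT (S.inclB ⁅x, y⁆)) = _
    rw [h0, map_zero, LieRing.of_associative_ring_bracket, mul_comm, sub_self]

theorem borelChar_apply (lam : Module.Dual K S.LieT) (x : lieAlg S.B) (h : S.LieT) (n : S.LieG)
    (hn : (n : Matrix (Fin N) (Fin N) K) ∈ nPlus S.base) (hx : S.inclB x = S.inclT h + n) :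
    S.borelChar lam x = lam h := by
  change lam (S.projT (S.inclB x)) = lam h
  rw [S.projT_eq (S.inclB x) h]
  rw [hx]
  change (h : Matrix (Fin N) (Fin N) K) + n - h ∈ _
  rw [add_sub_cancel_left]
  exact S.nPlus_le hn

variable {S}

theorem borelChar_pow {χ : Module.Dual K S.LieG} (hχ : S.VanishesOnNPlus χ) (lam : S.Lam p χ)
    (x : lieAlg S.B) : S.borelChar lam x ^ p = S.borelChar lam (pPow p S.B x) +
      algebraMap K K (resDual S.borel_le_group χ x ^ p) := by
  obtain ⟨h, n, hn, ex⟩ := S.exists_decomp x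
  have hχx : resDual S.borel_le_group χ x = χ (S.inclT h) := by
    change χ (S.inclB x) = _
    rw [ex, map_add, hχ n hn, add_zero]
  have hpx : S.projT (S.inclB (pPow p S.B x)) = pPow p S.T h := by
    apply S.projT_eq
    refine (pow_sub_mem (lieAlg_torus_le S.isTorus h.2) ?_ p).1
    have ex' : (x : Matrix (Fin N) (Fin N) K) = h + n := congrArg Subtype.val ex
    rw [ex', add_sub_cancel_left]
    exact S.nPlus_le hn
  have e2 : S.borelChar lam (pPow p S.B x) = lam.1 (pPow p S.T h) := congrArg lam.1 hpx
  rw [S.borelChar_apply lam x h n hn ex, e2, hχx, ← lam.2 h, Algebra.algebraMap_self_apply]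
  ring

/-- The algebra homomorphism `U_χ(Lie B) → K` that defines the one-dimensional module `K_lam`. -/
def weightHom {χ : Module.Dual K S.LieG} (hχ : S.VanishesOnNPlus χ) (lam : S.Lam p χ) :
    RedEnv p S.B (resDual S.borel_le_group χ) →ₐ[K] K :=
  redLift p S.B (resDual S.borel_le_group χ) (S.borelChar lam) (borelChar_pow p hχ lam)

theorem weightHom_ι {χ : Module.Dual K S.LieG} (hχ : S.VanishesOnNPlus χ) (lam : S.Lam p χ)
    (x : lieAlg S.B) (h : S.LieT) (n : S.LieG)
    (hn : (n : Matrix (Fin N) (Fin N) K) ∈ nPlus S.base) (hx : S.inclB x = S.inclT h + n) :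
    weightHom p hχ lam (redι p S.B (resDual S.borel_le_group χ) x) = lam.1 h := by
  rw [weightHom, redLift_ι]
  exact S.borelChar_apply lam x h n hn hx

/-- The baby Verma module `Z_χ(lam) = U_χ(Lie G) ⊗_{U_χ(Lie B)} K_lam`. -/
abbrev BabyVerma {χ : Module.Dual K S.LieG} (hχ : S.VanishesOnNPlus χ) (lam : S.Lam p χ) :
    Type _ :=
  Induced (redMap p S.borel_le_group χ) (OneDim (weightHom p hχ lam))

end ReductiveSetup

end ReducedRep

end

/-! Let $v$ be the highest weight vector of $Z_\chi(\lambda)$. Conceptually, the tensor identity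
gives $Z_\chi(\lambda)\otimes M\cong U_{\chi+\chi'}(\mathfrak g)\otimes_{U_{\chi+\chi'}(\mathfrak
b)}(\mathbb K_\lambda\otimes M)$. Induction from $\mathfrak b$ is exact, so a $\mathfrak
b$-filtration of $M=Z_{\chi'}(\mu)$ with one-dimensional quotients yields a filtration by baby Verma
modules. The proof replaces the tensor identity and exactness by a dimension count.

Choose a basis $m_1,m_2,\dots$ of $M$ on which $\mathfrak b$ acts by triangular matrices with
diagonal characters $\nu_i$, and let $W_i$ be generated by the $v\otimes m_j$ with $j\le i$. Since
$\mathfrak b$ acts on $v$ itself through $\lambda$, it acts on the class of $v\otimes m_i$ in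
$W_i/W_{i-1}$ through $\lambda+\nu_i$ (`inclB_smul_subquotientGen`). That class generates the
quotient, which is therefore an image of $Z_{\chi+\chi'}(\lambda+\nu_i)$. These $p^D$ modules have
dimension $p^D$ each, and $W_{p^D}$ is everything, of dimension $p^{2D}$; hence all the surjections
are isomorphisms (`bijective_of_surjective_subquotient`).

The $m_i$ are the ordered monomials in negative root vectors applied to the highest weight vector of
$M$. Give $f_\gamma$ the weight $1+\mathrm{ht}(\gamma)$. Reordering and $p$-th powers then produce
only terms of smaller weight, and positive root vectors strictly lower the weight
(`eVec_smul_wordProd_mem`), so sorting the monomials by weight makes $\mathfrak b$ triangular.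

The dimension $p^D$ rests on a PBW theorem for $U_\chi$. Spanning is a rewriting argument
(`wordProd_mem_reducedSpan`). For independence (`linearIndependent_orderedMon`), pick a function $l$
whose differential at the identity restricts to $\chi$ and let $X$ act on functions modulo $p$-th
powers of functions vanishing at the identity by $X+X(l)$. Jacobson's formula
(`twistedDer_pow_char`) shows that this is a $U_\chi$-module, and there the monomials pair
triangularly with monomials in dual coordinates, the diagonal entries being prime to $p$. -/

namespace ReducedRep

/-! ### Ordered monomials -/

section OrderedMonomials

variable {K U ι : Type*} [Field K] [Ring U] [Algebra K U] (x : ι → U) (w : ι → ℕ)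

/-- The product of the values of `x` along a word. -/
def wordProd (u : List ι) : U := (u.map x).prod

/-- The weight of a word. -/
def wordWt (u : List ι) : ℕ := (u.map w).sum

variable (K) in
/-- The span of the products of the words of weight less than `k`. -/
def filtLT (k : ℕ) : Submodule K U :=
  Submodule.span K {y | ∃ u : List ι, wordWt w u < k ∧ y = wordProd x u}

/-- The monomial with exponents `a`, its factors ordered as in the list `l`. -/
def orderedMon (l : List ι) (a : ι → ℕ) : U := (l.map fun i => x i ^ a i).prod

variable {x w}

theorem wordProd_append (u v : List ι) : wordProd x (u ++ v) = wordProd x u * wordProd x v := by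
  simp [wordProd]

theorem wordProd_cons (i : ι) (v : List ι) : wordProd x (i :: v) = x i * wordProd x v := by
  simp [wordProd]

theorem wordWt_append (u v : List ι) : wordWt w (u ++ v) = wordWt w u + wordWt w v := by
  simp [wordWt]

theorem wordWt_cons (i : ι) (v : List ι) : wordWt w (i :: v) = w i + wordWt w v := by
  simp [wordWt]

theorem wordWt_perm {u v : List ι} (h : u.Perm v) : wordWt w u = wordWt w v :=
  (h.map w).sum_eq

theorem wordProd_mem_filtLT {u : List ι} {k : ℕ} (h : wordWt w u < k) :
    wordProd x u ∈ filtLT K x w k := Submodule.subset_span ⟨u, h, rfl⟩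

theorem filtLT_mono {j k : ℕ} (h : j ≤ k) : filtLT K x w j ≤ filtLT K x w k :=
  Submodule.span_mono fun _ ⟨u, hu, hy⟩ => ⟨u, hu.trans_le h, hy⟩

theorem mul_mem_filtLT {y : U} {k : ℕ} (hy : y ∈ filtLT K x w k) (u v : List ι) :
    wordProd x u * y * wordProd x v ∈ filtLT K x w (wordWt w u + k + wordWt w v) := by
  induction hy using Submodule.span_induction with
  | mem y hy =>
    obtain ⟨t, ht, rfl⟩ := hy
    rw [← wordProd_append, ← wordProd_append]
    apply wordProd_mem_filtLT
    rw [wordWt_append, wordWt_append]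
    omega
  | zero => simp
  | add a b _ _ ha hb => rw [mul_add, add_mul]; exact add_mem ha hb
  | smul c a _ ha => rw [mul_smul_comm, smul_mul_assoc]; exact Submodule.smul_mem _ c ha

/-- A permutation is a chain of adjacent swaps, and each swap costs one commutator, which has
smaller weight than the pair it replaces. -/
theorem wordProd_sub_mem_of_perm
    (hc : ∀ i j, x i * x j - x j * x i ∈ filtLT K x w (w i + w j)) {u v : List ι}
    (h : u.Perm v) : wordProd x u - wordProd x v ∈ filtLT K x w (wordWt w u) := by
  induction h with
  | nil => simp
  | cons i h ih =>
    have := mul_mem_filtLT ih [i] []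
    rw [wordProd_cons, wordProd_cons, wordWt_cons, ← mul_sub]
    simpa [wordProd, wordWt] using this
  | swap i j l =>
    have := mul_mem_filtLT (hc j i) [] l
    rw [wordProd_cons, wordProd_cons, wordProd_cons, wordProd_cons, wordWt_cons, wordWt_cons,
      ← mul_assoc, ← mul_assoc, ← sub_mul, ← add_assoc]
    simpa [wordProd, wordWt] using this
  | trans h1 h2 ih1 ih2 =>
    rw [← sub_add_sub_cancel]
    rw [← wordWt_perm h1] at ih2
    exact add_mem ih1 ih2

theorem wordProd_flatMap_replicate (l : List ι) (a : ι → ℕ) :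
    wordProd x (l.flatMap fun i => List.replicate (a i) i) = orderedMon x l a := by
  induction l with
  | nil => rfl
  | cons i l ih =>
    rw [List.flatMap_cons, wordProd_append, ih]
    simp [wordProd, orderedMon]

theorem perm_flatMap_replicate_count [DecidableEq ι] {l : List ι} (hl : l.Nodup)
    (hl' : ∀ i, i ∈ l) (u : List ι) : u.Perm (l.flatMap fun i => List.replicate (u.count i) i) := by
  rw [List.perm_iff_count]
  intro j
  rw [List.count_flatMap]
  have : (List.count j ∘ fun i => List.replicate (List.count i u) i) =
      fun i => if i = j then u.count j else 0 := by
    funext i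
    simp only [Function.comp_apply, List.count_replicate, beq_iff_eq]
    split_ifs with h
    · rw [h]
    · rfl
  rw [this, ← List.sum_toFinset _ hl, Finset.sum_ite_eq']
  simp [hl']

variable [Fintype ι]

theorem wordWt_eq_sum_count [DecidableEq ι] (u : List ι) :
    wordWt w u = ∑ i, u.count i * w i := by
  induction u with
  | nil => simp [wordWt]
  | cons j u ih =>
    rw [wordWt_cons, ih]
    simp only [List.count_cons, add_mul, Finset.sum_add_distrib]
    simp [add_comm]

variable (K x w) in
/-- The span of the ordered monomials of weight at most `k` with exponents less than `p`. -/
def reducedSpan (p : ℕ) (l : List ι) (k : ℕ) : Submodule K U :=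
  Submodule.span K {y | ∃ a : ι → Fin p, ∑ i, (a i : ℕ) * w i ≤ k ∧
    y = orderedMon x l fun i => a i}

theorem reducedSpan_mono {p : ℕ} {l : List ι} {j k : ℕ} (h : j ≤ k) :
    reducedSpan K x w p l j ≤ reducedSpan K x w p l k :=
  Submodule.span_mono fun _ ⟨a, ha, hy⟩ => ⟨a, ha.trans h, hy⟩

/-- If commutators and `p`-th powers of the generators have smaller weight than expected, then the
ordered monomials with exponents less than `p` span, compatibly with the weights. -/
theorem wordProd_mem_reducedSpan {p : ℕ}
    (hc : ∀ i j, x i * x j - x j * x i ∈ filtLT K x w (w i + w j))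
    (hp : ∀ i, x i ^ p ∈ filtLT K x w (p * w i)) {l : List ι} (hl : l.Nodup) (hl' : ∀ i, i ∈ l)
    (u : List ι) : wordProd x u ∈ reducedSpan K x w p l (wordWt w u) := by
  classical
  obtain ⟨k, hk⟩ : ∃ k, wordWt w u = k := ⟨_, rfl⟩
  induction k using Nat.strong_induction_on generalizing u with
  | _ k ih =>
    have low : filtLT K x w k ≤ reducedSpan K x w p l k := by
      refine Submodule.span_le.2 ?_
      rintro _ ⟨v, hv, rfl⟩
      exact reducedSpan_mono hv.le (ih _ hv v rfl)
    rw [hk]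
    -- If every letter occurs fewer than $p$ times, sorting the word gives an admissible monomial
    -- plus terms of smaller weight. Otherwise $p$ equal letters are moved to the front and their
    -- $p$-th power is replaced by terms of smaller weight.
    by_cases h : ∀ i, u.count i < p
    · have h1 := wordProd_sub_mem_of_perm hc (perm_flatMap_replicate_count hl hl' u)
      rw [hk, wordProd_flatMap_replicate] at h1
      have h2 : orderedMon x l (fun i => u.count i) ∈ reducedSpan K x w p l k :=
        Submodule.subset_span ⟨fun i => ⟨u.count i, h i⟩, by rw [← hk, wordWt_eq_sum_count], rfl⟩
      simpa using add_mem (low h1) h2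
    · push Not at h
      obtain ⟨i, hi⟩ := h
      obtain ⟨v, hv⟩ : ∃ v, u.Perm (List.replicate p i ++ v) := by
        have : (List.replicate p i).Subperm u := by
          rw [List.subperm_iff_count]
          intro j
          rw [List.count_replicate]
          split_ifs with hij
          · rwa [← eq_of_beq hij]
          · exact Nat.zero_le _
        obtain ⟨t, ht, hs⟩ := this
        obtain ⟨v, hv⟩ := hs.exists_perm_append
        exact ⟨v, hv.trans (ht.append_right v)⟩
      have h1 := wordProd_sub_mem_of_perm hc hv
      have h2 : wordProd x (List.replicate p i ++ v) ∈ filtLT K x w k := by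
        have := mul_mem_filtLT (hp i) [] v
        rw [wordProd_append]
        rw [wordWt_perm hv, wordWt_append] at hk
        simpa [wordProd, wordWt, ← hk] using this
      rw [hk] at h1
      simpa using low (add_mem h1 h2)

end OrderedMonomials

end ReducedRep

namespace ReducedRep

attribute [local instance] LieRing.ofAssociativeRing

/-! ### The `p`-th power of a twisted derivation -/

section Jacobson

variable {K : Type*} [Field K] (p : ℕ) [Fact p.Prime] [CharP K p]

/-- Left and right multiplication by $a$ commute, so the $p$-th power of their difference is the
difference of their $p$-th powers. -/
theorem iterate_commutator_char {R : Type*} [Ring R] [Algebra K R] (a b : R) :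
    ((LinearMap.mulLeft K a - LinearMap.mulRight K a) ^ p) b = a ^ p * b - b * a ^ p := by
  rcases subsingleton_or_nontrivial R with h | h
  · exact Subsingleton.elim _ _
  have : CharP (Module.End K R) p :=
    charP_of_injective_algebraMap (FaithfulSMul.algebraMap_injective K _) p
  have hc : Commute (LinearMap.mulLeft K a) (LinearMap.mulRight K a) := by
    apply LinearMap.ext
    intro z
    simp [mul_assoc]
  rw [sub_pow_char_of_commute _ hc, LinearMap.pow_mulLeft,
    LinearMap.pow_mulRight]
  simp

/-- If `b` and the iterated commutators of `a` with `b` are given by `f ↦ μ (D ^ n f)`, then the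
commutator with `a ^ p` is given by `D ^ p`. -/
theorem commutator_pow_char {R A : Type*} [Ring R] [Algebra K R] [AddCommGroup A] [Module K A]
    (D : Module.End K A) (μ : A →ₗ[K] R) (a : R) (h : ∀ f, a * μ f - μ f * a = μ (D f)) (f : A) :
    a ^ p * μ f - μ f * a ^ p = μ ((D ^ p) f) := by
  rw [← iterate_commutator_char (K := K)]
  generalize p = n
  induction n generalizing f with
  | zero => simp
  | succ n ih => rw [pow_succ, Module.End.mul_apply, pow_succ, Module.End.mul_apply, ← ih (D f), ← h]
                 simp

variable {A : Type*} [CommRing A] [Algebra K A]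

/-- The operator `D + g`, where `g` acts by multiplication. -/
def twistedDer (D : Derivation K A A) (g : A) : Module.End K A :=
  (D : A →ₗ[K] A) + LinearMap.mulLeft K g

@[simp] theorem twistedDer_apply (D : Derivation K A A) (g f : A) :
    twistedDer D g f = D f + g * f := rfl

/-- The operator `D + t g` on sequences, which are thought of as power series in `t`. -/
def twistedDerSeq (D : Derivation K A A) (g : A) : Module.End K (ℕ → A) where
  toFun f n := D (f n) + g * (if n = 0 then 0 else f (n - 1))
  map_add' f f' := by
    funext n
    by_cases h : n = 0 <;> simp [h, mul_add]; abel
  map_smul' c f := by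
    funext n
    by_cases h : n = 0 <;> simp [h]

/-- Here `Pi.single 0 1` is the constant series $1$. The four clauses say that $(D+tg)^k1$ has
degree at most $k$ in $t$, that its coefficient of $t^k$ is $g^k$, that the constant coefficient
vanishes for positive exponents because $D1=0$, and that setting $t=1$ recovers $(D+g)^k1$. -/
theorem twistedDerSeq_pow_one (D : Derivation K A A) (g : A) (k : ℕ) :
    (∀ n, k < n → ((twistedDerSeq D g) ^ k) (Pi.single 0 1) n = 0) ∧
    ((twistedDerSeq D g) ^ k) (Pi.single 0 1) k = g ^ k ∧
    ((twistedDerSeq D g) ^ (k + 1)) (Pi.single 0 1) 0 = 0 ∧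
    ∑ n ∈ Finset.range (k + 1), ((twistedDerSeq D g) ^ k) (Pi.single 0 1) n =
      ((twistedDer D g) ^ k) 1 := by
  induction k with
  | zero =>
    refine ⟨fun n hn => by simp [hn.ne'], by simp, ?_, by simp⟩
    simp [twistedDerSeq]
  | succ k ih =>
    obtain ⟨h1, h2, h3, h4⟩ := ih
    have hs : ∀ (j n : ℕ), ((twistedDerSeq D g) ^ (j + 1)) (Pi.single 0 1) n =
        D (((twistedDerSeq D g) ^ j) (Pi.single 0 1) n) +
          g * (if n = 0 then 0 else ((twistedDerSeq D g) ^ j) (Pi.single 0 1) (n - 1)) := by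
      intro j n
      rw [pow_succ', Module.End.mul_apply]
      rfl
    refine ⟨fun n hn => ?_, ?_, ?_, ?_⟩
    · rw [hs, h1 n (by omega), if_neg (by omega), h1 (n - 1) (by omega)]
      simp
    · rw [hs, h1 _ (by omega), if_neg (by omega), Nat.add_sub_cancel, h2, pow_succ']
      simp
    · rw [hs, h3]
      simp
    · rw [pow_succ' (twistedDer D g), Module.End.mul_apply, ← h4, twistedDer_apply, map_sum, Finset.mul_sum]
      simp only [hs, Finset.sum_add_distrib]
      congr 1
      · rw [Finset.sum_range_succ, h1 _ (by omega), map_zero, add_zero]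
      · rw [Finset.sum_range_succ']
        simp

/-- Jacobson's formula for the operator `D + D l`. -/
theorem twistedDer_pow_char (D : Derivation K A A) (l f : A) :
    ((twistedDer D (D l)) ^ p) f =
      ((D : A →ₗ[K] A) ^ p) f + (((D : A →ₗ[K] A) ^ p) l + D l ^ p) * f := by
  have hp : p.Prime := Fact.out
  -- The commutator of $D+g$ with multiplication by $f$ is multiplication by $Df$. Taking $p$-th
  -- powers and applying the result to $1$ reduces the formula to the value $(D+g)^p1$.
  have h0 := commutator_pow_char p (D : A →ₗ[K] A) (LinearMap.mul K A) (twistedDer D (D l))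
    (fun f => by ext b; simp; ring) f
  have h1 := LinearMap.congr_fun h0 1
  simp only [LinearMap.sub_apply, Module.End.mul_apply, LinearMap.mul_apply', mul_one] at h1
  rw [sub_eq_iff_eq_add] at h1
  rw [h1, mul_comm f]
  congr 2
  set g := D l with hg
  -- `P` is $d/dt$. Since $[D+tg,d/dt]=-g$, iterating the commutator $p$ times gives
  -- $[(D+tg)^p,d/dt]=-D^{p-1}g=-D^pl$, which determines the $t$-derivative of $(D+tg)^p1$.
  let P : Module.End K (ℕ → A) :=
    { toFun := fun f n => (n + 1 : A) * f (n + 1)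
      map_add' := fun f f' => by funext n; simp [mul_add]
      map_smul' := fun c f => by funext n; simp }
  let μ : A →ₗ[K] Module.End K (ℕ → A) :=
    { toFun := fun a =>
        { toFun := fun f n => a * f n
          map_add' := fun f f' => by funext n; simp [mul_add]
          map_smul' := fun c f => by funext n; simp }
      map_add' := fun a b => by ext f n; simp [add_mul]
      map_smul' := fun c a => by ext f n; simp }
  have hμ : ∀ a, twistedDerSeq D g * μ a - μ a * twistedDerSeq D g = μ (D a) := by
    intro a
    apply LinearMap.ext
    intro f
    funext n
    by_cases h : n = 0 <;> simp [twistedDerSeq, μ, h] <;> ring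
  have hP : twistedDerSeq D g * P - P * twistedDerSeq D g = μ (-g) := by
    apply LinearMap.ext
    intro f
    funext n
    rcases n with _ | n <;> simp [twistedDerSeq, μ, P]
    ring
  -- The extra coordinate in $K$ stands for multiples of $d/dt$, so that one linear family, closed
  -- under commutation with $D+tg$, contains both $d/dt$ and the multiplications.
  let D' : Module.End K (A × K) :=
    { toFun := fun a => (D a.1 - a.2 • g, 0)
      map_add' := fun a b => by simp [add_smul]; abel
      map_smul' := fun c a => by simp [smul_sub, mul_smul] }
  let μ' : (A × K) →ₗ[K] Module.End K (ℕ → A) := μ.coprod (LinearMap.toSpanSingleton K _ P)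
  have hμ' : ∀ a, twistedDerSeq D g * μ' a - μ' a * twistedDerSeq D g = μ' (D' a) := by
    rintro ⟨a, c⟩
    simp only [μ', D', LinearMap.coprod_apply, LinearMap.toSpanSingleton_apply, LinearMap.coe_mk,
      AddHom.coe_mk, zero_smul, add_zero, sub_eq_add_neg, map_add]
    rw [← smul_neg, map_smul, ← hP, ← hμ]
    simp only [mul_add, add_mul, mul_smul_comm, smul_mul_assoc, smul_sub]
    abel
  have h2 := commutator_pow_char p D' μ' (twistedDerSeq D g) hμ' (0, 1)
  have hD' : ∀ n, (D' ^ (n + 1)) (0, 1) = (-((D : A →ₗ[K] A) ^ n) g, 0) := by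
    intro n
    induction n with
    | zero => simp [D']
    | succ n ih => rw [pow_succ', Module.End.mul_apply, ih, pow_succ' (D : A →ₗ[K] A)]; simp [D']
  have hDg : (D' ^ p) (0, 1) = (-((D : A →ₗ[K] A) ^ p) l, 0) := by
    have := hD' (p - 1)
    rw [Nat.sub_add_cancel hp.one_le] at this
    rw [this, hg, ← Derivation.coeFn_coe, ← Module.End.mul_apply, ← pow_succ,
      Nat.sub_add_cancel hp.one_le]
  rw [hDg] at h2
  have h3 := LinearMap.congr_fun h2 (Pi.single 0 1)
  have hP1 : P (Pi.single 0 1) = 0 := by funext n; simp [P]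
  simp only [μ', LinearMap.coprod_apply, LinearMap.toSpanSingleton_apply, map_zero, one_smul,
    zero_add, add_zero, LinearMap.sub_apply, Module.End.mul_apply, hP1, zero_sub] at h3
  obtain ⟨h4, h5, -, h7⟩ := twistedDerSeq_pow_one D g p
  have h6 := (twistedDerSeq_pow_one D g (p - 1)).2.2.1
  rw [Nat.sub_add_cancel hp.one_le] at h6
  set s := ((twistedDerSeq D g) ^ p) (Pi.single 0 1) with hs
  -- Coefficientwise form of $\frac{d}{dt}(D+tg)^p1=D^pl$.
  have h8 : ∀ n : ℕ, ((n : A) + 1) * s (n + 1) =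
      if n = 0 then ((D : A →ₗ[K] A) ^ p) l else 0 := by
    intro n
    have := congrFun h3 n
    simp only [P, μ, LinearMap.coe_mk, AddHom.coe_mk, Pi.neg_apply, map_neg] at this
    have h9 : ((n : A) + 1) * s (n + 1) = -(-(((n : A) + 1) * s (n + 1))) := by ring
    rw [h9, this]
    split_ifs with hn <;> simp [Pi.single_apply, hn]
  rw [← h7, Finset.sum_range_succ, h5]
  congr 1
  obtain ⟨q, hq⟩ : ∃ q, p = q + 2 := ⟨p - 2, by have := hp.two_le; omega⟩
  -- For $2\le n<p$ the integer $n$ is invertible in $A$, so the coefficient of $t^n$ vanishes. Only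
  -- the coefficients of $t$ and $t^p$ survive.
  have h10 : ∑ n ∈ Finset.range p, s n = s 1 := by
    refine Finset.sum_eq_single_of_mem 1 (Finset.mem_range.2 hp.one_lt) fun n hn hn1 => ?_
    rcases n with _ | n
    · exact h6
    · have h11 := h8 n
      rw [if_neg (by omega)] at h11
      have hu : IsUnit ((n : A) + 1) := by
        have : ((n : A) + 1) = algebraMap K A ((n + 1 : ℕ) : K) := by simp
        rw [this]
        refine IsUnit.map _ (isUnit_iff_ne_zero.2 ?_)
        rw [Ne, CharP.cast_eq_zero_iff K p]
        exact Nat.not_dvd_of_pos_of_lt (by omega) (Finset.mem_range.1 hn)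
      exact hu.mul_right_eq_zero.1 h11
  rw [h10]
  simpa using h8 0

end Jacobson

end ReducedRep

namespace ReducedRep

attribute [local instance] LieRing.ofAssociativeRing

/-! ### Linear independence of ordered monomials in reduced enveloping algebras -/

section Pairing

variable {K A : Type*} [Field K] [CommRing A] [Algebra K A]

/-- By the Leibniz rule a derivation lowers the $\mathfrak m$-adic order by at most one, even when
it does not preserve $\mathfrak m$. -/
theorem derivation_mem_pow (m : Ideal A) (D : Derivation K A A) (k : ℕ) {f : A}
    (hf : f ∈ m ^ (k + 1)) : D f ∈ m ^ k := by
  induction k generalizing f with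
  | zero => simp
  | succ k ih =>
    rw [pow_succ] at hf
    refine Submodule.mul_induction_on hf (fun a ha b hb => ?_) fun a b ha hb => ?_
    · rw [Derivation.leibniz, smul_eq_mul, smul_eq_mul]
      refine add_mem (Ideal.mul_mem_right _ _ ha) ?_
      rw [pow_succ, mul_comm (m ^ k)]
      exact Ideal.mul_mem_mul hb (ih ha)
    · rw [map_add]
      exact add_mem ha hb

theorem twistedDer_mem_pow (m : Ideal A) (D : Derivation K A A) (g : A) (k : ℕ) {f : A}
    (hf : f ∈ m ^ (k + 1)) : twistedDer D g f ∈ m ^ k :=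
  add_mem (derivation_mem_pow m D k hf) (Ideal.mul_mem_left _ _ (Ideal.pow_le_pow_right k.le_succ hf))

variable {ι : Type*}

theorem prod_mem_pow_card {m : Ideal A} {y : ι → A} (hy : ∀ i, y i ∈ m) (v : Multiset ι) :
    (v.map y).prod ∈ m ^ v.card := by
  induction v using Multiset.induction_on with
  | empty => simp
  | cons i v ih =>
    rw [Multiset.map_cons, Multiset.prod_cons, Multiset.card_cons, pow_succ, mul_comm (m ^ _)]
    exact Ideal.mul_mem_mul (hy i) ih

variable [DecidableEq ι]

/-- If `D y_j ≡ δ_ij` modulo `m`, then `D` acts on monomials in the `y_j` like `∂ / ∂ y_i`, up to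
terms of higher order. -/
theorem derivation_prod_sub_mem {m : Ideal A} {y : ι → A} (hy : ∀ i, y i ∈ m)
    (D : Derivation K A A) (i : ι) (hD : ∀ j, D (y j) - (if i = j then 1 else 0) ∈ m)
    (v : Multiset ι) :
    D (v.map y).prod - (v.count i : A) * ((v.erase i).map y).prod ∈ m ^ v.card := by
  induction v using Multiset.induction_on with
  | empty => simp
  | cons j v ih =>
    have h1 : y j * (D (v.map y).prod - (v.count i : A) * ((v.erase i).map y).prod) ∈
        m ^ (v.card + 1) := by
      rw [pow_succ, mul_comm (m ^ _)]
      exact Ideal.mul_mem_mul (hy j) ih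
    have h2 : (v.map y).prod * (D (y j) - (if i = j then 1 else 0)) ∈ m ^ (v.card + 1) := by
      rw [pow_succ]
      exact Ideal.mul_mem_mul (prod_mem_pow_card hy v) (hD j)
    rw [Multiset.card_cons, Multiset.map_cons, Multiset.prod_cons, Derivation.leibniz]
    have h3 := add_mem h1 h2
    convert h3 using 1
    simp only [smul_eq_mul]
    by_cases hij : i = j
    · subst hij
      rw [Multiset.erase_cons_head, Multiset.count_cons_self, if_pos rfl]
      -- If $i\notin v$, erasing $i$ changes nothing, and the identity holds only because the
      -- coefficient is zero.
      have h4 : (v.count i : A) * (v.map y).prod =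
          (v.count i : A) * (y i * ((v.erase i).map y).prod) := by
        by_cases hi : i ∈ v
        · rw [← Multiset.prod_cons (y i), ← Multiset.map_cons, Multiset.cons_erase hi]
        · rw [Multiset.count_eq_zero_of_notMem hi]
          simp
      push_cast
      rw [add_mul, h4]
      ring
    · rw [Multiset.erase_cons_tail (s := v) (fun h => hij h.symm), Multiset.count_cons_of_ne hij,
        if_neg hij, Multiset.map_cons, Multiset.prod_cons]
      ring

/-- To leading order at the point, each letter $i$ differentiates by $y_i$; the multiplication terms
$g_i$ only contribute at higher order. Thus $c$ is the product of the successive exponents: it is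
zero as soon as a variable is exhausted, and it is prime to $p$ when all exponents are below $p$.
The length bound keeps the truncated subtraction in the error exponent honest. -/
theorem twistedDer_word_sub_mem {m : Ideal A} {y : ι → A} (hy : ∀ i, y i ∈ m)
    (D : ι → Derivation K A A) (hD : ∀ i j, D i (y j) - (if i = j then 1 else 0) ∈ m) (g : ι → A)
    (v : Multiset ι) (u : List ι) (huv : u.length ≤ v.card) :
    ∃ c : ℕ, wordProd (fun i => twistedDer (D i) (g i)) u (v.map y).prod -
        (c : A) * ((v - u).map y).prod ∈ m ^ (v.card - u.length + 1) ∧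
      (¬ (u : Multiset ι) ≤ v → c = 0) ∧
      ∀ p : ℕ, p.Prime → (∀ i, v.count i < p) → (u : Multiset ι) ≤ v → ¬ p ∣ c := by
  induction u with
  | nil =>
    refine ⟨1, by simp [wordProd], by simp, fun p hp _ _ => ?_⟩
    simpa using hp.one_lt.ne'
  | cons i u ih =>
    have hlen : u.length + 1 ≤ v.card := huv
    obtain ⟨c, h1, h2, h3⟩ := ih (by omega)
    have hsub : v - ((i :: u : List ι) : Multiset ι) = (v - u).erase i := by
      rw [← Multiset.cons_coe, ← Multiset.singleton_add, add_comm, tsub_add_eq_tsub_tsub,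
        Multiset.sub_singleton]
    have hle : ((i :: u : List ι) : Multiset ι) ≤ v → (u : Multiset ι) ≤ v := by
      rw [← Multiset.cons_coe]
      exact fun h => (Multiset.le_cons_self _ _).trans h
    refine ⟨c * (v - u).count i, ?_, fun h => ?_, fun p hp hv h => ?_⟩
    · rw [hsub, wordProd_cons, Module.End.mul_apply]
      have hk : v.card - (i :: u).length + 1 = v.card - u.length := by
        rw [List.length_cons]; omega
      rw [hk]
      have h4 := twistedDer_mem_pow m (D i) (g i) _ h1
      rw [map_sub] at h4
      -- When $u\not\le v$ the coefficient $c$ is already zero, so the statement is needed only in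
      -- the first case, where $v-u$ has the expected size.
      have h5 : twistedDer (D i) (g i) ((c : A) * ((v - u).map y).prod) -
          ((c * (v - u).count i : ℕ) : A) * (((v - u).erase i).map y).prod ∈
            m ^ (v.card - u.length) := by
        by_cases huv' : (u : Multiset ι) ≤ v
        · have hcard : (v - u).card = v.card - u.length := by
            rw [Multiset.card_sub huv', Multiset.coe_card]
          have h6 := derivation_prod_sub_mem hy (D i) i (hD i) (v - u)
          have h7 := prod_mem_pow_card hy (v - u)
          rw [hcard] at h6 h7
          have h8 := add_mem (Ideal.mul_mem_left _ (c : A) h6)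
            (Ideal.mul_mem_left _ (g i * (c : A)) h7)
          convert h8 using 1
          rw [twistedDer_apply, Derivation.leibniz, Derivation.map_natCast]
          push_cast
          simp only [smul_eq_mul]
          ring
        · rw [h2 huv']
          simp
      have h9 := add_mem h4 h5
      rwa [sub_add_sub_cancel] at h9
    · by_cases huv' : (u : Multiset ι) ≤ v
      · rw [Nat.mul_eq_zero]
        right
        by_contra hi
        apply h
        rw [← Multiset.cons_coe]
        have hi' : i ∈ v - u := Multiset.count_ne_zero.1 hi
        have := Multiset.singleton_le.2 hi'
        rw [le_tsub_iff_left huv', add_comm, Multiset.singleton_add] at this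
        exact this
      · rw [h2 huv', zero_mul]
    · rw [hp.dvd_mul, not_or]
      refine ⟨h3 p hp hv (hle h), Nat.not_dvd_of_pos_of_lt ?_ ?_⟩
      · rw [Multiset.count_sub]
        have := Multiset.count_le_of_le i h
        rw [← Multiset.cons_coe, Multiset.count_cons_self] at this
        omega
      · exact lt_of_le_of_lt (Multiset.count_le_of_le i (Multiset.sub_le_self _ _)) (hv i)

end Pairing

end ReducedRep

set_option linter.unusedSectionVars false

noncomputable section

namespace ReducedRep

attribute [local instance] LieRing.ofAssociativeRing

/-! ### Representations of reduced enveloping algebras by twisted derivations -/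

section TwistedRepresentation

variable {K : Type*} [Field K] {N : ℕ}

theorem leftDer_add (X Y : Matrix (Fin N) (Fin N) K) (f : Coord K N) :
    leftDer (X + Y) f = leftDer X f + leftDer Y f := by
  have : leftDer (X + Y) = leftDer X + leftDer Y := by
    apply MvPolynomial.derivation_ext
    rintro (⟨i, j⟩ | ⟨i, j⟩)
    · simp [leftDer_inl, mul_add, Finset.sum_add_distrib]
    · simp [leftDer_inr, add_mul, Finset.sum_add_distrib]
      abel
  rw [this, Derivation.add_apply]

theorem leftDer_smul (c : K) (X : Matrix (Fin N) (Fin N) K) (f : Coord K N) :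
    leftDer (c • X) f = c • leftDer X f := by
  have : leftDer (c • X) = c • leftDer X := by
    apply MvPolynomial.derivation_ext
    rintro (⟨i, j⟩ | ⟨i, j⟩)
    · simp [leftDer_inl, MvPolynomial.smul_eq_C_mul, Finset.mul_sum, mul_left_comm]
    · simp [leftDer_inr, MvPolynomial.smul_eq_C_mul, Finset.mul_sum, mul_assoc]
  rw [this, Derivation.smul_apply]

/-- Every linear form on matrices is the differential at the identity of a regular function that
vanishes at the identity. -/
theorem exists_diffOne_eq (φ : Module.Dual K (Matrix (Fin N) (Fin N) K)) :
    ∃ f : Coord K N, evalAt 1 f = 0 ∧ ∀ X, diffOne f X = φ X := by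
  refine ⟨∑ ij : Fin N × Fin N, MvPolynomial.C (φ (Matrix.single ij.1 ij.2 1)) *
    (MvPolynomial.X (Sum.inl ij) -
      MvPolynomial.C ((1 : Matrix (Fin N) (Fin N) K) ij.1 ij.2)), ?_, fun X => ?_⟩
  · simp [evalAt, entries]
  · conv_rhs => rw [Matrix.matrix_eq_sum_single X]
    rw [← evalAt_one_leftDer]
    simp only [map_sum, leftDer_C_mul, map_sub, leftDer_C, sub_zero, map_mul, Fintype.sum_prod_type,
      leftDer_inl]
    refine Finset.sum_congr rfl fun i _ => Finset.sum_congr rfl fun j _ => ?_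
    have : Matrix.single i j (X i j) = X i j • Matrix.single i j (1 : K) := by simp
    rw [this, map_smul, smul_eq_mul, mul_comm]
    simp [evalAt, entries, Matrix.one_apply]

variable (p : ℕ) [Fact p.Prime] [CharP K p]

variable (K N) in
/-- The ideal of the first Frobenius neighbourhood of the identity. -/
def frobIdeal : Ideal (Coord K N) :=
  Ideal.span {f | ∃ g : Coord K N, evalAt 1 g = 0 ∧ f = g ^ p}

/-- $D(g^p)=p\,g^{p-1}Dg=0$ in characteristic $p$. Hence the twisted operators descend to the
quotient. -/
theorem derivation_mem_frobIdeal (D : Derivation K (Coord K N) (Coord K N)) {f : Coord K N}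
    (hf : f ∈ frobIdeal K N p) : D f ∈ frobIdeal K N p := by
  induction hf using Submodule.span_induction with
  | mem f hf =>
    obtain ⟨g, -, rfl⟩ := hf
    rw [Derivation.leibniz_pow, ← Nat.cast_smul_eq_nsmul K, CharP.cast_eq_zero, zero_smul]
    exact zero_mem _
  | zero => simp
  | add a b _ _ ha hb => rw [map_add]; exact add_mem ha hb
  | smul a f hf ih =>
    rw [smul_eq_mul, Derivation.leibniz]
    exact add_mem (Ideal.mul_mem_left _ _ ih) (Ideal.mul_mem_right _ _ hf)

/-- Modulo the ideal a $p$-th power is a constant. This turns the term $(X l)^p$ of Jacobson's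
formula into the scalar $\chi(X)^p$. -/
theorem pow_sub_mem_frobIdeal (f : Coord K N) :
    f ^ p - MvPolynomial.C (evalAt 1 f ^ p) ∈ frobIdeal K N p := by
  refine Ideal.subset_span ⟨f - MvPolynomial.C (evalAt 1 f), ?_, ?_⟩
  · simp [evalAt]
  · rw [sub_pow_char, map_pow]

variable (K N) in
/-- The algebra of functions on the first Frobenius neighbourhood of the identity. -/
abbrev FrobQuot : Type _ := Coord K N ⧸ (frobIdeal K N p).restrictScalars K

/-- The action of a matrix `X` on functions by the operator `X + X(l)`. -/
def twistedOp (l : Coord K N) (X : Matrix (Fin N) (Fin N) K) : Module.End K (FrobQuot K N p) :=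
  Submodule.mapQ _ _ (twistedDer (leftDer X) (leftDer X l)) fun _ hf =>
    add_mem (derivation_mem_frobIdeal p _ hf) (Ideal.mul_mem_left _ _ hf)

theorem twistedOp_mk (l : Coord K N) (X : Matrix (Fin N) (Fin N) K) (f : Coord K N) :
    twistedOp p l X (Submodule.Quotient.mk f) =
      Submodule.Quotient.mk (twistedDer (leftDer X) (leftDer X l) f) := rfl

/-- The action of the Lie algebra of `G` on functions by the operators `X + X(l)`. -/
def twistedRep (G : Subgroup (GL (Fin N) K)) (l : Coord K N) :
    lieAlg G →ₗ⁅K⁆ Module.End K (FrobQuot K N p) where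
  toFun X := twistedOp p l (X : Matrix (Fin N) (Fin N) K)
  map_add' X Y := by
    apply LinearMap.ext
    intro f
    obtain ⟨f, rfl⟩ := Submodule.Quotient.mk_surjective _ f
    rw [LinearMap.add_apply, twistedOp_mk, twistedOp_mk, twistedOp_mk,
      ← Submodule.Quotient.mk_add]
    congr 1
    have h : ((X + Y : lieAlg G) : Matrix (Fin N) (Fin N) K) = X + Y := rfl
    simp only [twistedDer_apply, h, leftDer_add]
    ring
  map_smul' c X := by
    apply LinearMap.ext
    intro f
    obtain ⟨f, rfl⟩ := Submodule.Quotient.mk_surjective _ f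
    rw [RingHom.id_apply, LinearMap.smul_apply, twistedOp_mk, twistedOp_mk,
      ← Submodule.Quotient.mk_smul]
    congr 1
    have h : ((c • X : lieAlg G) : Matrix (Fin N) (Fin N) K) = c • X := rfl
    simp only [twistedDer_apply, h, leftDer_smul, smul_add, smul_mul_assoc]
  map_lie' := by
    intro X Y
    apply LinearMap.ext
    intro f
    obtain ⟨f, rfl⟩ := Submodule.Quotient.mk_surjective _ f
    rw [LieRing.of_associative_ring_bracket, LinearMap.sub_apply, Module.End.mul_apply,
      Module.End.mul_apply, twistedOp_mk, twistedOp_mk, twistedOp_mk, twistedOp_mk, twistedOp_mk,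
      ← Submodule.Quotient.mk_sub]
    congr 1
    have h : ((⁅X, Y⁆ : lieAlg G) : Matrix (Fin N) (Fin N) K) =
      (X : Matrix (Fin N) (Fin N) K) * Y - Y * X := rfl
    simp only [twistedDer_apply, h, leftDer_lie, map_add, Derivation.leibniz, smul_eq_mul]
    ring

/-- Jacobson's formula gives $(X+X(l))^p=X^p+X^p(l)+X(l)^p$. The first two terms are the twisted
operator of $X^{[p]}$, since the $p$-th power of the derivation of $X$ is the derivation of the
matrix $X^p$; the last is $\chi(X)^p$ modulo the Frobenius ideal. -/
theorem twistedRep_pow (G : Subgroup (GL (Fin N) K)) (χ : Module.Dual K (lieAlg G)) (l : Coord K N)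
    (hl : ∀ X : lieAlg G, diffOne l (X : Matrix (Fin N) (Fin N) K) = χ X) (X : lieAlg G) :
    twistedRep p G l X ^ p = twistedRep p G l (pPow p G X) +
      algebraMap K (Module.End K (FrobQuot K N p)) (χ X ^ p) := by
  apply LinearMap.ext
  intro f
  obtain ⟨f, rfl⟩ := Submodule.Quotient.mk_surjective _ f
  have h1 : ∀ n : ℕ, (twistedRep p G l X ^ n) (Submodule.Quotient.mk f) = Submodule.Quotient.mk
      ((twistedDer (leftDer (X : Matrix (Fin N) (Fin N) K)) (leftDer X l) ^ n) f) := by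
    intro n
    induction n with
    | zero => rfl
    | succ n ih => rw [pow_succ', Module.End.mul_apply, ih, pow_succ', Module.End.mul_apply]; rfl
  rw [h1, twistedDer_pow_char, LinearMap.add_apply, Module.algebraMap_end_apply]
  change _ = twistedOp p l ((X : Matrix (Fin N) (Fin N) K) ^ p) _ + _
  rw [twistedOp_mk, ← Submodule.Quotient.mk_smul, ← Submodule.Quotient.mk_add,
    Submodule.Quotient.eq, twistedDer_apply, leftDer_pow_char p, leftDer_pow_char p]
  have h2 := pow_sub_mem_frobIdeal p (leftDer (X : Matrix (Fin N) (Fin N) K) l)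
  rw [evalAt_one_leftDer, hl] at h2
  have h3 := Ideal.mul_mem_right f _ h2
  rw [Submodule.restrictScalars_mem]
  convert h3 using 1
  rw [MvPolynomial.smul_eq_C_mul]
  ring

/-- Evaluation at the identity. -/
def evalQuot : FrobQuot K N p →ₗ[K] K :=
  Submodule.liftQ _ (evalAt 1).toLinearMap fun f hf => by
    have hp : p ≠ 0 := (Fact.out : p.Prime).ne_zero
    have : frobIdeal K N p ≤ RingHom.ker (evalAt (1 : GL (Fin N) K)) := by
      refine Ideal.span_le.2 ?_
      rintro _ ⟨g, hg, rfl⟩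
      simp [RingHom.mem_ker, hg, hp]
    exact this hf

theorem evalQuot_mk (f : Coord K N) :
    evalQuot p (Submodule.Quotient.mk f : FrobQuot K N p) = evalAt 1 f := rfl

theorem count_flatMap_replicate {ι : Type*} [DecidableEq ι] {l : List ι} (hl : l.Nodup)
    (hl' : ∀ i, i ∈ l) (a : ι → ℕ) (j : ι) :
    (l.flatMap fun i => List.replicate (a i) i).count j = a j := by
  rw [List.count_flatMap]
  have : (List.count j ∘ fun i => List.replicate (a i) i) = fun i => if i = j then a j else 0 := by
    funext i
    simp only [Function.comp_apply, List.count_replicate, beq_iff_eq]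
    split_ifs with h
    · rw [h]
    · rfl
  rw [this, ← List.sum_toFinset _ hl, Finset.sum_ite_eq']
  simp [hl']

/-- The ordered monomials with exponents less than `p` in linearly independent elements of the Lie
algebra are linearly independent in the reduced enveloping algebra. -/
theorem linearIndependent_orderedMon (G : Subgroup (GL (Fin N) K)) (χ : Module.Dual K (lieAlg G))
    {ι : Type*} [Fintype ι] {x : ι → lieAlg G} (hx : LinearIndependent K x) {l : List ι}
    (hl : l.Nodup) (hl' : ∀ i, i ∈ l) :
    LinearIndependent K fun a : ι → Fin p =>
      orderedMon (fun i => redι p G χ (x i)) l fun i => (a i : ℕ) := by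
  classical
  have hp : p.Prime := Fact.out
  -- The form is extended from the Lie algebra to all matrices, where it is visibly the differential
  -- of a polynomial in the matrix entries.
  obtain ⟨χ', hχ'⟩ := LinearMap.exists_extend χ
  obtain ⟨ℓ, -, hℓ⟩ := exists_diffOne_eq χ'
  have hℓ' : ∀ X : lieAlg G, diffOne ℓ (X : Matrix (Fin N) (Fin N) K) = χ X := fun X => by
    rw [hℓ, ← hχ']; rfl
  let ρ := redLift p G χ (twistedRep p G ℓ) (twistedRep_pow p G χ ℓ hℓ')
  let D : ι → Derivation K (Coord K N) (Coord K N) :=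
    fun i => leftDer (x i : Matrix (Fin N) (Fin N) K)
  have hρ : ∀ (u : List ι) (f : Coord K N),
      ρ (wordProd (fun i => redι p G χ (x i)) u) (Submodule.Quotient.mk f) =
        Submodule.Quotient.mk (wordProd (fun i => twistedDer (D i) (D i ℓ)) u f) := by
    intro u f
    induction u with
    | nil => simp [wordProd]
    | cons i u ih =>
      rw [wordProd_cons, wordProd_cons, map_mul, Module.End.mul_apply, ih, Module.End.mul_apply]
      simp only [ρ, redLift_ι]
      rfl
  have hx' : LinearIndependent K fun i => (x i : Matrix (Fin N) (Fin N) K) :=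
    hx.map' (lieAlg G).toSubmodule.subtype (Submodule.ker_subtype _)
  -- Local coordinates at the identity dual to the $x_i$: the coordinate forms on the span of the
  -- $x_i$ are extended to all matrices and realized as differentials.
  obtain ⟨y, hy, hDy⟩ : ∃ y : ι → Coord K N, (∀ j, evalAt 1 (y j) = 0) ∧
      ∀ i j, evalAt 1 (D i (y j)) = if i = j then 1 else 0 := by
    have : ∀ j, ∃ f : Coord K N, evalAt 1 f = 0 ∧
        ∀ i, evalAt 1 (D i f) = if i = j then 1 else 0 := by
      intro j
      obtain ⟨φ, hφ⟩ := (LinearMap.exists_extend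
        ((Finsupp.lapply j).comp hx'.repr))
      obtain ⟨f, hf, hf'⟩ := exists_diffOne_eq φ
      refine ⟨f, hf, fun i => ?_⟩
      rw [evalAt_one_leftDer, hf']
      have h1 := LinearMap.congr_fun hφ ⟨(x i : Matrix (Fin N) (Fin N) K),
        Submodule.subset_span ⟨i, rfl⟩⟩
      rw [LinearMap.comp_apply, LinearMap.comp_apply,
        hx'.repr_eq_single i _ rfl] at h1
      simpa [Finsupp.single_apply] using h1
    choose y hy using this
    exact ⟨y, fun j => (hy j).1, fun i j => (hy j).2 i⟩
  set m : Ideal (Coord K N) := RingHom.ker (evalAt (1 : GL (Fin N) K)) with hm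
  have hy' : ∀ j, y j ∈ m := hy
  have hD : ∀ i j, D i (y j) - (if i = j then 1 else 0) ∈ m := by
    intro i j
    rw [hm, RingHom.mem_ker, map_sub, hDy]
    split_ifs <;> simp
  let word : (ι → Fin p) → List ι := fun a => l.flatMap fun i => List.replicate (a i : ℕ) i
  have hword : ∀ a i, (word a).count i = a i :=
    fun a i => count_flatMap_replicate hl hl' (fun i => (a i : ℕ)) i
  -- The pairing applies the monomial $x^a$ as a differential operator to $y^b$ and evaluates at the
  -- identity.
  let pairing : (ι → Fin p) → (ι → Fin p) → K := fun a b =>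
    evalAt 1 (wordProd (fun i => twistedDer (D i) (D i ℓ)) (word a)
      (((word b : Multiset ι).map y).prod))
  have hpair : ∀ a b, (word a).length ≤ (word b).length → (pairing a b = 0 ↔ a ≠ b) := by
    intro a b hab
    obtain ⟨c, h1, h2, h3⟩ := twistedDer_word_sub_mem hy' D hD (fun i => D i ℓ)
      (word b : Multiset ι) (word a) (by simpa using hab)
    -- The exponent of the error ideal is at least one, so the error vanishes at the identity.
    have h4 := Ideal.pow_le_self (by omega) h1
    rw [hm, RingHom.mem_ker, map_sub, sub_eq_zero, map_mul, map_natCast] at h4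
    change pairing a b = _ at h4
    rw [h4]
    by_cases hle : (word a : Multiset ι) ≤ word b
    · by_cases hab' : a = b
      · subst hab'
        have hc := h3 p hp (fun i => by rw [Multiset.coe_count, hword]; exact (a i).2) le_rfl
        rw [← CharP.cast_eq_zero_iff K p] at hc
        simpa using hc
      · simp only [ne_eq, hab', not_false_eq_true, iff_true]
        have hne : (word b : Multiset ι) - (word a : Multiset ι) ≠ 0 := by
          intro h0
          have h5 := le_antisymm hle (tsub_eq_zero_iff_le.1 h0)
          refine hab' (funext fun i => Fin.ext ?_)
          rw [← hword a i, ← hword b i, ← Multiset.coe_count, h5, Multiset.coe_count]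
        obtain ⟨i, hi⟩ := Multiset.exists_mem_of_ne_zero hne
        rw [← Multiset.cons_erase hi, Multiset.map_cons, Multiset.prod_cons, map_mul, hy, zero_mul,
          mul_zero]
    · rw [h2 hle]
      simp only [Nat.cast_zero, zero_mul, true_iff]
      rintro rfl
      exact hle le_rfl
  rw [Fintype.linearIndependent_iff]
  intro k hk
  by_contra hne
  push Not at hne
  -- Take $b$ of maximal degree among the exponents that occur in the relation. All others have
  -- degree at most that of $b$ and pair to zero with $y^b$, which isolates the coefficient of $b$.
  obtain ⟨b, hb, hmax⟩ := (Finset.univ.filter fun a => k a ≠ 0).exists_max_image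
    (fun a => (word a).length) (by obtain ⟨a, ha⟩ := hne; exact ⟨a, by simpa using ha⟩)
  have hb' : k b ≠ 0 := by simpa using hb
  have h1 : ∑ a, k a * pairing a b = 0 := by
    have h2 := congrArg (fun z => evalQuot p (ρ z
      (Submodule.Quotient.mk (((word b : Multiset ι).map y).prod)))) hk
    simp only [map_zero, LinearMap.zero_apply, map_sum, LinearMap.sum_apply, map_smul,
      LinearMap.smul_apply, smul_eq_mul] at h2
    rw [← h2]
    refine Finset.sum_congr rfl fun a _ => ?_
    rw [← wordProd_flatMap_replicate, hρ, evalQuot_mk]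
  rw [Finset.sum_eq_single b] at h1
  · rcases mul_eq_zero.1 h1 with h2 | h2
    · exact hb' h2
    · exact (hpair b b le_rfl).1 h2 rfl
  · intro a _ hab
    by_cases ha : k a = 0
    · rw [ha, zero_mul]
    · rw [(hpair a b (hmax a (by simpa using ha))).2 hab, mul_zero]
  · simp

end TwistedRepresentation

end ReducedRep

end

set_option linter.unusedSectionVars false

noncomputable section

namespace ReducedRep

attribute [local instance] LieRing.ofAssociativeRing

/-! ### Weights of root vectors -/

section WeightVectors

variable {K : Type*} [Field K] {N : ℕ} {T : Subgroup (GL (Fin N) K)}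

/-- `Lie T` acts on the weight space of `y` through the differential of `y`. -/
theorem mul_sub_mul_of_mem_wtSpace {y : charGroup T} {X : Matrix (Fin N) (Fin N) K}
    (hX : X ∈ wtSpace y) (h : lieAlg T) :
    (h : Matrix (Fin N) (Fin N) K) * X - X * h = charDiff y h • X := by
  obtain ⟨F, hF⟩ := y.2
  have hF' : ∀ t : T, (charVal y t : K) = evalAt (t : GL (Fin N) K) F := hF
  have hF1 : evalAt (1 : GL (Fin N) K) F = 1 := by
    have := hF' 1
    simpa [charVal] using this.symm
  ext i j
  -- This is the $(i,j)$ entry of $gX-y(g)Xg$, which vanishes on $T$. Its derivative at $1$ in the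
  -- direction $h$ is the same entry of $hX-Xh-dy(h)X$.
  let f : Coord K N := (∑ k, MvPolynomial.X (Sum.inl (i, k)) * MvPolynomial.C (X k j)) -
    F * ∑ k, MvPolynomial.C (X i k) * MvPolynomial.X (Sum.inl (k, j))
  have hf : ∀ g ∈ T, evalAt g f = 0 := by
    intro g hg
    have h1 := hX ⟨g, hg⟩
    rw [hF'] at h1
    have h2 : (g : Matrix (Fin N) (Fin N) K) * X = evalAt g F • (X * g) := by
      rw [← smul_mul_assoc, ← h1, mul_assoc, ← Units.val_mul, inv_mul_cancel, Units.val_one,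
        mul_one]
    have h3 := congrFun (congrFun h2 i) j
    simp only [Matrix.mul_apply, Matrix.smul_apply, smul_eq_mul] at h3
    simp only [f, map_sub, map_mul, map_sum]
    simpa [evalAt, entries, sub_eq_zero] using h3
  have h0 := h.2 f hf
  rw [← evalAt_one_leftDer] at h0
  simp only [f, map_sum, map_sub, leftDer_C, leftDer_inl, Derivation.leibniz, map_add, smul_eq_mul, map_mul, hF1] at h0
  rw [evalAt_one_leftDer, ← charDiff_apply y F hF'] at h0
  simp [evalAt, entries, Matrix.one_apply] at h0
  rw [Matrix.sub_apply, Matrix.smul_apply, Matrix.mul_apply, Matrix.mul_apply, smul_eq_mul]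
  have h5 : ∑ k, (h : Matrix (Fin N) (Fin N) K) i k * X k j =
      ∑ k, X k j * (h : Matrix (Fin N) (Fin N) K) i k :=
    Finset.sum_congr rfl fun _ _ => mul_comm _ _
  rw [h5]
  linear_combination h0

/-- With $c=dy(h)$ one has $hX=X(h+c)$, hence $h^pX=X(h+c)^p=X(h^p+c^p)$. Comparing with
$[h^{[p]},X]=dy(h^{[p]})X$ gives the claim, as $X\ne0$. -/
theorem charDiff_pPow (p : ℕ) [Fact p.Prime] [CharP K p] {y : charGroup T}
    {X : Matrix (Fin N) (Fin N) K} (hX : X ∈ wtSpace y) (hX0 : X ≠ 0) (h : lieAlg T) :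
    charDiff y (pPow p T h) = charDiff y h ^ p := by
  have hN : Nonempty (Fin N) := by
    by_contra hN
    rw [not_nonempty_iff] at hN
    exact hX0 (Subsingleton.elim _ _)
  have : CharP (Matrix (Fin N) (Fin N) K) p :=
    charP_of_injective_algebraMap (FaithfulSMul.algebraMap_injective K _) p
  have h1 := mul_sub_mul_of_mem_wtSpace hX h
  have h2 := mul_sub_mul_of_mem_wtSpace hX (pPow p T h)
  set c := charDiff y h with hc
  have h3 : ∀ n : ℕ, (h : Matrix (Fin N) (Fin N) K) ^ n * X =
      X * ((h : Matrix (Fin N) (Fin N) K) + algebraMap K _ c) ^ n := by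
    intro n
    induction n with
    | zero => simp
    | succ n ih =>
      rw [pow_succ', mul_assoc, ih, ← mul_assoc, sub_eq_iff_eq_add.1 h1, pow_succ', ← mul_assoc]
      congr 1
      rw [mul_add, Algebra.algebraMap_eq_smul_one, mul_smul_comm, mul_one, add_comm]
  have h4 := h3 p
  rw [add_pow_char_of_commute _ (Algebra.commute_algebraMap_right _ _), ← map_pow, mul_add,
    Algebra.algebraMap_eq_smul_one, mul_smul_comm, mul_one] at h4
  change (h : Matrix (Fin N) (Fin N) K) ^ p * X - X * (h : Matrix (Fin N) (Fin N) K) ^ p = _ at h2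
  rw [h4, add_sub_cancel_left] at h2
  exact (smul_left_injective K hX0 h2).symm

theorem lie_mem_wtSpace {x y : charGroup T} {X Y : Matrix (Fin N) (Fin N) K} (hX : X ∈ wtSpace x)
    (hY : Y ∈ wtSpace y) : ⁅X, Y⁆ ∈ wtSpace (x + y) := by
  rw [LieRing.of_associative_ring_bracket]
  refine sub_mem (wtSpace_mul hX hY) ?_
  rw [add_comm x y]
  exact wtSpace_mul hY hX

theorem pow_mem_wtSpace {x : charGroup T} {X : Matrix (Fin N) (Fin N) K} (hX : X ∈ wtSpace x)
    (n : ℕ) : X ^ n ∈ wtSpace (n • x) := by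
  induction n with
  | zero =>
    intro t
    rw [pow_zero, zero_smul, mul_one, ← Units.val_mul, mul_inv_cancel, charVal_zero]
    simp
  | succ n ih =>
    rw [pow_succ, succ_nsmul]
    exact wtSpace_mul ih hX

end WeightVectors

/-! ### Root spaces, signs and heights of roots -/

namespace ReductiveSetup

variable {K : Type*} [Field K] {N : ℕ} (S : ReductiveSetup K N)

/-- The root vector of the Chevalley basis. -/
def rootVec (α : Roots S.G S.T) : S.LieG := S.c (Sum.inr α)

theorem rootVec_mem (α : Roots S.G S.T) :
    (S.rootVec α : Matrix (Fin N) (Fin N) K) ∈ wtSpace α.1 := (S.isChevalley.root_vector α).2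

theorem rootVec_ne_zero (α : Roots S.G S.T) : (S.rootVec α : Matrix (Fin N) (Fin N) K) ≠ 0 :=
  fun h => S.c.ne_zero (Sum.inr α) (Subtype.ext h)

theorem basis_inl (i : Fin S.d) : S.c (Sum.inl i) = S.inclT (S.h i) :=
  Subtype.ext (S.isChevalley.toral i)

/-- The root spaces are lines: every Chevalley basis vector other than $e_\alpha$ lies in another
weight space, so $x$ minus its $e_\alpha$-component is a sum of vectors of other weights.
Independence of the weight spaces makes it zero. -/
theorem eq_smul_rootVec (α : Roots S.G S.T) (x : S.LieG)
    (hx : (x : Matrix (Fin N) (Fin N) K) ∈ wtSpace α.1) : ∃ k : K, x = k • S.rootVec α := by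
  set M := ⨆ (y : charGroup S.T) (_ : y ≠ α.1),
    (wtSpace y : Submodule K (Matrix (Fin N) (Fin N) K)) with hM
  have h : M.mkQ ∘ₗ (S.LieG.toSubmodule.subtype - S.LieG.toSubmodule.subtype ∘ₗ
      (LinearMap.toSpanSingleton K S.LieG (S.rootVec α)).comp (S.c.coord (Sum.inr α))) = 0 := by
    apply S.c.ext
    intro i
    rw [LinearMap.comp_apply, LinearMap.zero_apply, Submodule.mkQ_apply,
      Submodule.Quotient.mk_eq_zero, LinearMap.sub_apply, LinearMap.comp_apply,
      LinearMap.comp_apply, Module.Basis.coord_apply, Module.Basis.repr_self,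
      LinearMap.toSpanSingleton_apply]
    rcases i with i | β
    · rw [Finsupp.single_eq_of_ne (by simp), zero_smul, map_zero, sub_zero, basis_inl]
      refine Submodule.mem_iSup_of_mem 0 (Submodule.mem_iSup_of_mem (Ne.symm α.2.1) ?_)
      exact lieAlg_torus_le S.isTorus (S.h i).2
    · by_cases hβ : β = α
      · subst hβ
        rw [Finsupp.single_eq_same, one_smul]
        change (S.rootVec β : Matrix (Fin N) (Fin N) K) - S.rootVec β ∈ M
        rw [sub_self]
        exact zero_mem _
      · rw [Finsupp.single_eq_of_ne (by simpa using Ne.symm hβ), zero_smul, map_zero, sub_zero]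
        exact Submodule.mem_iSup_of_mem β.1 (Submodule.mem_iSup_of_mem
          (fun h => hβ (Subtype.ext h)) (S.rootVec_mem β))
  have h1 := LinearMap.congr_fun h x
  rw [LinearMap.comp_apply, LinearMap.zero_apply, Submodule.mkQ_apply,
    Submodule.Quotient.mk_eq_zero] at h1
  refine ⟨S.c.coord (Sum.inr α) x, ?_⟩
  have h2 : (x : Matrix (Fin N) (Fin N) K) - (S.c.coord (Sum.inr α) x • S.rootVec α : S.LieG) ∈
      wtSpace α.1 := sub_mem hx (Submodule.smul_mem _ _ (S.rootVec_mem α))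
  have h3 := (wtSpace_indep S.isTorus α.1).le_bot ⟨h2, h1⟩
  exact Subtype.ext (sub_eq_zero.1 h3)

theorem eq_zero_of_not_isRoot {y : charGroup S.T} (hy : y ≠ 0) (hy' : ¬ IsRoot S.G y) (x : S.LieG)
    (hx : (x : Matrix (Fin N) (Fin N) K) ∈ wtSpace y) : x = 0 := by
  by_contra h0
  refine hy' ⟨hy, fun h => h0 (Subtype.ext ?_)⟩
  have : (x : Matrix (Fin N) (Fin N) K) ∈ rootSpace S.G y := ⟨x.2, hx⟩
  rw [h] at this
  exact this

theorem exists_eq_inclT (x : S.LieG)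
    (hx : (x : Matrix (Fin N) (Fin N) K) ∈ wtSpace (0 : charGroup S.T)) :
    ∃ t : S.LieT, x = S.inclT t := by
  refine ⟨S.projT x, Subtype.ext ?_⟩
  have h1 : (x : Matrix (Fin N) (Fin N) K) - S.projT x ∈ wtSpace (0 : charGroup S.T) :=
    sub_mem hx (lieAlg_torus_le S.isTorus (S.projT x).2)
  have h3 := (wtSpace_indep S.isTorus 0).le_bot ⟨h1, S.sub_projT_mem x⟩
  exact sub_eq_zero.1 h3

/-- The reflection in $\alpha$ permutes the roots and sends $\alpha$ to $-\alpha$. -/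
theorem isRoot_neg (α : Roots S.G S.T) : IsRoot S.G (-α.1) := by
  have h : (S.P.reflectionPerm α α).1 = -α.1 := by
    rw [← S.isRootDatum.root, ← S.isRootDatum.root]
    rw [S.P.root_reflectionPerm, S.P.reflection_apply_self]
  rw [← h]
  exact (S.P.reflectionPerm α α).2

/-- The negative of a root. -/
def negRoot (α : Roots S.G S.T) : Roots S.G S.T := ⟨-α.1, S.isRoot_neg α⟩

theorem isPositive_or_neg (α : Roots S.G S.T) :
    IsPositive S.base α ∨ IsPositive S.base (S.negRoot α) := by
  unfold IsPositive
  rw [S.isRootDatum.root (S.negRoot α)]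
  have := S.base.root_mem_or_neg_mem α
  rwa [S.isRootDatum.root] at this ⊢

/-- A root is a nonnegative or a nonpositive combination of simple roots. The second alternative
would put both $\alpha$ and $-\alpha$ in the cone of simple roots, which contains no line. -/
theorem height_pos {α : Roots S.G S.T} (hα : IsPositive S.base α) : 0 < S.base.height α := by
  obtain ⟨f, -, hf | hf⟩ := S.base.exists_root_eq_sum_nat_or_neg α
  · have h1 : S.P.root α = ∑ j ∈ S.base.support, (f j : ℤ) • S.P.root j := by simp [hf]
    refine lt_of_le_of_ne ?_ (S.base.height_ne_zero α).symm
    rw [RootPairing.Base.height_eq_sum h1]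
    exact Finset.sum_nonneg fun j _ => Int.natCast_nonneg _
  · exfalso
    have h1 : -S.P.root α ∈ AddSubmonoid.closure (S.P.root '' S.base.support) := by
      rw [hf, neg_neg]
      exact sum_mem fun j hj =>
        nsmul_mem (AddSubmonoid.subset_closure (Set.mem_image_of_mem _ hj)) _
    exact S.P.ne_zero α (S.closure_pointed hα h1 (add_neg_cancel _))

theorem height_negRoot (α : Roots S.G S.T) :
    S.base.height (S.negRoot α) = -S.base.height α := by
  -- $-\alpha$ is written as $\alpha+(-2)\alpha$ to fit this additivity rule.
  have := S.base.height_add_zsmul (i := α) (j := α) (k := S.negRoot α) (z := -2) (by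
    rw [S.isRootDatum.root, S.isRootDatum.root]
    change -α.1 = _
    module)
  rw [this]
  simp only [smul_eq_mul]
  ring

theorem height_add' {α β δ : Roots S.G S.T} (h : δ.1 = α.1 + β.1) :
    S.base.height δ = S.base.height α + S.base.height β :=
  S.base.height_add (by rw [S.isRootDatum.root, S.isRootDatum.root, S.isRootDatum.root, h])

theorem height_nsmul {α δ : Roots S.G S.T} (n : ℕ) (h : δ.1 = n • α.1) :
    S.base.height δ = n * S.base.height α := by
  have := S.base.height_add_zsmul (i := α) (j := α) (k := δ) (z := n - 1) (by
    rw [S.isRootDatum.root, S.isRootDatum.root, h]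
    module)
  rw [this]
  simp only [smul_eq_mul]
  ring

end ReductiveSetup

end ReducedRep

end

set_option linter.unusedSectionVars false

noncomputable section

namespace ReducedRep

attribute [local instance] LieRing.ofAssociativeRing

/-! ### Spanning sets of reduced enveloping algebras -/

section Spanning

variable {K : Type*} [Field K] {N : ℕ} (p : ℕ) [Fact p.Prime] [CharP K p]
  (H : Subgroup (GL (Fin N) K)) (χ : Module.Dual K (lieAlg H))

theorem redEnv_hom_ext {A : Type*} [Ring A] [Algebra K A] {f g : RedEnv p H χ →ₐ[K] A}
    (h : ∀ x, f (redι p H χ x) = g (redι p H χ x)) : f = g := by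
  apply RingQuot.ringQuot_ext'
  apply UniversalEnvelopingAlgebra.hom_ext
  ext x
  exact h x

/-- The universal property gives a homomorphism into the subalgebra generated by the Lie algebra.
Composed with the inclusion it fixes the Lie algebra, hence it is the identity. -/
theorem adjoin_redι : Algebra.adjoin K (Set.range (redι p H χ)) = ⊤ := by
  set A := Algebra.adjoin K (Set.range (redι p H χ)) with hA
  have hmem : ∀ x, redι p H χ x ∈ A := fun x => Algebra.subset_adjoin ⟨x, rfl⟩
  let f : lieAlg H →ₗ⁅K⁆ A :=
    { toFun := fun x => ⟨redι p H χ x, hmem x⟩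
      map_add' := fun x y => Subtype.ext (map_add _ _ _)
      map_smul' := fun c x => Subtype.ext (map_smul _ _ _)
      map_lie' := fun {x y} => Subtype.ext (LieHom.map_lie _ _ _) }
  let g : RedEnv p H χ →ₐ[K] A := redLift p H χ f fun x => Subtype.ext (redι_pow p H χ x)
  have h : A.val.comp g = AlgHom.id K _ := redEnv_hom_ext p H χ fun x => by
    rw [AlgHom.comp_apply, redLift_ι]
    rfl
  refine eq_top_iff.2 fun y _ => ?_
  rw [← AlgHom.id_apply (R := K) y, ← h]
  exact (g y).2

variable {ι : Type*} {x : ι → lieAlg H}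

theorem redι_mem_span (hx : Submodule.span K (Set.range x) = ⊤) (y : lieAlg H) :
    redι p H χ y ∈ Submodule.span K (Set.range fun i => redι p H χ (x i)) := by
  have h1 : y ∈ Submodule.span K (Set.range x) := hx ▸ Submodule.mem_top
  have h2 := Submodule.mem_map_of_mem (f := (redι p H χ : lieAlg H →ₗ[K] RedEnv p H χ)) h1
  rw [Submodule.map_span, ← Set.range_comp] at h2
  exact h2

theorem span_wordProd (hx : Submodule.span K (Set.range x) = ⊤) :
    Submodule.span K (Set.range (wordProd fun i => redι p H χ (x i))) = ⊤ := by
  have h1 : Algebra.adjoin K (Set.range fun i => redι p H χ (x i)) = ⊤ := by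
    rw [← top_le_iff, ← adjoin_redι p H χ]
    refine Algebra.adjoin_le ?_
    rintro _ ⟨y, rfl⟩
    exact Algebra.span_le_adjoin K _ (redι_mem_span p H χ hx y)
  rw [← Algebra.top_toSubmodule, ← h1, Algebra.adjoin_eq_span]
  refine le_antisymm (Submodule.span_le.2 ?_) (Submodule.span_mono ?_)
  · rintro _ ⟨u, rfl⟩
    refine Submodule.subset_span ?_
    induction u with
    | nil => exact one_mem _
    | cons i u ih =>
      rw [wordProd_cons]
      exact mul_mem (Submonoid.subset_closure ⟨i, rfl⟩) ih
  · intro y hy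
    induction hy using Submonoid.closure_induction with
    | mem y hy =>
      obtain ⟨i, rfl⟩ := hy
      exact ⟨[i], by simp [wordProd]⟩
    | one => exact ⟨[], by simp [wordProd]⟩
    | mul a b _ _ ha hb =>
      obtain ⟨u, rfl⟩ := ha
      obtain ⟨v, rfl⟩ := hb
      exact ⟨u ++ v, wordProd_append u v⟩

/-- The ordered monomials with exponents less than `p` in a spanning family of the Lie algebra span
the reduced enveloping algebra. -/
theorem span_orderedMon [Fintype ι] (hx : Submodule.span K (Set.range x) = ⊤) {l : List ι}
    (hl : l.Nodup) (hl' : ∀ i, i ∈ l) :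
    Submodule.span K (Set.range fun a : ι → Fin p =>
      orderedMon (fun i => redι p H χ (x i)) l fun i => (a i : ℕ)) = ⊤ := by
  have hp : p.Prime := Fact.out
  have h1 : ∀ k, 1 < k → ∀ y, redι p H χ y ∈
      filtLT K (fun i => redι p H χ (x i)) (fun _ => 1) k := by
    intro k hk y
    refine Submodule.span_mono ?_ (redι_mem_span p H χ hx y)
    rintro _ ⟨i, rfl⟩
    exact ⟨[i], by simpa [wordWt] using hk, by simp [wordProd]⟩
  rw [← top_le_iff, ← span_wordProd p H χ hx]
  refine Submodule.span_le.2 ?_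
  rintro _ ⟨u, rfl⟩
  -- All generators have weight $1$, so the filtration is by degree: a bracket has degree $1<2$, and
  -- $x^{[p]}+\chi(x)^p$ has degree at most $1<p$.
  refine Submodule.span_mono ?_ (wordProd_mem_reducedSpan (K := K) (p := p) (w := fun _ => 1)
    (fun i j => ?_) (fun i => ?_) hl hl' u)
  · rintro _ ⟨a, -, rfl⟩
    exact ⟨a, rfl⟩
  · rw [← LieRing.of_associative_ring_bracket, ← LieHom.map_lie]
    exact h1 _ (by norm_num) _
  · rw [redι_pow, mul_one]
    refine add_mem (h1 _ hp.one_lt _) ?_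
    rw [Algebra.algebraMap_eq_smul_one]
    refine Submodule.smul_mem _ _ (Submodule.subset_span ⟨[], ?_, by simp [wordProd]⟩)
    simpa [wordWt] using hp.pos

end Spanning

namespace ReductiveSetup

/-! ### Root vectors and brackets -/

variable {K : Type*} [Field K] {N : ℕ} (S : ReductiveSetup K N) {D : ℕ} (γ : Fin D ≃ S.PosRoots)

/-- The root vectors of the positive roots. -/
def eVec (j : Fin D) : S.LieG := S.rootVec (γ j).1

/-- The root vectors of the negative roots. -/
def fVec (j : Fin D) : S.LieG := S.rootVec (S.negRoot (γ j).1)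

/-- The height of a positive root. -/
def ht (j : Fin D) : ℕ := (S.base.height (γ j).1).toNat

theorem ht_cast (j : Fin D) : (S.ht γ j : ℤ) = S.base.height (γ j).1 :=
  Int.toNat_of_nonneg (S.height_pos (γ j).2).le

theorem ht_pos (j : Fin D) : 0 < S.ht γ j := by
  have h1 := S.ht_cast γ j
  have h2 := S.height_pos (γ j).2
  omega

theorem root_cases (α : Roots S.G S.T) :
    (∃ j, α = (γ j).1) ∨ ∃ j, α = S.negRoot (γ j).1 := by
  rcases S.isPositive_or_neg α with h | h
  · exact Or.inl ⟨γ.symm ⟨α, h⟩, by simp⟩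
  · refine Or.inr ⟨γ.symm ⟨S.negRoot α, h⟩, ?_⟩
    rw [Equiv.apply_symm_apply]
    exact Subtype.ext (neg_neg _).symm

theorem lie_inclT (t : S.LieT) (y : charGroup S.T) (x : S.LieG)
    (hx : (x : Matrix (Fin N) (Fin N) K) ∈ wtSpace y) : ⁅S.inclT t, x⁆ = charDiff y t • x :=
  Subtype.ext (mul_sub_mul_of_mem_wtSpace hx t)

/-- Functions representing $y$ and $-y$ multiply to $1$ on $T$ and both take the value $1$ at the
identity, so by the product rule their differentials cancel on `Lie T`. -/
theorem charDiff_neg (y : charGroup S.T) : charDiff (-y) = -charDiff y := by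
  ext t
  obtain ⟨f, hf⟩ := y.2
  obtain ⟨g, hg⟩ := (-y).2
  have hf' : ∀ t : S.T, (charVal y t : K) = evalAt (t : GL (Fin N) K) f := hf
  have hg' : ∀ t : S.T, (charVal (-y) t : K) = evalAt (t : GL (Fin N) K) g := hg
  have hf1 : evalAt (1 : GL (Fin N) K) f = 1 := by simpa [charVal] using (hf' 1).symm
  have hg1 : evalAt (1 : GL (Fin N) K) g = 1 := by simpa [charVal] using (hg' 1).symm
  rw [LinearMap.neg_apply, charDiff_apply _ g hg', charDiff_apply _ f hf', eq_neg_iff_add_eq_zero]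
  have h := t.2 (f * g - 1) fun s hs => by
    rw [map_sub, map_mul, ← hf' ⟨s, hs⟩, ← hg' ⟨s, hs⟩, ← Units.val_mul, ← charVal_add,
      add_neg_cancel, charVal_zero, map_one, Units.val_one, sub_self]
  rw [← evalAt_one_leftDer, map_sub, Derivation.leibniz, Derivation.map_one_eq_zero, sub_zero,
    map_add, smul_eq_mul, smul_eq_mul, map_mul, map_mul, hf1, hg1, one_mul, one_mul,
    evalAt_one_leftDer, evalAt_one_leftDer] at h
  exact h

theorem lie_inclT_fVec (t : S.LieT) (j : Fin D) :
    ⁅S.inclT t, S.fVec γ j⁆ = -charDiff (γ j).1.1 t • S.fVec γ j := by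
  have h := S.lie_inclT t (-(γ j).1.1) (S.fVec γ j) (S.rootVec_mem (S.negRoot (γ j).1))
  rwa [charDiff_neg] at h

theorem charDiff_root_pPow (p : ℕ) [Fact p.Prime] [CharP K p] (α : Roots S.G S.T) (t : S.LieT) :
    charDiff α.1 (pPow p S.T t) = charDiff α.1 t ^ p :=
  charDiff_pPow p (S.rootVec_mem α) (S.rootVec_ne_zero α) t

theorem root_mem_closure (j : Fin D) :
    (γ j).1.1 ∈ AddSubmonoid.closure (S.P.root '' S.base.support) := by
  have h := (γ j).2
  unfold IsPositive at h
  rwa [S.isRootDatum.root] at h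

theorem add_eq_zero_of_neg {A : Type*} [AddCommGroup A] {a b : A} (h : -a + -b = 0) :
    a + b = 0 := by
  rwa [← neg_add, neg_eq_zero] at h

theorem nsmul_eq_zero_of_neg {A : Type*} [AddCommGroup A] {a : A} {n : ℕ} (h : n • -a = 0) :
    n • a = 0 := by
  rwa [smul_neg, neg_eq_zero] at h

theorem sum_ne_zero (j k : Fin D) : -(γ j).1.1 + -(γ k).1.1 ≠ 0 := by
  intro h
  refine (γ j).1.2.1 (S.closure_pointed (S.root_mem_closure γ j) (S.root_mem_closure γ k) ?_)
  exact add_eq_zero_of_neg (A := charGroup S.T) h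

/-- The bracket of two negative root vectors is `0` or a multiple of a negative root vector. -/
theorem lie_fVec_fVec (j k : Fin D) : ⁅S.fVec γ j, S.fVec γ k⁆ = 0 ∨
    ∃ (c : K) (i : Fin D), ⁅S.fVec γ j, S.fVec γ k⁆ = c • S.fVec γ i ∧
      S.ht γ i = S.ht γ j + S.ht γ k := by
  have hmem : ((⁅S.fVec γ j, S.fVec γ k⁆ : S.LieG) : Matrix (Fin N) (Fin N) K) ∈
      wtSpace (-(γ j).1.1 + -(γ k).1.1) :=
    lie_mem_wtSpace (S.rootVec_mem (S.negRoot _)) (S.rootVec_mem (S.negRoot _))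
  have h0 := S.sum_ne_zero γ j k
  by_cases h : IsRoot S.G (-(γ j).1.1 + -(γ k).1.1)
  · right
    obtain ⟨c, hc⟩ := S.eq_smul_rootVec ⟨_, h⟩ _ hmem
    have h1 : S.base.height ⟨_, h⟩ = -(S.ht γ j + S.ht γ k : ℤ) := by
      rw [S.height_add' (α := S.negRoot (γ j).1) (β := S.negRoot (γ k).1) rfl, S.height_negRoot,
        S.height_negRoot, ht_cast, ht_cast]
      ring
    -- The height found in `h1` is negative, which excludes a positive root.
    rcases S.root_cases γ ⟨_, h⟩ with ⟨i, hi⟩ | ⟨i, hi⟩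
    · rw [hi, ← ht_cast] at h1
      have := S.ht_pos γ i
      omega
    · refine ⟨c, i, by rw [hc, hi]; rfl, ?_⟩
      rw [hi, S.height_negRoot, ← ht_cast] at h1
      omega
  · exact Or.inl (S.eq_zero_of_not_isRoot h0 h _ hmem)

/-- The `p`-th power of a negative root vector is `0` or a multiple of a negative root vector. -/
theorem pPow_fVec (p : ℕ) [Fact p.Prime] [CharP K p] (j : Fin D) : pPow p S.G (S.fVec γ j) = 0 ∨
    ∃ (c : K) (i : Fin D), pPow p S.G (S.fVec γ j) = c • S.fVec γ i ∧
      S.ht γ i = p * S.ht γ j := by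
  have hp : p.Prime := Fact.out
  have hmem : ((pPow p S.G (S.fVec γ j) : S.LieG) : Matrix (Fin N) (Fin N) K) ∈
      wtSpace (p • -(γ j).1.1) := pow_mem_wtSpace (S.rootVec_mem (S.negRoot _)) p
  have h0 : p • -(γ j).1.1 ≠ 0 := by
    intro h
    have hj := S.root_mem_closure γ j
    -- If $p\gamma=0$, then $\gamma$ and $(p-1)\gamma$ are opposite elements of the pointed cone, so
    -- $\gamma=0$.
    refine (γ j).1.2.1 (S.closure_pointed hj (nsmul_mem hj (p - 1)) ?_)
    have h1 : p • (γ j).1.1 = 0 :=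
      nsmul_eq_zero_of_neg (A := charGroup S.T) h
    rw [← succ_nsmul', Nat.sub_add_cancel hp.one_le, h1]
  by_cases h : IsRoot S.G (p • -(γ j).1.1)
  · right
    obtain ⟨c, hc⟩ := S.eq_smul_rootVec ⟨_, h⟩ _ hmem
    have h1 : S.base.height ⟨_, h⟩ = -(p * S.ht γ j : ℤ) := by
      rw [S.height_nsmul (α := S.negRoot (γ j).1) p rfl, S.height_negRoot, ht_cast]
      ring
    rcases S.root_cases γ ⟨_, h⟩ with ⟨i, hi⟩ | ⟨i, hi⟩
    · rw [hi, ← ht_cast] at h1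
      have h2 := S.ht_pos γ i
      have h3 : (0 : ℤ) ≤ p * S.ht γ j := by positivity
      omega
    · refine ⟨c, i, by rw [hc, hi]; rfl, ?_⟩
      rw [hi, S.height_negRoot, ← ht_cast] at h1
      have h2 := neg_injective h1
      exact_mod_cast h2
  · exact Or.inl (S.eq_zero_of_not_isRoot h0 h _ hmem)

/-- The bracket of a positive and a negative root vector is `0`, or an element of `Lie T`, or a
multiple of a positive root vector, or a multiple of a negative root vector of smaller height. -/
theorem lie_eVec_fVec (j k : Fin D) : ⁅S.eVec γ j, S.fVec γ k⁆ = 0 ∨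
    (∃ t, ⁅S.eVec γ j, S.fVec γ k⁆ = S.inclT t) ∨
    (∃ (c : K) (i : Fin D), ⁅S.eVec γ j, S.fVec γ k⁆ = c • S.eVec γ i) ∨
    ∃ (c : K) (i : Fin D), ⁅S.eVec γ j, S.fVec γ k⁆ = c • S.fVec γ i ∧ S.ht γ i < S.ht γ k := by
  have hmem : ((⁅S.eVec γ j, S.fVec γ k⁆ : S.LieG) : Matrix (Fin N) (Fin N) K) ∈
      wtSpace ((γ j).1.1 + -(γ k).1.1) :=
    lie_mem_wtSpace (S.rootVec_mem _) (S.rootVec_mem (S.negRoot _))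
  by_cases h0 : (γ j).1.1 + -(γ k).1.1 = 0
  · rw [h0] at hmem
    exact Or.inr (Or.inl (S.exists_eq_inclT _ hmem))
  by_cases h : IsRoot S.G ((γ j).1.1 + -(γ k).1.1)
  · right; right
    obtain ⟨c, hc⟩ := S.eq_smul_rootVec ⟨_, h⟩ _ hmem
    have h1 : S.base.height ⟨_, h⟩ = (S.ht γ j : ℤ) - S.ht γ k := by
      rw [S.height_add' (α := (γ j).1) (β := S.negRoot (γ k).1) rfl, S.height_negRoot,
        ht_cast, ht_cast]
      ring
    rcases S.root_cases γ ⟨_, h⟩ with ⟨i, hi⟩ | ⟨i, hi⟩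
    · exact Or.inl ⟨c, i, by rw [hc, hi]; rfl⟩
    · refine Or.inr ⟨c, i, by rw [hc, hi]; rfl, ?_⟩
      rw [hi, S.height_negRoot, ← ht_cast] at h1
      have := S.ht_pos γ j
      omega
  · exact Or.inl (S.eq_zero_of_not_isRoot h0 h _ hmem)

/-! ### Bases of the Lie algebras -/

/-- The map from the indices of the triangular basis to those of the Chevalley basis. -/
def triIndexFun : Fin D ⊕ (Fin S.d ⊕ Fin D) → Fin S.d ⊕ Roots S.G S.T :=
  Sum.elim (fun j => Sum.inr (S.negRoot (γ j).1))
    (Sum.elim Sum.inl fun j => Sum.inr (γ j).1)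

/-- Every root is positive or the negative of a positive root, and never both, because the heights
have opposite signs. -/
theorem triIndexFun_bijective : Function.Bijective (S.triIndexFun γ) := by
  have hne : ∀ j k, S.negRoot (γ j).1 ≠ (γ k).1 := by
    intro j k h
    have h1 := congrArg S.base.height h
    rw [S.height_negRoot, ← ht_cast, ← ht_cast] at h1
    have := S.ht_pos γ j
    omega
  constructor
  · rintro (j | i | j) (k | i' | k) h <;> simp [triIndexFun] at h
    · have : (γ j).1 = (γ k).1 := Subtype.ext (neg_injective (congrArg Subtype.val h))
      rw [γ.injective (Subtype.ext this)]
    · exact absurd h (hne j k)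
    · rw [h]
    · exact absurd h.symm (hne k j)
    · rw [γ.injective (Subtype.ext h)]
  · rintro (i | α)
    · exact ⟨Sum.inr (Sum.inl i), rfl⟩
    · rcases S.root_cases γ α with ⟨j, rfl⟩ | ⟨j, rfl⟩
      · exact ⟨Sum.inr (Sum.inr j), rfl⟩
      · exact ⟨Sum.inl j, rfl⟩

/-- The Chevalley basis, indexed compatibly with the triangular decomposition. -/
def triBasis : Module.Basis (Fin D ⊕ (Fin S.d ⊕ Fin D)) K S.LieG :=
  S.c.reindex (Equiv.ofBijective _ (S.triIndexFun_bijective γ)).symm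

theorem triBasis_apply (i : Fin D ⊕ (Fin S.d ⊕ Fin D)) :
    S.triBasis γ i = S.c (S.triIndexFun γ i) := by
  rw [triBasis, Module.Basis.reindex_apply, Equiv.symm_symm, Equiv.ofBijective_apply]

theorem triBasis_inl (j : Fin D) : S.triBasis γ (Sum.inl j) = S.fVec γ j := S.triBasis_apply γ _

theorem nPlus_le_borel : nPlus S.base ≤ (lieAlg S.B).toSubmodule := by
  rw [S.borel_eq]; exact le_sup_right

theorem eVec_mem_nPlus (j : Fin D) : (S.eVec γ j : Matrix (Fin N) (Fin N) K) ∈ nPlus S.base :=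
  Submodule.mem_iSup_of_mem (γ j) (S.isChevalley.root_vector _)

/-- The basis of `Lie B` contained in the Chevalley basis. -/
def borelVec : Fin S.d ⊕ Fin D → lieAlg S.B :=
  Sum.elim (fun i => ⟨S.h i, lieAlg_mono S.torus_le (S.h i).2⟩)
    fun j => ⟨S.eVec γ j, S.nPlus_le_borel (S.eVec_mem_nPlus γ j)⟩

theorem inclB_borelVec (i : Fin S.d ⊕ Fin D) :
    S.inclB (S.borelVec γ i) = S.triBasis γ (Sum.inr i) := by
  rw [triBasis_apply]
  rcases i with i | j
  · exact (S.basis_inl i).symm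
  · rfl

/-- Combines the decomposition of `borel_eq` with the fact that the root spaces are lines. -/
theorem span_borelVec : Submodule.span K (Set.range (S.borelVec γ)) = ⊤ := by
  rw [← top_le_iff]
  intro x _
  have hx : (x : Matrix (Fin N) (Fin N) K) ∈ (lieAlg S.B).toSubmodule := x.2
  set P := (Submodule.span K (Set.range (S.borelVec γ))).map (lieAlg S.B).toSubmodule.subtype with hP
  suffices h : (lieAlg S.B).toSubmodule ≤ P by
    obtain ⟨y, hy, hyx⟩ := h hx
    rwa [← Subtype.ext (a1 := y) (a2 := x) hyx]
  rw [S.borel_eq]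
  refine sup_le (fun y hy => ?_) (iSup_le fun α y hy => ?_)
  · have h1 : (⟨y, hy⟩ : S.LieT) ∈ Submodule.span K (Set.range S.h) := by
      rw [S.h.span_eq]; exact Submodule.mem_top
    have h2 := Submodule.mem_map_of_mem (f := S.LieT.toSubmodule.subtype) h1
    rw [Submodule.map_span] at h2
    refine Submodule.span_le.2 ?_ h2
    rintro _ ⟨_, ⟨i, rfl⟩, rfl⟩
    exact ⟨S.borelVec γ (Sum.inl i), Submodule.subset_span ⟨_, rfl⟩, rfl⟩
  · obtain ⟨c, hc⟩ := S.eq_smul_rootVec α.1 ⟨y, hy.1⟩ hy.2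
    have hc' : y = c • (S.rootVec α.1 : Matrix (Fin N) (Fin N) K) := congrArg Subtype.val hc
    rw [hc']
    refine P.smul_mem c ⟨S.borelVec γ (Sum.inr (γ.symm α)), Submodule.subset_span ⟨_, rfl⟩, ?_⟩
    change (S.rootVec (γ (γ.symm α)).1 : Matrix (Fin N) (Fin N) K) = _
    rw [Equiv.apply_symm_apply]

end ReductiveSetup

end ReducedRep

end

set_option linter.unusedSectionVars false

noncomputable section

namespace ReducedRep

open scoped TensorProduct

attribute [local instance] LieRing.ofAssociativeRing

/-! ### Modules induced from one-dimensional modules -/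

section InducedOneDim

variable {K : Type*} [Field K] {A B : Type*} [Ring A] [Algebra K A] [Ring B] [Algebra K B]
  (φ : A →ₐ[K] B) (f : A →ₐ[K] K)

/-- The generator of a one-dimensional module. -/
def OneDim.one : OneDim f := (1 : K)

/-- The generator of the module induced from a one-dimensional module. -/
def indGen : Induced φ (OneDim f) :=
  Submodule.Quotient.mk ((1 : B) ⊗ₜ[K] OneDim.one f)

theorem smul_indGen (b : B) : b • indGen φ f =
    Submodule.Quotient.mk (b ⊗ₜ[K] OneDim.one f) := by
  rw [indGen, ← Submodule.Quotient.mk_smul, TensorProduct.smul_tmul', smul_eq_mul, mul_one]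

theorem mk_tmul (b : B) (m : OneDim f) :
    (Submodule.Quotient.mk (b ⊗ₜ[K] m) : Induced φ (OneDim f)) = (show K from m) • b • indGen φ f := by
  rw [smul_indGen, ← Submodule.Quotient.mk_smul, ← TensorProduct.tmul_smul]
  congr 2
  exact (mul_one (show K from m)).symm

theorem map_smul_indGen (a : A) : φ a • indGen φ f = f a • indGen φ f := by
  rw [smul_indGen]
  have h1 : ((1 : B) * φ a) ⊗ₜ[K] OneDim.one f -
      (1 : B) ⊗ₜ[K] (a • OneDim.one f) ∈ inducedRel φ (OneDim f) :=
    Submodule.subset_span ⟨1, a, _, rfl⟩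
  rw [one_mul] at h1
  rw [(Submodule.Quotient.eq _).2 h1, mk_tmul, one_smul]
  congr 1
  exact mul_one (f a)

theorem span_indGen : Submodule.span B {indGen φ f} = ⊤ := by
  rw [← top_le_iff]
  intro z _
  obtain ⟨z, rfl⟩ := Submodule.Quotient.mk_surjective _ z
  induction z using TensorProduct.induction_on with
  | zero => exact zero_mem _
  | tmul b m =>
    rw [mk_tmul, ← smul_assoc]
    exact Submodule.smul_mem _ _ (Submodule.mem_span_singleton_self _)
  | add a b ha hb => exact add_mem (ha trivial) (hb trivial)

section Lift

variable {M : Type*} [AddCommGroup M] [Module K M] [Module B M] [IsScalarTower K B M]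

/-- The homomorphism from an induced module given by a vector on which `A` acts through `f`. -/
def indLift (v : M) (hv : ∀ a, φ a • v = f a • v) : Induced φ (OneDim f) →ₗ[B] M :=
  Submodule.liftQ _ (TensorProduct.AlgebraTensorModule.lift (LinearMap.toSpanSingleton B
    (OneDim f →ₗ[K] M) (LinearMap.toSpanSingleton K M v))) <| by
    refine Submodule.span_le.2 ?_
    rintro _ ⟨b, a, m, rfl⟩
    rw [SetLike.mem_coe, LinearMap.mem_ker, map_sub, TensorProduct.AlgebraTensorModule.lift_tmul,
      TensorProduct.AlgebraTensorModule.lift_tmul]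
    change (b * φ a) • (show K from m) • v - b • ((f a * show K from m) • v) = 0
    rw [mul_smul, smul_comm (φ a), hv, smul_smul, mul_comm, sub_self]

theorem indLift_indGen (v : M) (hv : ∀ a, φ a • v = f a • v) :
    indLift φ f v hv (indGen φ f) = v := by
  change (1 : B) • (1 : K) • v = v
  rw [one_smul, one_smul]

end Lift

variable {φ f} {ι κ : Type*} (F : ι → B) (g : κ → A)

/-- In $F_i\,\varphi(g_k)$ the right factor acts on the generator by a scalar, so only the $F_i$
matter. -/
theorem span_smul_indGen (hspan : Submodule.span K (Set.range fun ik : ι × κ => F ik.1 * φ (g ik.2))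
    = ⊤) : Submodule.span K (Set.range fun i => F i • indGen φ f) = ⊤ := by
  rw [← top_le_iff]
  intro z _
  have hz : z ∈ Submodule.span B {indGen φ f} := by rw [span_indGen]; exact Submodule.mem_top
  obtain ⟨b, rfl⟩ := Submodule.mem_span_singleton.1 hz
  have hb : b ∈ Submodule.span K (Set.range fun ik : ι × κ => F ik.1 * φ (g ik.2)) := by
    rw [hspan]; exact Submodule.mem_top
  induction hb using Submodule.span_induction with
  | mem b hb =>
    obtain ⟨⟨i, k⟩, rfl⟩ := hb
    rw [mul_smul, map_smul_indGen, smul_comm]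
    exact Submodule.smul_mem _ _ (Submodule.subset_span ⟨i, rfl⟩)
  | zero => rw [zero_smul]; exact zero_mem _
  | add a b _ _ ha hb =>
    rw [add_smul]
    exact add_mem (ha Submodule.mem_top (by rw [span_indGen]; exact Submodule.mem_top))
      (hb Submodule.mem_top (by rw [span_indGen]; exact Submodule.mem_top))
  | smul c a _ ha =>
    rw [smul_assoc]
    exact Submodule.smul_mem _ _ (ha Submodule.mem_top (by rw [span_indGen]; exact Submodule.mem_top))

/-- If `B` is a free right `A`-module on the `F i`, then the `F i` give linearly independent elements
of an induced module. -/
theorem linearIndependent_smul_indGen (hg : Submodule.span K (Set.range g) = ⊤)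
    (bas : Module.Basis (ι × κ) K B) (hbas : ∀ i k, bas (i, k) = F i * φ (g k)) :
    LinearIndependent K fun i => F i • indGen φ f := by
  classical
  -- The prospective coordinates on the induced module: in $B=\bigoplus F_i\varphi(A)$ the factor
  -- from $A$ is replaced by its value under $f$.
  let θ : B →ₗ[K] (ι →₀ K) := bas.constr K fun ik => Finsupp.single ik.1 (f (g ik.2))
  have h1 : ∀ i a, θ (F i * φ a) = Finsupp.single i (f a) := by
    intro i a
    have ha : a ∈ Submodule.span K (Set.range g) := by rw [hg]; exact Submodule.mem_top
    induction ha using Submodule.span_induction with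
    | mem a ha =>
      obtain ⟨k, rfl⟩ := ha
      rw [← hbas, Module.Basis.constr_basis]
    | zero => simp
    | add a b _ _ ha hb => rw [map_add, mul_add, map_add, ha, hb, map_add, Finsupp.single_add]
    | smul c a _ ha => rw [map_smul, mul_smul_comm, map_smul, ha, map_smul, Finsupp.smul_single]
  have h2 : ∀ a b, θ (b * φ a) = f a • θ b := by
    intro a b
    have : θ ∘ₗ LinearMap.mulRight K (φ a) = f a • θ := by
      apply bas.ext
      rintro ⟨i, k⟩
      rw [LinearMap.comp_apply, LinearMap.mulRight_apply, LinearMap.smul_apply, hbas, mul_assoc,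
        ← map_mul, h1, h1, map_mul, mul_comm, Finsupp.smul_single, smul_eq_mul]
    exact LinearMap.congr_fun this b
  let Θ : B ⊗[K] OneDim f →ₗ[K] (ι →₀ K) :=
    TensorProduct.lift ((LinearMap.lsmul K (ι →₀ K)).flip.comp θ : B →ₗ[K] K →ₗ[K] (ι →₀ K))
  have hΘ : ∀ (b : B) (m : OneDim f), Θ (b ⊗ₜ[K] m) = (show K from m) • θ b := fun b m => rfl
  -- The relations form a $B$-submodule while $\Theta$ is only $K$-linear. Quantifying over $c$ lets
  -- the induction pass the multiplication by elements of $B$.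
  have h3 : ∀ z ∈ inducedRel φ (OneDim f), ∀ c : B, Θ (c • z) = 0 := by
    intro z hz
    induction hz using Submodule.span_induction with
    | mem z hz =>
      obtain ⟨b, a, m, rfl⟩ := hz
      intro c
      rw [smul_sub, map_sub, TensorProduct.smul_tmul', TensorProduct.smul_tmul', hΘ, hΘ, smul_eq_mul,
        smul_eq_mul, ← mul_assoc, h2, smul_smul, sub_eq_zero, mul_comm]
      rfl
    | zero => simp
    | add a b _ _ ha hb => intro c; rw [smul_add, map_add, ha, hb, add_zero]
    | smul d z _ hz => intro c; rw [smul_smul, hz]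
  rw [linearIndependent_iff']
  intro s k hk i hi
  have h4 : (∑ i ∈ s, k i • (F i ⊗ₜ[K] OneDim.one f) : B ⊗[K] OneDim f) ∈
      inducedRel φ (OneDim f) := by
    rw [← Submodule.Quotient.mk_eq_zero, ← Submodule.mkQ_apply, map_sum, ← hk]
    refine Finset.sum_congr rfl fun i _ => ?_
    rw [smul_indGen, Submodule.mkQ_apply, Submodule.Quotient.mk_smul]
  have h5 := h3 _ h4 1
  rw [one_smul, map_sum] at h5
  have h6 : ∀ i, θ (F i) = Finsupp.single i 1 := by
    intro i
    have := h1 i 1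
    rwa [map_one, mul_one, map_one] at this
  have hΘ1 : ∀ i, Θ (F i ⊗ₜ[K] OneDim.one f) = Finsupp.single i 1 := fun i => by
    rw [hΘ, ← h6]
    exact one_smul K _
  simp only [map_smul, hΘ1] at h5
  have h7 := DFunLike.congr_fun h5 i
  rw [Finsupp.finsetSum_apply, Finset.sum_eq_single_of_mem i hi] at h7
  · simpa using h7
  · intro j _ hj
    simp [Finsupp.single_eq_of_ne' hj]

end InducedOneDim

section OrderedMonMaps

variable {K U V ι κ : Type*} [Field K] [Ring U] [Algebra K U] [Ring V] [Algebra K V]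

theorem orderedMon_append (x : ι → U) (l l' : List ι) (a : ι → ℕ) :
    orderedMon x (l ++ l') a = orderedMon x l a * orderedMon x l' a := by
  simp [orderedMon]

theorem orderedMon_map (x : ι → U) (s : κ → ι) (l : List κ) (a : ι → ℕ) :
    orderedMon x (l.map s) a = orderedMon (fun i => x (s i)) l fun i => a (s i) := by
  simp [orderedMon, Function.comp_def]

theorem map_orderedMon (φ : U →ₐ[K] V) (x : ι → U) (l : List ι) (a : ι → ℕ) :
    φ (orderedMon x l a) = orderedMon (fun i => φ (x i)) l a := by
  simp [orderedMon, map_list_prod, Function.comp_def]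

end OrderedMonMaps

/-! ### PBW bases adapted to the Borel subalgebra, and bases of baby Verma modules -/

namespace ReductiveSetup

variable {K : Type*} [Field K] {N : ℕ} (S : ReductiveSetup K N) {D : ℕ} (γ : Fin D ≃ S.PosRoots)
  (p : ℕ) [Fact p.Prime] [CharP K p]

theorem redMap_ι (χ : Module.Dual K S.LieG) (x : lieAlg S.B) :
    redMap p S.borel_le_group χ (redι p S.B (resDual S.borel_le_group χ) x) =
      redι p S.G χ (S.inclB x) := by
  exact redLift_ι p S.B (resDual S.borel_le_group χ) _ _ x

/-- The ordered monomials in the negative root vectors. -/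
def fMon (χ : Module.Dual K S.LieG) (a : Fin D → Fin p) : RedEnv p S.G χ :=
  orderedMon (fun j => redι p S.G χ (S.fVec γ j)) (List.finRange D) fun j => (a j : ℕ)

/-- The ordered monomials in the basis of `Lie B`. -/
def borelMon (χ : Module.Dual K S.LieG) (a : Fin S.d ⊕ Fin D → Fin p) :
    RedEnv p S.B (resDual S.borel_le_group χ) :=
  orderedMon (fun j => redι p S.B (resDual S.borel_le_group χ) (S.borelVec γ j))
    Finset.univ.toList fun j => (a j : ℕ)

theorem span_borelMon (χ : Module.Dual K S.LieG) :
    Submodule.span K (Set.range (S.borelMon γ p χ)) = ⊤ :=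
  span_orderedMon p S.B _ (S.span_borelVec γ) (Finset.nodup_toList _) (by simp)

/-- The order of the triangular basis: first the negative root vectors, then `Lie B`. -/
def triList (d D : ℕ) : List (Fin D ⊕ (Fin d ⊕ Fin D)) :=
  (List.finRange D).map Sum.inl ++ (Finset.univ : Finset (Fin d ⊕ Fin D)).toList.map Sum.inr

theorem triList_nodup (d D : ℕ) : (triList d D).Nodup := by
  refine List.Nodup.append ((List.nodup_finRange D).map Sum.inl_injective)
    ((Finset.nodup_toList _).map Sum.inr_injective) ?_
  intro x hx hy
  obtain ⟨j, -, rfl⟩ := List.mem_map.1 hx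
  obtain ⟨k, -, hk⟩ := List.mem_map.1 hy
  simp at hk

theorem mem_triList (d D : ℕ) (i : Fin D ⊕ (Fin d ⊕ Fin D)) : i ∈ triList d D := by
  rcases i with i | i
  · exact List.mem_append_left _ (List.mem_map_of_mem (List.mem_finRange i))
  · exact List.mem_append_right _ (List.mem_map_of_mem (by simp))

/-- Listing the negative root vectors before the basis of `Lie B` makes each PBW monomial split as a
product. This exhibits $U_\chi(\mathfrak g)$ as a free right $U_\chi(\mathfrak b)$-module. -/
theorem orderedMon_triList (χ : Module.Dual K S.LieG) (a : Fin D → Fin p)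
    (b : Fin S.d ⊕ Fin D → Fin p) :
    orderedMon (fun i => redι p S.G χ (S.triBasis γ i)) (triList S.d D)
        (fun i => ((Sum.elim a b i : Fin p) : ℕ)) =
      S.fMon γ p χ a * redMap p S.borel_le_group χ (S.borelMon γ p χ b) := by
  rw [triList, orderedMon_append, orderedMon_map, orderedMon_map, borelMon, map_orderedMon, fMon]
  simp only [triBasis_inl, redMap_ι, inclB_borelVec, Sum.elim_inl, Sum.elim_inr]

/-- A basis of the reduced enveloping algebra which shows that it is free over the reduced
enveloping algebra of the Borel subalgebra. -/
def redBasis (χ : Module.Dual K S.LieG) :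
    Module.Basis ((Fin D → Fin p) × (Fin S.d ⊕ Fin D → Fin p)) K (RedEnv p S.G χ) :=
  (Module.Basis.mk (linearIndependent_orderedMon p S.G χ (S.triBasis γ).linearIndependent
    (triList_nodup S.d D) (mem_triList S.d D))
    (span_orderedMon p S.G χ (S.triBasis γ).span_eq (triList_nodup S.d D)
      (mem_triList S.d D)).ge).reindex (Equiv.sumArrowEquivProdArrow _ _ _)

theorem redBasis_apply (χ : Module.Dual K S.LieG) (a : Fin D → Fin p)
    (b : Fin S.d ⊕ Fin D → Fin p) : S.redBasis γ p χ (a, b) =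
      S.fMon γ p χ a * redMap p S.borel_le_group χ (S.borelMon γ p χ b) := by
  rw [redBasis, Module.Basis.reindex_apply, Module.Basis.mk_apply, ← orderedMon_triList]
  rfl

variable {S}

section Verma

variable {χ : Module.Dual K S.LieG} (hχ : S.VanishesOnNPlus χ) (lam : S.Lam p χ)

/-- The highest weight vector of the baby Verma module. -/
def vac : BabyVerma p hχ lam := indGen _ _

/-- The basis of the baby Verma module that consists of the ordered monomials in the negative root
vectors, applied to the highest weight vector. -/
def vermaBasis : Module.Basis (Fin D → Fin p) K (BabyVerma p hχ lam) :=
  Module.Basis.mk (v := fun a => S.fMon γ p χ a • vac p hχ lam)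
    (linearIndependent_smul_indGen (S.fMon γ p χ) (S.borelMon γ p χ) (S.span_borelMon γ p χ)
      (S.redBasis γ p χ) (S.redBasis_apply γ p χ))
    (span_smul_indGen (S.fMon γ p χ) (S.borelMon γ p χ) (by
      rw [← (S.redBasis γ p χ).span_eq]
      congr 2
      funext ⟨a, b⟩
      exact (S.redBasis_apply γ p χ a b).symm)).ge

theorem vermaBasis_apply (a : Fin D → Fin p) :
    vermaBasis γ p hχ lam a = S.fMon γ p χ a • vac p hχ lam := by
  exact Module.Basis.mk_apply _ _ a

theorem finrank_babyVerma (γ : Fin D ≃ S.PosRoots) :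
    Module.finrank K (BabyVerma p hχ lam) = p ^ D := by
  rw [Module.finrank_eq_card_basis (vermaBasis γ p hχ lam)]
  simp

end Verma

end ReductiveSetup

end ReducedRep

end

set_option linter.unusedSectionVars false

noncomputable section

namespace ReducedRep

open scoped TensorProduct

attribute [local instance] LieRing.ofAssociativeRing

namespace ReductiveSetup

/-! ### The action of the Borel subalgebra on a baby Verma module -/

variable {K : Type*} [Field K] {N : ℕ} {S : ReductiveSetup K N} {D : ℕ} (γ : Fin D ≃ S.PosRoots)
  (p : ℕ) [Fact p.Prime] [CharP K p] {χ : Module.Dual K S.LieG} (hχ : S.VanishesOnNPlus χ)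
  (lam : S.Lam p χ)

variable (S) in
/-- The weight of a negative root vector in the filtration of the baby Verma module. -/
def fWt (j : Fin D) : ℕ := 1 + S.ht γ j

variable (S) in
/-- The weight of an exponent tuple in the filtration of the baby Verma module. -/
def monWt (a : Fin D → Fin p) : ℕ := ∑ j, (a j : ℕ) * S.fWt γ j

variable (S) in
/-- The weight of the torus on a monomial in the negative root vectors. -/
def monChar (lam : Module.Dual K S.LieT) (a : Fin D → Fin p) : Module.Dual K S.LieT :=
  lam - ∑ j, (a j : ℕ) • charDiff (γ j).1.1

theorem redι_mul_redι (x y : S.LieG) :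
    redι p S.G χ x * redι p S.G χ y = redι p S.G χ y * redι p S.G χ x + redι p S.G χ ⁅x, y⁆ := by
  rw [LieHom.map_lie, LieRing.of_associative_ring_bracket]
  abel

/-- The span of the products of negative root vectors of small weight. -/
abbrev fFilt (χ : Module.Dual K S.LieG) (k : ℕ) : Submodule K (RedEnv p S.G χ) :=
  filtLT K (fun j => redι p S.G χ (S.fVec γ j)) (S.fWt γ) k

/-- The summand $1$ in the weight $1+\mathrm{ht}$ makes all relations strictly decreasing. A nonzero
bracket of $f_j$ and $f_k$ has weight $1+\mathrm{ht}_j+\mathrm{ht}_k$, one less than the pair; a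
nonzero $f_j^{[p]}$ has weight $1+p\,\mathrm{ht}_j<p(1+\mathrm{ht}_j)$; and the scalar
$\chi(f_j)^p$, which need not vanish, has weight $0$. -/
theorem fFilt_le (χ : Module.Dual K S.LieG) (k : ℕ) :
    fFilt γ p χ k ≤ Submodule.span K (S.fMon γ p χ '' {a | S.monWt γ p a < k}) := by
  have hp : p.Prime := Fact.out
  refine Submodule.span_le.2 ?_
  rintro _ ⟨u, hu, rfl⟩
  refine Submodule.span_mono ?_ (wordProd_mem_reducedSpan (K := K) (p := p) (w := S.fWt γ)
    (fun i j => ?_) (fun i => ?_) (List.nodup_finRange D) List.mem_finRange u)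
  · rintro _ ⟨a, ha, rfl⟩
    exact ⟨a, lt_of_le_of_lt ha hu, rfl⟩
  · rw [← LieRing.of_associative_ring_bracket, ← LieHom.map_lie]
    rcases S.lie_fVec_fVec γ i j with h | ⟨c, k, h, hk⟩
    · rw [h, map_zero]
      exact zero_mem _
    · rw [h, map_smul]
      refine Submodule.smul_mem _ _ (Submodule.subset_span ⟨[k], ?_, by simp [wordProd]⟩)
      simp only [wordWt, List.map_cons, List.map_nil, List.sum_cons, List.sum_nil, fWt]
      omega
  · rw [redι_pow]
    refine add_mem ?_ ?_
    · rcases S.pPow_fVec γ p i with h | ⟨c, k, h, hk⟩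
      · rw [h, map_zero]
        exact zero_mem _
      · rw [h, map_smul]
        refine Submodule.smul_mem _ _ (Submodule.subset_span ⟨[k], ?_, by simp [wordProd]⟩)
        have := hp.one_lt
        simp only [wordWt, List.map_cons, List.map_nil, List.sum_cons, List.sum_nil, fWt, hk, mul_add]
        omega
    · rw [Algebra.algebraMap_eq_smul_one]
      refine Submodule.smul_mem _ _ (Submodule.subset_span ⟨[], ?_, by simp [wordProd]⟩)
      exact Nat.mul_pos hp.pos (by simp [fWt])

variable (S) in
/-- The word that corresponds to a monomial. -/
def monWord (a : Fin D → Fin p) : List (Fin D) :=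
  (List.finRange D).flatMap fun j => List.replicate (a j : ℕ) j

theorem wordProd_monWord (χ : Module.Dual K S.LieG) (a : Fin D → Fin p) :
    wordProd (fun j => redι p S.G χ (S.fVec γ j)) (monWord p a) = S.fMon γ p χ a :=
  wordProd_flatMap_replicate _ _

theorem count_monWord (a : Fin D → Fin p) (j : Fin D) : (monWord p a).count j = a j :=
  count_flatMap_replicate (List.nodup_finRange D) List.mem_finRange (fun j => (a j : ℕ)) j

theorem wordWt_monWord (a : Fin D → Fin p) : wordWt (S.fWt γ) (monWord p a) = S.monWt γ p a := by
  rw [wordWt_eq_sum_count, monWt]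
  simp only [count_monWord]

/-! ### Triangular action of the Borel subalgebra on modules with a highest weight vector -/

section HighestWeight

variable {M : Type*} [AddCommGroup M] [Module K M] [Module (RedEnv p S.G χ) M]
  [IsScalarTower K (RedEnv p S.G χ) M]

/-- The map `u ↦ u v`. -/
def orbitMap (v : M) : RedEnv p S.G χ →ₗ[K] M :=
  (LinearMap.toSpanSingleton (RedEnv p S.G χ) _ v).restrictScalars K

theorem orbitMap_apply (v : M) (u : RedEnv p S.G χ) : orbitMap p v u = u • v := rfl

theorem redι_smul_orbitMap (v : M) (x : S.LieG) (u : RedEnv p S.G χ) :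
    redι p S.G χ x • orbitMap p v u = orbitMap p v (redι p S.G χ x * u) := by
  rw [orbitMap_apply, orbitMap_apply, mul_smul]

variable {p} {lam : Module.Dual K S.LieT} {v : M}

theorem inclT_smul_wordProd (hT : ∀ t, redι p S.G χ (S.inclT t) • v = lam t • v) (t : S.LieT)
    (u : List (Fin D)) :
    redι p S.G χ (S.inclT t) •
        orbitMap p v (wordProd (fun j => redι p S.G χ (S.fVec γ j)) u) =
      (lam t - (u.map fun j => charDiff (γ j).1.1 t).sum) •
        orbitMap p v (wordProd (fun j => redι p S.G χ (S.fVec γ j)) u) := by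
  induction u with
  | nil =>
    simp only [wordProd, List.map_nil, List.prod_nil, List.sum_nil, sub_zero, orbitMap_apply, one_smul]
    exact hT t
  | cons j u ih =>
    rw [wordProd_cons, redι_smul_orbitMap, ← mul_assoc, redι_mul_redι, lie_inclT_fVec, add_mul, map_add,
      mul_assoc, ← redι_smul_orbitMap, ← redι_smul_orbitMap p v (S.inclT t), ih, map_smul,
      smul_mul_assoc, map_smul, smul_comm, redι_smul_orbitMap, ← add_smul, List.map_cons, List.sum_cons]
    congr 1
    ring

/-- Positive root vectors lower the filtration of a highest weight module. -/
theorem eVec_smul_wordProd_mem (hT : ∀ t, redι p S.G χ (S.inclT t) • v = lam t • v)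
    (hE : ∀ j, redι p S.G χ (S.eVec γ j) • v = 0) (u : List (Fin D)) (j : Fin D) :
    redι p S.G χ (S.eVec γ j) •
        orbitMap p v (wordProd (fun j => redι p S.G χ (S.fVec γ j)) u) ∈
      (fFilt γ p χ (wordWt (S.fWt γ) u)).map (orbitMap p v) := by
  -- A bracket $[e_j,f_k]$ can be a multiple of another positive root vector, so the claim is needed
  -- for all $j$ at once.
  induction u generalizing j with
  | nil =>
    simp only [wordProd, List.map_nil, List.prod_nil, orbitMap_apply, one_smul]
    rw [hE]
    exact zero_mem _
  | cons k u ih =>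
    have hf : ∀ z ∈ (fFilt γ p χ (wordWt (S.fWt γ) u)).map (orbitMap p v),
        redι p S.G χ (S.fVec γ k) • z ∈
          (fFilt γ p χ (wordWt (S.fWt γ) (k :: u))).map (orbitMap p v) := by
      rintro _ ⟨y, hy, rfl⟩
      rw [redι_smul_orbitMap]
      refine Submodule.mem_map_of_mem ?_
      have := mul_mem_filtLT hy [k] []
      simpa [wordProd, wordWt] using this
    have hlow : ∀ m, m ≤ wordWt (S.fWt γ) (k :: u) →
        (fFilt γ p χ m).map (orbitMap p v) ≤
          (fFilt γ p χ (wordWt (S.fWt γ) (k :: u))).map (orbitMap p v) :=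
      fun m hm => Submodule.map_mono (filtLT_mono hm)
    have hk : wordWt (S.fWt γ) u < wordWt (S.fWt γ) (k :: u) := by
      rw [wordWt_cons, fWt]; omega
    rw [wordProd_cons, redι_smul_orbitMap, ← mul_assoc, redι_mul_redι, add_mul, map_add, mul_assoc,
      ← redι_smul_orbitMap, ← redι_smul_orbitMap p v (S.eVec γ j), ← redι_smul_orbitMap]
    -- What remains is the bracket term $[e_j,f_k]u$. If the bracket is toral, it acts on $u v$ by a
    -- scalar and the letter $f_k$ is lost; if it is positive, the induction hypothesis applies to
    -- the shorter word; if it is negative, $f_k$ is replaced by a root vector of smaller height,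
    -- and the height part of the weight drops.
    refine add_mem (hf _ (ih j)) ?_
    rcases S.lie_eVec_fVec γ j k with h | ⟨t, h⟩ | ⟨c, i, h⟩ | ⟨c, i, h, hi⟩
    · rw [h, map_zero, zero_smul]
      exact zero_mem _
    · rw [h, inclT_smul_wordProd γ hT]
      exact Submodule.smul_mem _ _ (Submodule.mem_map_of_mem (wordProd_mem_filtLT hk))
    · rw [h, map_smul, smul_assoc]
      exact Submodule.smul_mem _ _ (hlow _ hk.le (ih i))
    · rw [h, map_smul, smul_assoc, redι_smul_orbitMap,
        ← wordProd_cons (x := fun j => redι p S.G χ (S.fVec γ j)) i u]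
      refine Submodule.smul_mem _ _ (Submodule.mem_map_of_mem (wordProd_mem_filtLT ?_))
      rw [wordWt_cons, wordWt_cons, fWt, fWt]
      omega

theorem inclT_smul_fMon (hT : ∀ t, redι p S.G χ (S.inclT t) • v = lam t • v) (t : S.LieT) (a : Fin D → Fin p) :
    redι p S.G χ (S.inclT t) • (S.fMon γ p χ a • v) =
      S.monChar γ p lam a t • (S.fMon γ p χ a • v) := by
  have h := inclT_smul_wordProd γ hT t (monWord p a)
  rw [wordProd_monWord, orbitMap_apply] at h
  rw [h]
  congr 1
  rw [monChar, LinearMap.sub_apply, LinearMap.sum_apply, Finset.sum_list_map_count]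
  congr 1
  rw [Finset.sum_subset (Finset.subset_univ _) fun j _ hj => by
    rw [List.count_eq_zero_of_not_mem (by simpa using hj), zero_smul]]
  simp only [count_monWord]
  rfl

theorem eVec_smul_fMon_mem (hT : ∀ t, redι p S.G χ (S.inclT t) • v = lam t • v)
    (hE : ∀ j, redι p S.G χ (S.eVec γ j) • v = 0) (j : Fin D) (a : Fin D → Fin p) :
    redι p S.G χ (S.eVec γ j) • (S.fMon γ p χ a • v) ∈ Submodule.span K
      ((fun a => S.fMon γ p χ a • v) '' {a' | S.monWt γ p a' < S.monWt γ p a}) := by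
  have h := eVec_smul_wordProd_mem γ hT hE (monWord p a) j
  rw [wordProd_monWord, orbitMap_apply, wordWt_monWord] at h
  have h2 := Submodule.map_mono (f := orbitMap p v) (fFilt_le γ p χ (S.monWt γ p a)) h
  rw [Submodule.map_span, ← Set.image_comp] at h2
  refine Submodule.span_mono ?_ h2
  rintro _ ⟨b, hb, rfl⟩
  exact ⟨b, hb, rfl⟩

/-- The Lie algebra of the Borel subgroup acts on the basis of the baby Verma module by triangular
matrices. -/
theorem inclB_smul_fMon_sub_mem (hT : ∀ t, redι p S.G χ (S.inclT t) • v = lam t • v)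
    (hE : ∀ j, redι p S.G χ (S.eVec γ j) • v = 0) (x : lieAlg S.B) (a : Fin D → Fin p) :
    redι p S.G χ (S.inclB x) • (S.fMon γ p χ a • v) -
        S.borelChar (S.monChar γ p lam a) x • (S.fMon γ p χ a • v) ∈
      Submodule.span K ((fun a => S.fMon γ p χ a • v) '' {a' | S.monWt γ p a' < S.monWt γ p a}) := by
  have hx : x ∈ Submodule.span K (Set.range (S.borelVec γ)) := by
    rw [span_borelVec]; exact Submodule.mem_top
  induction hx using Submodule.span_induction with
  | mem x hx =>
    obtain ⟨i | j, rfl⟩ := hx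
    · rw [S.borelChar_apply _ _ (S.h i) 0 (zero_mem _) (by rw [add_zero]; rfl)]
      have : S.inclB (S.borelVec γ (Sum.inl i)) = S.inclT (S.h i) := rfl
      rw [this, inclT_smul_fMon γ hT, sub_self]
      exact zero_mem _
    · rw [S.borelChar_apply _ _ 0 (S.eVec γ j) (S.eVec_mem_nPlus γ j)
        (by rw [map_zero, zero_add]; rfl), map_zero, zero_smul, sub_zero]
      exact eVec_smul_fMon_mem γ hT hE j a
  | zero =>
    rw [map_zero, map_zero, map_zero, zero_smul, zero_smul, sub_zero]
    exact zero_mem _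
  | add x y _ _ hx hy =>
    rw [map_add, map_add, map_add, add_smul, add_smul, add_sub_add_comm]
    exact add_mem hx hy
  | smul c x _ hx =>
    rw [map_smul, map_smul, map_smul, smul_assoc, smul_assoc, ← smul_sub]
    exact Submodule.smul_mem _ _ hx

end HighestWeight

/-! ### The Borel subalgebra on a baby Verma module -/

theorem inclB_smul_vac (x : lieAlg S.B) :
    redι p S.G χ (S.inclB x) • vac p hχ lam = S.borelChar lam.1 x • vac p hχ lam := by
  have h := map_smul_indGen (redMap p S.borel_le_group χ) (weightHom p hχ lam)
    (redι p S.B (resDual S.borel_le_group χ) x)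
  rw [redMap_ι, weightHom, redLift_ι] at h
  exact h

theorem inclT_smul_vac (t : S.LieT) :
    redι p S.G χ (S.inclT t) • vac p hχ lam = lam.1 t • vac p hχ lam := by
  have h := inclB_smul_vac p hχ lam ⟨t, lieAlg_mono S.torus_le t.2⟩
  rw [S.borelChar_apply _ _ t 0 (zero_mem _) (by rw [add_zero]; rfl)] at h
  exact h

theorem eVec_smul_vac (j : Fin D) : redι p S.G χ (S.eVec γ j) • vac p hχ lam = 0 := by
  have h := inclB_smul_vac p hχ lam ⟨S.eVec γ j, S.nPlus_le_borel (S.eVec_mem_nPlus γ j)⟩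
  rw [S.borelChar_apply _ _ 0 (S.eVec γ j) (S.eVec_mem_nPlus γ j)
    (by rw [map_zero, zero_add]; rfl), map_zero] at h
  exact h.trans (zero_smul K (vac p hχ lam))

theorem inclB_smul_vermaBasis_sub_mem (x : lieAlg S.B) (a : Fin D → Fin p) :
    redι p S.G χ (S.inclB x) • vermaBasis γ p hχ lam a -
        S.borelChar (S.monChar γ p lam a) x • vermaBasis γ p hχ lam a ∈
      Submodule.span K (vermaBasis γ p hχ lam '' {a' | S.monWt γ p a' < S.monWt γ p a}) := by
  have h := inclB_smul_fMon_sub_mem γ (inclT_smul_vac p hχ lam) (eVec_smul_vac γ p hχ lam) x a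
  have hv : (fun a => S.fMon γ p χ a • vac p hχ lam) = vermaBasis γ p hχ lam :=
    funext fun a => (vermaBasis_apply γ p hχ lam a).symm
  rw [hv, ← vermaBasis_apply] at h
  exact h

/-! ### Weights of tensor products -/

/-- Differentials of roots satisfy $\gamma(h^{[p]})=\gamma(h)^p$, and Frobenius fixes the integer
coefficients. Subtracting such combinations therefore leaves $\lambda(h)^p-\lambda(h^{[p]})$
unchanged. -/
theorem monChar_mem_Lam (a : Fin D → Fin p) : S.monChar γ p lam a ∈ S.Lam p χ := by
  intro t
  rw [← lam.2 t, monChar, LinearMap.sub_apply, LinearMap.sub_apply, sub_pow_char,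
    LinearMap.sum_apply, LinearMap.sum_apply, sum_pow_char]
  have : ∀ j, ((((a j : ℕ) • charDiff (γ j).1.1 : Module.Dual K S.LieT) t) ^ p) =
      ((a j : ℕ) • charDiff (γ j).1.1 : Module.Dual K S.LieT) (pPow p S.T t) := by
    intro j
    rw [LinearMap.smul_apply, LinearMap.smul_apply, S.charDiff_root_pPow, nsmul_eq_mul, nsmul_eq_mul,
      mul_pow, ← frobenius_def, map_natCast]
  simp only [this]
  ring

theorem add_mem_Lam {χ' : Module.Dual K S.LieG} {lam mu : Module.Dual K S.LieT}
    (hlam : lam ∈ S.Lam p χ) (hmu : mu ∈ S.Lam p χ') : lam + mu ∈ S.Lam p (χ + χ') := by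
  intro t
  have h1 := hlam t
  have h2 := hmu t
  rw [LinearMap.add_apply, LinearMap.add_apply, LinearMap.add_apply, add_pow_char, add_pow_char]
  linear_combination h1 + h2

end ReductiveSetup

end ReducedRep

end

set_option linter.unusedSectionVars false

noncomputable section

namespace ReducedRep

open scoped TensorProduct

attribute [local instance] LieRing.ofAssociativeRing

/-! ### Generation of modules over the reduced enveloping algebra -/

section Generation

variable {K : Type*} [Field K] {N : ℕ} (p : ℕ) [Fact p.Prime] [CharP K p]
  {G : Subgroup (GL (Fin N) K)}

theorem redEnv_smul_mem {χ : Module.Dual K (lieAlg G)} {M : Type*} [AddCommGroup M] [Module K M]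
    [Module (RedEnv p G χ) M] [IsScalarTower K (RedEnv p G χ) M] (P : Submodule K M)
    (hP : ∀ x, ∀ m ∈ P, redι p G χ x • m ∈ P) (u : RedEnv p G χ) : ∀ m ∈ P, u • m ∈ P := by
  have hu : u ∈ Algebra.adjoin K (Set.range (redι p G χ)) := by
    rw [adjoin_redι]; exact Algebra.mem_top
  induction hu using Algebra.adjoin_induction with
  | mem u hu =>
    obtain ⟨x, rfl⟩ := hu
    exact hP x
  | algebraMap c =>
    intro m hm
    rw [algebraMap_smul]
    exact P.smul_mem c hm
  | add a b _ _ ha hb => intro m hm; rw [add_smul]; exact P.add_mem (ha m hm) (hb m hm)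
  | mul a b _ _ ha hb => intro m hm; rw [mul_smul]; exact ha _ (hb m hm)

variable {χ χ' : Module.Dual K (lieAlg G)} {M M' : Type*}
  [AddCommGroup M] [Module K M] [Module (RedEnv p G χ) M] [IsScalarTower K (RedEnv p G χ) M]
  [AddCommGroup M'] [Module K M'] [Module (RedEnv p G χ') M'] [IsScalarTower K (RedEnv p G χ') M']

instance : IsScalarTower K (RedEnv p G (χ + χ')) (TensorMod p G χ χ' M M') :=
  ⟨fun k u x => LinearMap.congr_fun (map_smul (tensorAction p G χ χ' M M') k u) (x : M ⊗[K] M')⟩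

variable (χ χ' M M') in
/-- Pure tensors as a bilinear map. -/
def tens : M →ₗ[K] M' →ₗ[K] TensorMod p G χ χ' M M' := TensorProduct.mk K M M'

theorem redι_smul_tens (x : lieAlg G) (m : M) (m' : M') :
    redι p G (χ + χ') x • tens p χ χ' M M' m m' =
      tens p χ χ' M M' (redι p G χ x • m) m' + tens p χ χ' M M' m (redι p G χ' x • m') :=
  redι_smul_tmul p G χ χ' M M' x m m'

theorem tens_induction {P : TensorMod p G χ χ' M M' → Prop} (z : TensorMod p G χ χ' M M')
    (h0 : P 0) (ht : ∀ m m', P (tens p χ χ' M M' m m')) (ha : ∀ x y, P x → P y → P (x + y)) : P z :=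
  TensorProduct.induction_on z h0 ht ha

/-- If `v` generates `M`, then the tensors `v ⊗ m'` generate the tensor product. -/
theorem eq_top_of_tens_mem {v : M} (hv : Submodule.span (RedEnv p G χ) {v} = ⊤)
    (W : Submodule (RedEnv p G (χ + χ')) (TensorMod p G χ χ' M M'))
    (hW : ∀ m', tens p χ χ' M M' v m' ∈ W) : W = ⊤ := by
  -- This subspace is stable under the Lie algebra because $xm\otimes m'=x(m\otimes m')-m\otimes
  -- xm'$, and it contains the generator $v$.
  let P : Submodule K M :=
    { carrier := {m | ∀ m', tens p χ χ' M M' m m' ∈ W}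
      zero_mem' := fun m' => by rw [map_zero, LinearMap.zero_apply]; exact zero_mem _
      add_mem' := fun ha hb m' => by
        rw [map_add, LinearMap.add_apply]; exact add_mem (ha m') (hb m')
      smul_mem' := fun c m hm m' => by
        rw [map_smul, LinearMap.smul_apply]; exact (W.restrictScalars K).smul_mem c (hm m') }
  have hP : ∀ x, ∀ m ∈ P, redι p G χ x • m ∈ P := by
    intro x m hm m'
    rw [eq_sub_of_add_eq (redι_smul_tens p x m m').symm]
    exact sub_mem (W.smul_mem _ (hm m')) (hm _)
  rw [← top_le_iff]
  intro z _
  induction z using tens_induction with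
  | h0 => exact zero_mem _
  | ht m m' =>
    have hm : m ∈ Submodule.span (RedEnv p G χ) {v} := by rw [hv]; exact Submodule.mem_top
    obtain ⟨u, rfl⟩ := Submodule.mem_span_singleton.1 hm
    exact redEnv_smul_mem p P hP u v hW m'
  | ha x y hx hy => exact add_mem (hx trivial) (hy trivial)

end Generation

/-! ### Counting dimensions in filtrations -/

section Filtration

theorem le_add_sum_of_succ_le {n : ℕ} (g : Fin (n + 1) → ℕ) (q : Fin n → ℕ)
    (h : ∀ i, g i.succ ≤ g i.castSucc + q i) : g (Fin.last n) ≤ g 0 + ∑ i, q i := by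
  induction n with
  | zero => simp
  | succ n ih =>
    have h1 := ih (fun i => g i.castSucc) (fun i => q i.castSucc) fun i => h i.castSucc
    have h2 : g (Fin.last (n + 1)) ≤ _ := h (Fin.last n)
    rw [Fin.sum_univ_castSucc]
    simp only [Fin.castSucc_zero] at h1
    omega

theorem finrank_le_of_ker_le_range {K X Y Z : Type*} [Field K] [AddCommGroup X] [AddCommGroup Y]
    [AddCommGroup Z] [Module K X] [Module K Y] [Module K Z] [FiniteDimensional K X]
    [FiniteDimensional K Y] [FiniteDimensional K Z] (f : X →ₗ[K] Y) (g : Z →ₗ[K] X)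
    (h : LinearMap.ker f ≤ LinearMap.range g) :
    Module.finrank K X ≤ Module.finrank K Z + Module.finrank K Y := by
  have h1 := LinearMap.finrank_range_add_finrank_ker f
  have h2 := Submodule.finrank_le (LinearMap.range f)
  have h3 := Submodule.finrank_mono h
  have h4 := LinearMap.finrank_range_le g
  omega

variable {K U V : Type*} [Field K] [Ring U] [Algebra K U] [AddCommGroup V] [Module K V] [Module U V]
  [IsScalarTower K U V]

theorem finrank_le_add_finrank_quotient [FiniteDimensional K V] {A B : Submodule U V} (hAB : A ≤ B)
    [FiniteDimensional K (B ⧸ A.submoduleOf B)] :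
    Module.finrank K B ≤ Module.finrank K A + Module.finrank K (B ⧸ A.submoduleOf B) := by
  have hA : FiniteDimensional K A := Module.Finite.of_injective
    (A.subtype.restrictScalars K) A.subtype_injective
  have hB : FiniteDimensional K B := Module.Finite.of_injective
    (B.subtype.restrictScalars K) B.subtype_injective
  refine finrank_le_of_ker_le_range ((A.submoduleOf B).mkQ.restrictScalars K)
    ((Submodule.inclusion hAB).restrictScalars K) fun z hz => ⟨⟨z, ?_⟩, rfl⟩
  exact (Submodule.Quotient.mk_eq_zero (A.submoduleOf B)).1 hz

/-- Surjections onto the subquotients of a filtration are bijective if the dimensions add up. -/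
theorem bijective_of_surjective_subquotient [FiniteDimensional K V] {n d : ℕ}
    (W : Fin (n + 1) → Submodule U V) (hW : Monotone W) (h0 : W 0 = ⊥) (hlast : W (Fin.last n) = ⊤)
    (hV : Module.finrank K V = n * d) (Z : Fin n → Type*) [∀ i, AddCommGroup (Z i)]
    [∀ i, Module K (Z i)] [∀ i, Module U (Z i)] [∀ i, IsScalarTower K U (Z i)]
    [∀ i, FiniteDimensional K (Z i)] (hZ : ∀ i, Module.finrank K (Z i) = d)
    (f : ∀ i, Z i →ₗ[U] W i.succ ⧸ (W i.castSucc).submoduleOf (W i.succ))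
    (hf : ∀ i, Function.Surjective (f i)) (i : Fin n) : Function.Bijective (f i) := by
  have hle : ∀ i : Fin n, Module.finrank K (W i.succ ⧸ (W i.castSucc).submoduleOf (W i.succ)) ≤ d :=
    fun i => hZ i ▸ LinearMap.finrank_le_finrank_of_surjective (f := (f i).restrictScalars K) (hf i)
  have hq : ∀ i : Fin n, FiniteDimensional K (W i.succ ⧸ (W i.castSucc).submoduleOf (W i.succ)) :=
    fun i => Module.Finite.of_surjective ((f i).restrictScalars K) (hf i)
  -- Telescoping bounds $nd=\dim V$ by the sum of the dimensions of the subquotients. Each of these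
  -- is at most $d$, so all inequalities are equalities.
  have htel := le_add_sum_of_succ_le (fun i => Module.finrank K (W i)) _ fun i =>
    finrank_le_add_finrank_quotient (K := K) (hW i.castSucc_lt_succ.le)
  have e0 : Module.finrank K (W 0) = 0 := by
    rw [h0]; exact finrank_bot K V
  have e1 : Module.finrank K (W (Fin.last n)) = n * d := by
    rw [hlast, ← hV]; exact finrank_top K V
  simp only [e0, e1, zero_add] at htel
  have hsum : ∑ i : Fin n, Module.finrank K (W i.succ ⧸ (W i.castSucc).submoduleOf (W i.succ)) =
      ∑ _i : Fin n, d :=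
    le_antisymm (Finset.sum_le_sum fun i _ => hle i) (by simpa using htel)
  have heq := (Finset.sum_eq_sum_iff_of_le fun i _ => hle i).1 hsum i (Finset.mem_univ i)
  refine ⟨?_, hf i⟩
  exact (LinearMap.injective_iff_surjective_of_finrank_eq_finrank
    (f := (f i).restrictScalars K) ((hZ i).trans heq.symm)).2 (hf i)

end Filtration

namespace ReductiveSetup

variable {K : Type*} [Field K] {N : ℕ} {S : ReductiveSetup K N} {p : ℕ} [Fact p.Prime] [CharP K p]

/-- $U_\chi(\mathfrak b)$ is generated by `Lie B`, so a vector on which `Lie B` acts through the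
character of `lam` satisfies the condition for mapping the baby Verma module to $M$. -/
theorem redMap_smul_eq {χ : Module.Dual K S.LieG} (hχ : S.VanishesOnNPlus χ) (lam : S.Lam p χ)
    {M : Type*} [AddCommGroup M] [Module K M] [Module (RedEnv p S.G χ) M]
    [IsScalarTower K (RedEnv p S.G χ) M] {v : M}
    (hv : ∀ x, redι p S.G χ (S.inclB x) • v = S.borelChar lam.1 x • v)
    (a : RedEnv p S.B (resDual S.borel_le_group χ)) :
    redMap p S.borel_le_group χ a • v = weightHom p hχ lam a • v := by
  have ha : a ∈ Algebra.adjoin K (Set.range (redι p S.B (resDual S.borel_le_group χ))) := by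
    rw [adjoin_redι]; exact Algebra.mem_top
  induction ha using Algebra.adjoin_induction with
  | mem a ha =>
    obtain ⟨x, rfl⟩ := ha
    rw [redMap_ι, weightHom, redLift_ι]
    exact hv x
  | algebraMap c => rw [AlgHom.commutes, AlgHom.commutes, algebraMap_smul, algebraMap_smul]
  | add a b _ _ ha hb => rw [map_add, map_add, add_smul, add_smul, ha, hb]
  | mul a b _ _ ha hb =>
    rw [map_mul, map_mul, mul_smul, hb, smul_comm, ha, smul_smul, mul_comm]

theorem borelChar_add (lam mu : Module.Dual K S.LieT) (x : lieAlg S.B) :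
    S.borelChar (lam + mu) x = S.borelChar lam x + S.borelChar mu x := rfl

/-! ### The filtration of a tensor product by highest weight tensors -/

section TensorFiltration

variable {χ χ' : Module.Dual K S.LieG} {M M' : Type*}
  [AddCommGroup M] [Module K M] [Module (RedEnv p S.G χ) M] [IsScalarTower K (RedEnv p S.G χ) M]
  [AddCommGroup M'] [Module K M'] [Module (RedEnv p S.G χ') M']
  [IsScalarTower K (RedEnv p S.G χ') M'] {n : ℕ}

/-- The filtration of a tensor product that is generated by tensors `v ⊗ m j`. -/
def tensorFilt (v : M) (m : Fin n → M') (i : Fin (n + 1)) :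
    Submodule (RedEnv p S.G (χ + χ')) (TensorMod p S.G χ χ' M M') :=
  Submodule.span _ ((fun j => tens p χ χ' M M' v (m j)) '' {j | j.castSucc < i})

variable (v : M) (m : Fin n → M')

theorem tensorFilt_mono : Monotone (tensorFilt (p := p) (χ := χ) (χ' := χ') v m) := fun _ _ h =>
  Submodule.span_mono (Set.image_mono fun _ hj => lt_of_lt_of_le hj h)

theorem tensorFilt_zero : tensorFilt (p := p) (χ := χ) (χ' := χ') v m 0 = ⊥ := by
  simp [tensorFilt]

theorem tens_mem_tensorFilt {j : Fin n} {i : Fin (n + 1)} (h : j.castSucc < i) :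
    tens p χ χ' M M' v (m j) ∈ tensorFilt v m i :=
  Submodule.subset_span ⟨j, h, rfl⟩

theorem tens_span_mem_tensorFilt {i : Fin n} {z : M'}
    (hz : z ∈ Submodule.span K (m '' {j | j < i})) :
    tens p χ χ' M M' v z ∈ tensorFilt v m i.castSucc := by
  induction hz using Submodule.span_induction with
  | mem z hz =>
    obtain ⟨j, hj, rfl⟩ := hz
    exact tens_mem_tensorFilt v m hj
  | zero => rw [map_zero]; exact zero_mem _
  | add a b _ _ ha hb => rw [map_add]; exact add_mem ha hb
  | smul c a _ ha =>
    rw [map_smul]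
    exact ((tensorFilt v m i.castSucc).restrictScalars K).smul_mem c ha

theorem tensorFilt_last {v : M} (hv : Submodule.span (RedEnv p S.G χ) {v} = ⊤)
    (hm : Submodule.span K (Set.range m) = ⊤) :
    tensorFilt (p := p) (χ := χ) (χ' := χ') v m (Fin.last n) = ⊤ := by
  refine eq_top_of_tens_mem p hv _ fun m' => ?_
  have hm' : m' ∈ Submodule.span K (Set.range m) := by rw [hm]; exact Submodule.mem_top
  induction hm' using Submodule.span_induction with
  | mem z hz =>
    obtain ⟨j, rfl⟩ := hz
    exact tens_mem_tensorFilt v m (Fin.castSucc_lt_last j)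
  | zero => rw [map_zero]; exact zero_mem _
  | add a b _ _ ha hb => rw [map_add]; exact add_mem ha hb
  | smul c a _ ha =>
    rw [map_smul]
    exact ((tensorFilt v m (Fin.last n)).restrictScalars K).smul_mem c ha

/-- The class of `v ⊗ m i` in a subquotient of the filtration. -/
def subquotientGen (i : Fin n) : tensorFilt (p := p) (χ := χ) (χ' := χ') v m i.succ ⧸
    (tensorFilt v m i.castSucc).submoduleOf (tensorFilt v m i.succ) :=
  Submodule.Quotient.mk ⟨tens p χ χ' M M' v (m i), tens_mem_tensorFilt v m i.castSucc_lt_succ⟩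

/-- The generators $v\otimes m_j$ with $j<i$ die in the quotient, so only $v\otimes m_i$ is left. -/
theorem span_subquotientGen (i : Fin n) : Submodule.span (RedEnv p S.G (χ + χ'))
    {subquotientGen (p := p) (χ := χ) (χ' := χ') v m i} = ⊤ := by
  rw [← top_le_iff]
  intro z _
  obtain ⟨⟨z, hz⟩, rfl⟩ := Submodule.Quotient.mk_surjective _ z
  refine Submodule.span_induction (p := fun z hz => (Submodule.Quotient.mk
    (⟨z, hz⟩ : tensorFilt (p := p) (χ := χ) (χ' := χ') v m i.succ) :
      _ ⧸ (tensorFilt v m i.castSucc).submoduleOf (tensorFilt v m i.succ)) ∈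
    Submodule.span (RedEnv p S.G (χ + χ')) {subquotientGen v m i}) ?_ ?_ ?_ ?_ hz
  · rintro _ ⟨j, hj, rfl⟩
    rcases (Fin.castSucc_lt_succ_iff.1 hj).lt_or_eq with h | rfl
    · have h0 : tens p χ χ' M M' v (m j) ∈ tensorFilt v m i.castSucc :=
        tens_mem_tensorFilt v m (Fin.castSucc_lt_castSucc_iff.2 h)
      exact Set.mem_of_eq_of_mem ((Submodule.Quotient.mk_eq_zero _).2 h0)
        (zero_mem (Submodule.span (RedEnv p S.G (χ + χ')) {subquotientGen v m i}))
    · exact Submodule.mem_span_singleton_self _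
  · exact zero_mem _
  · exact fun a b _ _ ha hb => add_mem ha hb
  · exact fun c a _ ha => Submodule.smul_mem _ c ha

/-- Since $v$ is an exact eigenvector, the error is $x(v\otimes m_i)-(\lambda+\nu_i)(x)\,v\otimes
m_i=v\otimes(xm_i-\nu_i(x)m_i)$. By triangularity the second factor is a combination of earlier
$m_j$, so the error lies in the previous step of the filtration. -/
theorem inclB_smul_subquotientGen {v : M} {m : Fin n → M'} {lam : Module.Dual K S.LieT}
    {ν : Fin n → Module.Dual K S.LieT}
    (hv : ∀ x, redι p S.G χ (S.inclB x) • v = S.borelChar lam x • v)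
    (hm : ∀ x i, redι p S.G χ' (S.inclB x) • m i - S.borelChar (ν i) x • m i ∈
      Submodule.span K (m '' {j | j < i})) (x : lieAlg S.B) (i : Fin n) :
    redι p S.G (χ + χ') (S.inclB x) • subquotientGen (p := p) (χ := χ) (χ' := χ') v m i =
      S.borelChar (lam + ν i) x • subquotientGen v m i := by
  have h := tens_span_mem_tensorFilt (p := p) (χ := χ) (χ' := χ') v m (hm x i)
  have h2 : redι p S.G (χ + χ') (S.inclB x) • tens p χ χ' M M' v (m i) -
      S.borelChar (lam + ν i) x • tens p χ χ' M M' v (m i) =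
      tens p χ χ' M M' v (redι p S.G χ' (S.inclB x) • m i - S.borelChar (ν i) x • m i) := by
    rw [redι_smul_tens, hv, borelChar_add, map_smul, LinearMap.smul_apply, map_sub,
      (tens p χ χ' M M' v).map_smul (S.borelChar (ν i) x), add_smul]
    abel
  rw [← h2] at h
  exact (Submodule.Quotient.eq ((tensorFilt (p := p) (χ := χ) (χ' := χ') v m i.castSucc).submoduleOf
    (tensorFilt v m i.succ))).2 h

theorem finrank_tensorMod (n n' : ℕ) (h : Module.finrank K M = n) (h' : Module.finrank K M' = n') :
    Module.finrank K (TensorMod p S.G χ χ' M M') = n * n' := by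
  rw [← h, ← h']
  exact Module.finrank_tensorProduct

instance [FiniteDimensional K M] [FiniteDimensional K M'] :
    FiniteDimensional K (TensorMod p S.G χ χ' M M') :=
  inferInstanceAs (FiniteDimensional K (M ⊗[K] M'))

end TensorFiltration

end ReductiveSetup

end ReducedRep

end

set_option linter.unusedSectionVars false

noncomputable section

namespace ReducedRep

/-! ### Sorting the monomials and identifying the subquotients -/

namespace ReductiveSetup

variable {K : Type*} [Field K] {N : ℕ} {S : ReductiveSetup K N} {D : ℕ} (γ : Fin D ≃ S.PosRoots)
  (p : ℕ) [Fact p.Prime] [CharP K p]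

/-- An enumeration of the exponent tuples along which the filtration weights do not decrease. -/
theorem exists_monotone_monWt :
    ∃ b : Fin (p ^ D) ≃ (Fin D → Fin p), Monotone fun i => S.monWt γ p (b i) := by
  let e : Fin (p ^ D) ≃ (Fin D → Fin p) := finFunctionFinEquiv.symm
  exact ⟨(Tuple.sort fun i => S.monWt γ p (e i)).trans e,
    Tuple.monotone_sort fun i => S.monWt γ p (e i)⟩

variable {p} in
theorem span_vac {χ : Module.Dual K S.LieG} (hχ : S.VanishesOnNPlus χ) (lam : S.Lam p χ) :
    Submodule.span (RedEnv p S.G χ) {vac p hχ lam} = ⊤ := span_indGen _ _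

theorem finiteDimensional_babyVerma (γ : Fin D ≃ S.PosRoots) {χ : Module.Dual K S.LieG} (hχ : S.VanishesOnNPlus χ)
    (lam : S.Lam p χ) : FiniteDimensional K (BabyVerma p hχ lam) :=
  (vermaBasis γ p hχ lam).finiteDimensional_of_finite

variable {p} in
theorem span_vermaBasis_comp {χ : Module.Dual K S.LieG} (hχ : S.VanishesOnNPlus χ)
    (mu : S.Lam p χ) {n : ℕ} (b : Fin n ≃ (Fin D → Fin p)) :
    Submodule.span K (Set.range fun i => vermaBasis γ p hχ mu (b i)) = ⊤ := by
  rw [← (vermaBasis γ p hχ mu).span_eq]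
  exact congrArg _ (b.surjective.range_comp _)

variable {p} in
theorem inclB_smul_vermaBasis_comp_sub_mem {χ : Module.Dual K S.LieG} (hχ : S.VanishesOnNPlus χ)
    (mu : S.Lam p χ) {n : ℕ} {b : Fin n ≃ (Fin D → Fin p)}
    (hb : Monotone fun i => S.monWt γ p (b i)) (x : lieAlg S.B) (i : Fin n) :
    redι p S.G χ (S.inclB x) • vermaBasis γ p hχ mu (b i) -
        S.borelChar (S.monChar γ p mu (b i)) x • vermaBasis γ p hχ mu (b i) ∈
      Submodule.span K ((fun i => vermaBasis γ p hχ mu (b i)) '' {j | j < i}) := by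
  -- The off-diagonal terms have strictly smaller weight and hence occur earlier in the enumeration.
  -- The order among monomials of equal weight is irrelevant.
  refine Submodule.span_mono ?_ (inclB_smul_vermaBasis_sub_mem γ p hχ mu x (b i))
  rintro _ ⟨a, ha, rfl⟩
  refine ⟨b.symm a, ?_, congrArg _ (b.apply_symm_apply a)⟩
  by_contra h
  have h1 := hb (not_lt.1 h)
  simp only [Equiv.apply_symm_apply] at h1
  exact absurd ha (not_lt.2 h1)

variable {p} in
/-- If `M` is generated by a vector on which the Borel subalgebra acts by a character, and if the Borel
subalgebra acts on `M'` by triangular matrices, then the subquotients of the filtration of `M ⊗ M'`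
are baby Verma modules, provided that the dimensions allow it. -/
theorem tensorFilt_equiv_babyVerma (γ : Fin D ≃ S.PosRoots) {χ χ' : Module.Dual K S.LieG}
    (hχ : S.VanishesOnNPlus χ)
    (hχ' : S.VanishesOnNPlus χ') {M M' : Type*} [AddCommGroup M] [Module K M]
    [Module (RedEnv p S.G χ) M] [IsScalarTower K (RedEnv p S.G χ) M] [AddCommGroup M'] [Module K M']
    [Module (RedEnv p S.G χ') M'] [IsScalarTower K (RedEnv p S.G χ') M'] [FiniteDimensional K M]
    [FiniteDimensional K M'] (hM : Module.finrank K M = p ^ D) {n : ℕ}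
    (hM' : Module.finrank K M' = n) {v : M} {m : Fin n → M'}
    (hspan : Submodule.span (RedEnv p S.G χ) {v} = ⊤)
    (hspan' : Submodule.span K (Set.range m) = ⊤) {lam : Module.Dual K S.LieT}
    {ν : Fin n → Module.Dual K S.LieT}
    (hv : ∀ x, redι p S.G χ (S.inclB x) • v = S.borelChar lam x • v)
    (hm : ∀ x i, redι p S.G χ' (S.inclB x) • m i - S.borelChar (ν i) x • m i ∈
      Submodule.span K (m '' {j | j < i}))
    (κ : Fin n → S.Lam p (χ + χ')) (hκ : ∀ i, (κ i : Module.Dual K S.LieT) = lam + ν i) (i : Fin n) :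
    Nonempty ((tensorFilt (p := p) (χ := χ) (χ' := χ') v m i.succ ⧸
      (tensorFilt v m i.castSucc).submoduleOf (tensorFilt v m i.succ)) ≃ₗ[RedEnv p S.G (χ + χ')]
      BabyVerma p (hχ.add hχ') (κ i)) := by
  have hgen : ∀ (i : Fin n) x, redι p S.G (χ + χ') (S.inclB x) •
      subquotientGen (p := p) (χ := χ) (χ' := χ') v m i =
      S.borelChar (κ i).1 x • subquotientGen v m i := by
    intro i x
    rw [hκ i]
    exact inclB_smul_subquotientGen hv hm x i
  -- The maps go from the baby Verma modules to the subquotients, as the universal property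
  -- requires. They are inverted only after the dimension count.
  let f : ∀ i : Fin n, BabyVerma p (hχ.add hχ') (κ i) →ₗ[RedEnv p S.G (χ + χ')]
      tensorFilt (p := p) (χ := χ) (χ' := χ') v m i.succ ⧸
        (tensorFilt v m i.castSucc).submoduleOf (tensorFilt v m i.succ) := fun i =>
    indLift _ _ (subquotientGen v m i) (redMap_smul_eq (hχ.add hχ') (κ i) (hgen i))
  have hf : ∀ i, Function.Surjective (f i) := by
    intro i
    rw [← LinearMap.range_eq_top, ← top_le_iff, ← span_subquotientGen, Submodule.span_le,
      Set.singleton_subset_iff]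
    exact ⟨vac p (hχ.add hχ') (κ i), indLift_indGen _ _ _ _⟩
  have hfd := fun i => finiteDimensional_babyVerma p γ (hχ.add hχ') (κ i)
  have hbij := bijective_of_surjective_subquotient (K := K) (tensorFilt v m)
    (tensorFilt_mono v m) (tensorFilt_zero v m) (tensorFilt_last m hspan hspan')
    ((finrank_tensorMod _ _ hM hM').trans (mul_comm _ _))
    (fun i => BabyVerma p (hχ.add hχ') (κ i))
    (fun i => finrank_babyVerma p (hχ.add hχ') (κ i) γ) f hf i
  exact ⟨(LinearEquiv.ofBijective (f i) hbij).symm⟩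

end ReductiveSetup

end ReducedRep

end

theorem theorem2 {K : Type*} [Field K] [IsAlgClosed K] (p : ℕ) [Fact p.Prime] [CharP K p] {N : ℕ}
    (S : ReducedRep.ReductiveSetup K N) (χ χ' : Module.Dual K S.LieG)
    (hχ : S.VanishesOnNPlus χ) (hχ' : S.VanishesOnNPlus χ')
    (lam : S.Lam p χ) (mu : S.Lam p χ') (D : ℕ) (γ : Fin D ≃ S.PosRoots) :
    ∃ (W : Fin (p ^ D + 1) → Submodule (ReducedRep.RedEnv p S.G (χ + χ'))
        (ReducedRep.TensorMod p S.G χ χ' (ReducedRep.ReductiveSetup.BabyVerma p hχ lam)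
          (ReducedRep.ReductiveSetup.BabyVerma p hχ' mu)))
      (b : Fin (p ^ D) ≃ (Fin D → Fin p)),
      Monotone W ∧ W 0 = ⊥ ∧ W (Fin.last (p ^ D)) = ⊤ ∧
      ∀ i : Fin (p ^ D), ∃ hν : (lam : Module.Dual K S.LieT) + mu -
          ∑ j, (b i j : ℕ) • ReducedRep.charDiff (γ j).1.1 ∈ S.Lam p (χ + χ'),
        Nonempty ((W i.succ ⧸ (W i.castSucc).submoduleOf (W i.succ)) ≃ₗ[ReducedRep.RedEnv p S.G
            (χ + χ')] ReducedRep.ReductiveSetup.BabyVerma p (hχ.add hχ')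
            ⟨(lam : Module.Dual K S.LieT) + mu -
              ∑ j, (b i j : ℕ) • ReducedRep.charDiff (γ j).1.1, hν⟩) := by
  have hb := (ReducedRep.ReductiveSetup.exists_monotone_monWt γ p).choose_spec
  let b := (ReducedRep.ReductiveSetup.exists_monotone_monWt γ p).choose
  -- The weight is regrouped as $\lambda+\nu_i$, where $\nu_i$ is the torus weight of the $i$-th
  -- basis vector of the second factor.
  have hκ : ∀ i, (lam : Module.Dual K S.LieT) + mu -
      ∑ j, (b i j : ℕ) • ReducedRep.charDiff (γ j).1.1 = lam + S.monChar γ p mu (b i) :=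
    fun i => add_sub_assoc _ _ _
  have hν : ∀ i, (lam : Module.Dual K S.LieT) + mu -
      ∑ j, (b i j : ℕ) • ReducedRep.charDiff (γ j).1.1 ∈ S.Lam p (χ + χ') := fun i => by
    rw [hκ]
    exact ReducedRep.ReductiveSetup.add_mem_Lam p lam.2
      (ReducedRep.ReductiveSetup.monChar_mem_Lam γ p mu (b i))
  have hfd := ReducedRep.ReductiveSetup.finiteDimensional_babyVerma p γ hχ lam
  have hfd' := ReducedRep.ReductiveSetup.finiteDimensional_babyVerma p γ hχ' mu
  refine ⟨ReducedRep.ReductiveSetup.tensorFilt (ReducedRep.ReductiveSetup.vac p hχ lam)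
      fun i => ReducedRep.ReductiveSetup.vermaBasis γ p hχ' mu (b i), b,
    ReducedRep.ReductiveSetup.tensorFilt_mono _ _, ReducedRep.ReductiveSetup.tensorFilt_zero _ _,
    ReducedRep.ReductiveSetup.tensorFilt_last _ (ReducedRep.ReductiveSetup.span_vac hχ lam)
      (ReducedRep.ReductiveSetup.span_vermaBasis_comp γ hχ' mu b), fun i => ⟨hν i, ?_⟩⟩
  exact ReducedRep.ReductiveSetup.tensorFilt_equiv_babyVerma γ hχ hχ'
    (ReducedRep.ReductiveSetup.finrank_babyVerma p hχ lam γ)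
    (ReducedRep.ReductiveSetup.finrank_babyVerma p hχ' mu γ)
    (ReducedRep.ReductiveSetup.span_vac hχ lam)
    (ReducedRep.ReductiveSetup.span_vermaBasis_comp γ hχ' mu b)
    (ReducedRep.ReductiveSetup.inclB_smul_vac p hχ lam)
    (ReducedRep.ReductiveSetup.inclB_smul_vermaBasis_comp_sub_mem γ hχ' mu hb)
    (fun i => ⟨_, hν i⟩) hκ i
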